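/- **Setting.** Let $M$ be a finite-dimensional smooth manifold without boundary and let $\mathcal T\to M$ be a natural vector or affine bundle of finite order, i.e. a bundle associated with a (higher order) frame bundle of $M$ through a smooth linear or affine action of the jet group on a finite-dimensional vector space (tensors, pseudo-tensors, densities, linear connections, and direct sums of these). Let $\Phi=\Gamma(\mathcal T)$ be the space of smooth sections, on which diffeomorphisms of $M$ act by pullback $\varphi\mapsto\psi^*\varphi$. Its tangent space at any point is the space of smooth sections of the vector bundle $\vec{\mathcal T}$ on which $\mathcal T$ is modelled. A map between such function spaces (and $\mathbb R$) is *smooth* if it sends smooth finite-dimensional families (families jointly smooth in the parameter and in the point of $M$) to smooth families; differential forms on $\Phi$ are alternating forms depending smoothly on the base point and the arguments in this sense. Derivatives $(DF)_\varphi(h)=\frac{d}{dt}\big|_{0}F(\varphi+th)$ are directional derivatives, vector fields on $\Phi$ are smooth maps $\mathfrak X:\Phi\to\Gamma(\vec{\mathcal T})$ with bracket $[\mathfrak X,\mathfrak Y]=D\mathfrak Y(\mathfrak X)-D\mathfrak X(\mathfrak Y)$, and $d$ is the exterior derivative. Let $\mathrm{diff}(M)=\Gamma(TM)$ with the bracket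 $[X,Y]_{\mathrm{diff}}=-[X,Y]_{\Gamma(TM)}$, and let $C^\infty(\Phi,\mathrm{diff}(M))$ be the real vector space of smooth field-dependent vector fields on $M$, with the pointwise bracket $[\,,]_{\mathrm{diff}}$. For $X\in C^\infty(\Phi,\mathrm{diff}(M))$ let $X^v$ be the vertical vector field $X^v|_\varphi=\mathfrak L_{X(\varphi)}\varphi$ on $\Phi$ ($\mathfrak L$ the Lie derivative), let $X^v(Y)=DY(X^v)$, and put $$\{X,Y\}=[X,Y]_{\mathrm{diff}}+X^v(Y)-Y^v(X).$$ For $K\in\Omega^k(\Phi;T\Phi)$ let $\iota_K$ be the insertion $$(\iota_K\alpha)(h_1,\dots,h_{k+q})=\tfrac1{k!\,q!}\sum_{\sigma}\mathrm{sgn}(\sigma)\,\alpha\big(K(h_{\sigma(1)},\dots,h_{\sigma(k)}),h_{\sigma(k+1)},\dots,h_{\sigma(k+q)}\big)$$ for $\alpha$ of degree $q+1$, and $\iota_K=0$ on degree $0$. Let $L_K=\iota_Kd-(-1)^{k-1}d\iota_K$ be the Nijenhuis–Lie derivative on real-valued forms, and $[K,J]_{\mathrm{NR}}=\iota_KJ-(-1)^{(k-1)(l-1)}\iota_JK$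 for $J\in\Omega^l(\Phi;T\Phi)$. The Frölicher–Nijenhuis bracket $[K,J]_{\mathrm{FN}}\in\Omega^{k+l}(\Phi;T\Phi)$ is defined by $L_{[K,J]_{\mathrm{FN}}}=L_KL_J-(-1)^{kl}L_JL_K$ on $\Omega^\bullet(\Phi)$. For $Y\in C^\infty(\Phi,\mathrm{diff}(M))$ let $(dY)^v\in\Omega^1(\Phi;T\Phi)$ be $(dY)^v_\varphi(h)=\mathfrak L_{(dY)_\varphi(h)}\varphi$. **Theorem.** 0. Let $X\in C^\infty(\Phi,\mathrm{diff}(M))$ and $\varphi\in\Phi$. If $\psi_\tau$ is a smooth curve of diffeomorphisms of $M$ with $\psi_0=\mathrm{id}_M$ and $\frac{d}{d\tau}\big|_0\psi_\tau=X(\varphi)$, then $X^v|_\varphi=\frac{d}{d\tau}\big|_0\psi_\tau^*\varphi$, in every local parametrization of $M$. 1. The bracket $\{\,,\}$ is a Lie bracket on $C^\infty(\Phi,\mathrm{diff}(M))$, the bracket $[\,,]$ is a Lie bracket on the vector fields on $\Phi$, and $X\mapsto X^v$ is a morphism of real Lie algebras between them: it is $\mathbb R$-linear and $$[X^v,Y^v]=\{X,Y\}^v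 .$$ 2. For all $X,Y\in C^\infty(\Phi,\mathrm{diff}(M))$, the vector field $\{X,Y\}^v$ is the Frölicher–Nijenhuis bracket of the vector-valued $0$-forms $X^v$ and $Y^v$, i.e. it is the unique $N\in\Omega^0(\Phi;T\Phi)$ with $L_N=L_{X^v}L_{Y^v}-L_{Y^v}L_{X^v}$ on $\Omega^\bullet(\Phi)$, and $$\{X,Y\}^v=([X,Y]_{\mathrm{diff}})^v+[X^v,(dY)^v]_{\mathrm{NR}}-[Y^v,(dX)^v]_{\mathrm{NR}},\qquad [X^v,(dY)^v]_{\mathrm{NR}}=\big(X^v(Y)\big)^v .$$ 3. Consequently $[L_{X^v},L_{Y^v}]=L_{\{X,Y\}^v}$ on differential forms of every degree on $\Phi$. -/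

import Mathlib

open Set Filter Function
open scoped Topology Manifold ContDiff
open Diffeology

set_option linter.unusedSectionVars false

namespace FieldSpace

section LocalCalculus

variable {E : Type*} [NormedAddCommGroup E] [NormedSpace ℝ E]
  {F : Type*} [NormedAddCommGroup F] [NormedSpace ℝ F]
  {G : Type*} [NormedAddCommGroup G] [NormedSpace ℝ G]

/-- `f` is a local diffeomorphism at `u`: it is smooth near `u`, with invertible derivative at
`u`. -/
def IsLocDiffeo (f : E → E) (u : E) : Prop :=
  (∀ᶠ w in 𝓝 u, ContDiffAt ℝ ∞ f w) ∧ (fderiv ℝ f u).IsInvertible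

/-- The space of jets of orders `1, …, r + 1` of maps `E → E` at a point. -/
abbrev Jet (E : Type*) [NormedAddCommGroup E] [NormedSpace ℝ E] (r : ℕ) : Type _ :=
  (i : Fin (r + 1)) → ContinuousMultilinearMap ℝ (fun _ : Fin (i.val + 1) => E) E

/-- The derivatives of orders `1, …, r + 1` of `f` at `u`. -/
noncomputable def jet (r : ℕ) (f : E → E) (u : E) : Jet E r :=
  fun i => iteratedFDeriv ℝ (i.val + 1) f u

/-- The first order part of a jet. -/
noncomputable def linPart {r : ℕ} (j : Jet E r) : E →L[ℝ] E :=
  continuousMultilinearCurryFin1 ℝ E E (j 0)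

lemma linPart_jet (r : ℕ) (f : E → E) (u : E) : linPart (jet r f u) = fderiv ℝ f u := by
  ext v
  simp [linPart, jet]

lemma linPart_continuous {r : ℕ} : Continuous (linPart : Jet E r → E →L[ℝ] E) := by
  unfold linPart
  exact (continuousMultilinearCurryFin1 ℝ E E).continuous.comp (continuous_apply _)

lemma isOpen_invertible [CompleteSpace E] : IsOpen {L : E →L[ℝ] E | L.IsInvertible} :=
  ContinuousLinearEquiv.isOpen

lemma contDiffAt_iteratedFDeriv_param (c : F → E → G) (i : ℕ) (z : F × E)
    (h : ContDiffAt ℝ ∞ (uncurry c) z) :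
    ContDiffAt ℝ ∞ (fun z : F × E => iteratedFDeriv ℝ i (c z.1) z.2) z := by
  induction i with
  | zero =>
    have : (fun z : F × E => iteratedFDeriv ℝ 0 (c z.1) z.2) =
      fun z => (continuousMultilinearCurryFin0 ℝ E G).symm (uncurry c z) := by
      ext z m; simp [uncurry]
    rw [this]
    exact (continuousMultilinearCurryFin0 ℝ E G).symm.contDiff.contDiffAt.comp z h
  | succ i ih =>
    have : (fun z : F × E => iteratedFDeriv ℝ (i + 1) (c z.1) z.2) = fun z =>
      (continuousMultilinearCurryLeftEquiv ℝ (fun _ : Fin (i + 1) => E) G).symm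
        (fderiv ℝ (iteratedFDeriv ℝ i (c z.1)) z.2) := by
      ext1 z; rw [iteratedFDeriv_succ_eq_comp_left]; rfl
    rw [this]
    have he : ContDiff ℝ ∞ (fun L : E →L[ℝ] ContinuousMultilinearMap ℝ (fun _ : Fin i => E) G =>
      (continuousMultilinearCurryLeftEquiv ℝ (fun _ : Fin (i + 1) => E) G).symm L) := by
      fun_prop
    refine he.contDiffAt.comp z ?_
    refine ContDiffAt.fderiv (f := fun z : F × E => iteratedFDeriv ℝ i (c z.1)) (g := Prod.snd)
      (n := ∞) ?_ contDiffAt_snd (by simp)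
    exact ContDiffAt.comp (g := fun z : F × E => iteratedFDeriv ℝ i (c z.1) z.2)
      (f := fun w : (F × E) × E => (w.1.1, w.2)) (z, z.2) ih
      ((contDiffAt_fst.comp _ contDiffAt_fst).prodMk contDiffAt_snd)

lemma contDiffAt_jet_param {r : ℕ} (c : F → E → E) (z : F × E)
    (h : ContDiffAt ℝ ∞ (uncurry c) z) :
    ContDiffAt ℝ ∞ (fun z : F × E => jet r (c z.1) z.2) z :=
  contDiffAt_pi.2 fun _ => contDiffAt_iteratedFDeriv_param c _ z h

lemma hasDerivAt_fderiv_swap (c : ℝ → E → G) (τ : ℝ) (u : E)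
    (h : ContDiffAt ℝ ∞ (uncurry c) (τ, u)) :
    HasDerivAt (fun t => fderiv ℝ (c t) u) (fderiv ℝ (fun w => deriv (fun t => c t w) τ) u) τ := by
  have h2 : ContDiffAt ℝ 2 (uncurry c) (τ, u) := h.of_le (WithTop.coe_le_coe.2 (le_top : (2 : ℕ∞) ≤ ⊤))
  have hd : ∀ᶠ z in 𝓝 (τ, u), DifferentiableAt ℝ (uncurry c) z :=
    (h2.eventually (by simp)).mono fun z hz => hz.differentiableAt (by simp)
  have hD : DifferentiableAt ℝ (fderiv ℝ (uncurry c)) (τ, u) :=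
    (h2.fderiv_right (m := 1) (by norm_num)).differentiableAt (by simp)
  have e1 : ∀ z : ℝ × E, DifferentiableAt ℝ (uncurry c) z →
      fderiv ℝ (c z.1) z.2 = (fderiv ℝ (uncurry c) z).comp (ContinuousLinearMap.inr ℝ ℝ E) := by
    intro z hz
    exact (HasFDerivAt.comp (g := uncurry c) (f := fun w => (z.1, w)) z.2 hz.hasFDerivAt
      (hasFDerivAt_prodMk_right z.1 z.2)).fderiv
  have e2 : ∀ z : ℝ × E, DifferentiableAt ℝ (uncurry c) z →
      deriv (fun t => c t z.2) z.1 = fderiv ℝ (uncurry c) z (1, 0) := by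
    intro z hz
    have := (HasFDerivAt.comp (g := uncurry c) (f := fun t => (t, z.2)) z.1 hz.hasFDerivAt
      (hasFDerivAt_prodMk_left z.1 z.2)).hasDerivAt.deriv
    simpa [Function.comp_def, uncurry] using this
  have t1 : ∀ᶠ t in 𝓝 τ, fderiv ℝ (c t) u =
      (fderiv ℝ (uncurry c) (t, u)).comp (ContinuousLinearMap.inr ℝ ℝ E) :=
    ((Continuous.prodMk_left u).tendsto τ |>.eventually hd).mono fun t ht => e1 (t, u) ht
  have t2 : (fun w => deriv (fun t => c t w) τ) =ᶠ[𝓝 u]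
      fun w => fderiv ℝ (uncurry c) (τ, w) (1, 0) :=
    ((Continuous.prodMk_right τ).tendsto u |>.eventually hd).mono fun w hw => e2 (τ, w) hw
  have d1 : HasDerivAt (fun t => fderiv ℝ (uncurry c) (t, u))
      (fderiv ℝ (fderiv ℝ (uncurry c)) (τ, u) (1, 0)) τ := by
    exact ((HasFDerivAt.comp (g := fderiv ℝ (uncurry c)) (f := fun t => (t, u)) τ hD.hasFDerivAt
      (hasFDerivAt_prodMk_left τ u)).hasDerivAt).congr_deriv (by simp)
  have d2 : HasFDerivAt (fun w => fderiv ℝ (uncurry c) (τ, w))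
      ((fderiv ℝ (fderiv ℝ (uncurry c)) (τ, u)).comp (ContinuousLinearMap.inr ℝ ℝ E)) u :=
    hD.hasFDerivAt.comp u (hasFDerivAt_prodMk_right τ u)
  have d3 := d2.clm_apply (hasFDerivAt_const ((1 : ℝ), (0 : E)) u)
  have d4 := (d1.clm_comp (hasDerivAt_const τ (ContinuousLinearMap.inr ℝ ℝ E)))
  rw [t2.fderiv_eq, d3.fderiv]
  refine HasDerivAt.congr_of_eventuallyEq ?_ t1
  refine d4.congr_deriv ?_
  ext v
  have sym := h2.isSymmSndFDerivAt (by simp)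
  simpa using (sym (0, v) (1, 0)).symm

/-- Mixed partials: time derivative of the iterated space derivatives. -/
lemma hasDerivAt_iteratedFDeriv (κ : ℝ → E → G) (i : ℕ) (τ : ℝ) (u : E)
    (h : ∀ᶠ w in 𝓝 u, ContDiffAt ℝ ∞ (uncurry κ) (τ, w)) :
    HasDerivAt (fun t => iteratedFDeriv ℝ i (κ t) u)
      (iteratedFDeriv ℝ i (fun w => deriv (fun t => κ t w) τ) u) τ := by
  induction i generalizing u with
  | zero =>
    have hd : HasDerivAt (fun t => κ t u) (deriv (fun t => κ t u) τ) τ := by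
      have := (h.self_of_nhds.differentiableAt (by simp)).comp τ
        (f := fun t => (t, u)) (by fun_prop)
      exact this.hasDerivAt
    let e := (continuousMultilinearCurryFin0 ℝ E
      G).symm.toContinuousLinearEquiv.toContinuousLinearMap
    exact (e.hasFDerivAt (x := κ τ u)).comp_hasDerivAt τ hd
  | succ i ih =>
    have e : ∀ᶠ w in 𝓝 u, deriv (fun t => iteratedFDeriv ℝ i (κ t) w) τ =
        iteratedFDeriv ℝ i (fun w => deriv (fun t => κ t w) τ) w :=
      h.eventually_nhds.mono fun w hw => (ih w hw).deriv
    have := hasDerivAt_fderiv_swap (fun t w => iteratedFDeriv ℝ i (κ t) w) τ u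
      (contDiffAt_iteratedFDeriv_param κ i (τ, u) h.self_of_nhds)
    rw [EventuallyEq.fderiv_eq e] at this
    let e := (continuousMultilinearCurryLeftEquiv ℝ
      (fun _ : Fin (i + 1) => E) G).symm.toContinuousLinearEquiv.toContinuousLinearMap
    exact (e.hasFDerivAt (x := fderiv ℝ (iteratedFDeriv ℝ i (κ τ)) u)).comp_hasDerivAt τ this

end LocalCalculus

section Fields

variable {E : Type*} [NormedAddCommGroup E] [NormedSpace ℝ E]
  {V : Type*} [NormedAddCommGroup V] [NormedSpace ℝ V]
  {M : Type*} [TopologicalSpace M] [ChartedSpace E M] {r : ℕ}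

/-- A smooth affine right action `v ↦ v · j` of the group of jets of order `r + 1` of local
diffeomorphisms of `E` fixing the origin, on the vector space `V`.  Such actions are the standard
fibres of the natural vector and affine bundles of order at most `r + 1`, that is of the bundles
associated with the frame bundles of manifolds modelled on `E` (tensors, pseudo-tensors, densities,
linear connections, and their direct sums). -/
structure AffineJetAction (E : Type*) [NormedAddCommGroup E] [NormedSpace ℝ E]
    (V : Type*) [NormedAddCommGroup V] [NormedSpace ℝ V] (r : ℕ) where
  /-- The action of a jet. -/
  act : Jet E r → V →ᵃ[ℝ] V
  act_id : act (jet r id 0) = AffineMap.id ℝ V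
  act_comp : ∀ f g : E → E, f 0 = 0 → g 0 = 0 → IsLocDiffeo f 0 → IsLocDiffeo g 0 →
    act (jet r (f ∘ g) 0) = (act (jet r g 0)).comp (act (jet r f 0))
  smooth : ContDiffOn ℝ ∞ (fun q : Jet E r × V => act q.1 q.2) {q | (linPart q.1).IsInvertible}

/-- The linear part of an affine action. -/
def AffineJetAction.lin (A : AffineJetAction E V r) : AffineJetAction E V r where
  act j := (A.act j).linear.toAffineMap
  act_id := by rw [A.act_id]; rfl
  act_comp f g hf hg hf' hg' := by rw [A.act_comp f g hf hg hf' hg']; rfl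
  smooth := by
    have h0 : ContDiffOn ℝ ∞ (fun q : Jet E r × V => A.act q.1 (0 : V))
        {q | (linPart q.1).IsInvertible} :=
      A.smooth.comp (f := fun q : Jet E r × V => (q.1, (0 : V)))
        (contDiff_fst.prodMk contDiff_const).contDiffOn (fun q hq => hq)
    refine (A.smooth.sub h0).congr fun q _ => ?_
    have := (A.act q.1).linearMap_vsub q.2 0
    simpa using this

/-- `p` is a local parametrization of `M` at `u`: it is smooth near `u`, with invertible
derivative at `u`. -/
def IsParam (p : E → M) (u : E) : Prop :=
  (∀ᶠ w in 𝓝 u, ContMDiffAt 𝓘(ℝ, E) 𝓘(ℝ, E) ∞ p w) ∧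
    (mfderiv 𝓘(ℝ, E) 𝓘(ℝ, E) p u).IsInvertible

/-- A section of the natural bundle over `M` with standard fibre `A`, given by its components
`s p : E → V` in the local parametrizations `p` of `M`: the components are smooth and obey the
transformation law `s (p ∘ f) u = s p (f u) · j_u f`.  (The value of `s p` at the points where `p`
is not a local parametrization is normalized to be zero.) -/
structure IsSection (A : AffineJetAction E V r) (s : (E → M) → E → V) : Prop where
  smooth : ∀ (p : E → M) (u : E), IsParam p u → ContDiffAt ℝ ∞ (s p) u
  transform : ∀ (p q : E → M) (f : E → E) (u : E), IsParam p (f u) → IsLocDiffeo f u →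
    q =ᶠ[𝓝 u] p ∘ f → s q u = A.act (jet r f u) (s p (f u))
  zero_off : ∀ (p : E → M) (u : E), ¬ IsParam p u → s p u = 0

variable [IsManifold 𝓘(ℝ, E) ∞ M]

lemma isParam_iff_chart {p : E → M} {u : E} (hp : ∀ᶠ w in 𝓝 u, ContMDiffAt 𝓘(ℝ, E) 𝓘(ℝ, E) ∞ p w)
    {x : M} (hx : p u ∈ (extChartAt 𝓘(ℝ, E) x).source) :
    (mfderiv 𝓘(ℝ, E) 𝓘(ℝ, E) p u).IsInvertible ↔
      (fderiv ℝ (extChartAt 𝓘(ℝ, E) x ∘ p) u).IsInvertible := by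
  have h1 : MDifferentiableAt 𝓘(ℝ, E) 𝓘(ℝ, E) p u := hp.self_of_nhds.mdifferentiableAt (by simp)
  have h2 : MDifferentiableAt 𝓘(ℝ, E) 𝓘(ℝ, E) (extChartAt 𝓘(ℝ, E) x) (p u) :=
    (contMDiffAt_extChartAt' (n := ∞) (by simpa using hx)).mdifferentiableAt (by simp)
  have h3 := isInvertible_mfderiv_extChartAt (I := 𝓘(ℝ, E)) hx
  rw [← mfderiv_eq_fderiv, mfderiv_comp u h2 h1]
  obtain ⟨e, he⟩ := h3
  rw [← he]
  exact (ContinuousLinearMap.isInvertible_equiv_comp (e := e)).symm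

lemma eventually_smooth_chart {p : E → M} {u : E}
    (hp : ∀ᶠ w in 𝓝 u, ContMDiffAt 𝓘(ℝ, E) 𝓘(ℝ, E) ∞ p w)
    {x : M} (hx : p u ∈ (extChartAt 𝓘(ℝ, E) x).source) :
    ∀ᶠ w in 𝓝 u, p w ∈ (extChartAt 𝓘(ℝ, E) x).source ∧
      ContDiffAt ℝ ∞ (extChartAt 𝓘(ℝ, E) x ∘ p) w := by
  have hc : ContinuousAt p u := hp.self_of_nhds.continuousAt
  filter_upwards [hp, hc.preimage_mem_nhds ((isOpen_extChartAt_source x).mem_nhds hx)] with w hw hw'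
  refine ⟨hw', ?_⟩
  rw [← contMDiffAt_iff_contDiffAt]
  exact (contMDiffAt_extChartAt' (n := ∞) (by simpa using hw')).comp w hw

lemma IsParam.eventually [CompleteSpace E] {p : E → M} {u : E} (hp : IsParam p u) :
    ∀ᶠ w in 𝓝 u, IsParam p w := by
  have hx : p u ∈ (extChartAt 𝓘(ℝ, E) (p u)).source := mem_extChartAt_source _
  have hs := eventually_smooth_chart hp.1 hx
  have hi := (isParam_iff_chart hp.1 hx).1 hp.2
  have hcont : ContinuousAt (fderiv ℝ (extChartAt 𝓘(ℝ, E) (p u) ∘ p)) u :=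
    (hs.self_of_nhds.2.fderiv_right (m := 0) (by simp)).continuousAt
  filter_upwards [hp.1.eventually_nhds, hs,
    hcont.preimage_mem_nhds (isOpen_invertible.mem_nhds hi)] with w h1 h2 h3
  exact ⟨h1, (isParam_iff_chart h1 h2.1).2 h3⟩

lemma IsParam.contMDiffAt {p : E → M} {u : E} (hp : IsParam p u) :
    ContMDiffAt 𝓘(ℝ, E) 𝓘(ℝ, E) ∞ p u := hp.1.self_of_nhds

lemma IsParam.mdifferentiableAt {p : E → M} {u : E} (hp : IsParam p u) :
    MDifferentiableAt 𝓘(ℝ, E) 𝓘(ℝ, E) p u := hp.contMDiffAt.mdifferentiableAt (by simp)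

lemma IsLocDiffeo.eventually [CompleteSpace E] {f : E → E} {u : E} (hf : IsLocDiffeo f u) :
    ∀ᶠ w in 𝓝 u, IsLocDiffeo f w := by
  have hcont : ContinuousAt (fderiv ℝ f) u :=
    (hf.1.self_of_nhds.fderiv_right (m := 0) (by simp)).continuousAt
  filter_upwards [hf.1.eventually_nhds, hcont.preimage_mem_nhds (isOpen_invertible.mem_nhds hf.2)]
    with w h1 h2 using ⟨h1, h2⟩

lemma IsParam.comp {p q : E → M} {f : E → E} {u : E} (hp : IsParam p (f u)) (hf : IsLocDiffeo f u)
    (hq : q =ᶠ[𝓝 u] p ∘ f) : IsParam q u := by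
  have hfc : ContinuousAt f u := hf.1.self_of_nhds.continuousAt
  constructor
  · filter_upwards [hq.eventually_nhds, hf.1, hfc.eventually hp.1] with w h1 h2 h3
    exact (h3.comp w h2.contMDiffAt).congr_of_eventuallyEq h1
  · rw [hq.mfderiv_eq, mfderiv_comp u hp.mdifferentiableAt
      (hf.1.self_of_nhds.differentiableAt (by simp)).mdifferentiableAt, mfderiv_eq_fderiv]
    exact hp.2.comp hf.2

end Fields

section Fields

variable {E : Type*} [NormedAddCommGroup E] [NormedSpace ℝ E] [FiniteDimensional ℝ E]
  {V : Type*} [NormedAddCommGroup V] [NormedSpace ℝ V]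
  {M : Type*} [TopologicalSpace M] [ChartedSpace E M] [IsManifold 𝓘(ℝ, E) ∞ M] {r : ℕ}

lemma AffineJetAction.contDiffAt (A : AffineJetAction E V r) {q : Jet E r × V}
    (hq : (linPart q.1).IsInvertible) :
    ContDiffAt ℝ ∞ (fun q : Jet E r × V => A.act q.1 q.2) q := by
  have : CompleteSpace E := FiniteDimensional.complete ℝ E
  exact A.smooth.contDiffAt
    ((isOpen_invertible.preimage (linPart_continuous.comp continuous_fst)).mem_nhds hq)

/-- The derivative of `A.act j' (s c x')` at `(j', x') = (j, x)` in the direction `(dj, dx)`. -/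
noncomputable def variation (A : AffineJetAction E V r) (s : (E → M) → E → V) (c : E → M)
    (j : Jet E r) (x : E) (dj : Jet E r) (dx : E) : V :=
  fderiv ℝ (fun q : Jet E r × V => A.act q.1 q.2) (j, s c x) (dj, fderiv ℝ (s c) x dx)

lemma eventually_isLocDiffeo {κ : ℝ → E → E} {u : E}
    (hκ : ∀ᶠ z in 𝓝 ((0 : ℝ), u), ContDiffAt ℝ ∞ (uncurry κ) z)
    (hinv : (fderiv ℝ (κ 0) u).IsInvertible) : ∀ᶠ t in 𝓝 (0 : ℝ), IsLocDiffeo (κ t) u := by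
  have : CompleteSpace E := FiniteDimensional.complete ℝ E
  have h0 : ContDiffAt ℝ ∞ (uncurry κ) ((0 : ℝ), u) := hκ.self_of_nhds
  have hjc : ContDiffAt ℝ ∞ (fun t : ℝ => jet 0 (κ t) u) 0 :=
    (contDiffAt_jet_param κ ((0 : ℝ), u) h0).comp (0 : ℝ) (f := fun t : ℝ => (t, u))
      (contDiffAt_id.prodMk contDiffAt_const)
  have e1 : ∀ᶠ t in 𝓝 (0 : ℝ), ∀ᶠ w in 𝓝 u, ContDiffAt ℝ ∞ (uncurry κ) (t, w) := by
    have := (Continuous.prodMk_left u).tendsto (0 : ℝ) |>.eventually hκ.eventually_nhds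
    exact this.mono fun t ht => (Continuous.prodMk_right t).tendsto u |>.eventually ht
  have e2 : ∀ᶠ t in 𝓝 (0 : ℝ), (fderiv ℝ (κ t) u).IsInvertible := by
    have hcont : ContinuousAt (fun t : ℝ => linPart (jet 0 (κ t) u)) 0 :=
      linPart_continuous.continuousAt.comp hjc.continuousAt
    have := hcont.preimage_mem_nhds (isOpen_invertible.mem_nhds
      (by simpa [linPart_jet] using hinv))
    filter_upwards [this] with t ht
    simpa [linPart_jet] using ht
  filter_upwards [e1, e2] with t h1 h2
  exact ⟨h1.mono fun w hw => hw.comp w (f := fun w => (t, w))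
    (contDiffAt_const.prodMk contDiffAt_id), h2⟩

lemma hasDerivAt_family {A : AffineJetAction E V r} {s : (E → M) → E → V} (hs : IsSection A s)
    {c : E → M} {κ : ℝ → E → E} {u : E}
    (hκ : ∀ᶠ z in 𝓝 ((0 : ℝ), u), ContDiffAt ℝ ∞ (uncurry κ) z)
    (hinv : (fderiv ℝ (κ 0) u).IsInvertible) (hc : IsParam c (κ 0 u))
    {P : ℝ → E → M} (hP : ∀ᶠ t in 𝓝 (0 : ℝ), P t =ᶠ[𝓝 u] c ∘ κ t) :
    HasDerivAt (fun t => s (P t) u) (variation A s c (jet r (κ 0) u) (κ 0 u)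
      (jet r (fun w => deriv (fun t => κ t w) 0) u) (deriv (fun t => κ t u) 0)) 0 := by
  have : CompleteSpace E := FiniteDimensional.complete ℝ E
  have h0 : ContDiffAt ℝ ∞ (uncurry κ) ((0 : ℝ), u) := hκ.self_of_nhds
  have hline : ∀ᶠ w in 𝓝 u, ContDiffAt ℝ ∞ (uncurry κ) ((0 : ℝ), w) :=
    (Continuous.prodMk_right (0 : ℝ)).tendsto u |>.eventually hκ
  have hk : ContDiffAt ℝ ∞ (fun t : ℝ => κ t u) 0 :=
    h0.comp (0 : ℝ) (f := fun t : ℝ => (t, u)) (contDiffAt_id.prodMk contDiffAt_const)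
  have hjc : ContDiffAt ℝ ∞ (fun t : ℝ => jet r (κ t) u) 0 :=
    (contDiffAt_jet_param κ ((0 : ℝ), u) h0).comp (0 : ℝ) (f := fun t : ℝ => (t, u))
      (contDiffAt_id.prodMk contDiffAt_const)
  have hj : HasDerivAt (fun t : ℝ => jet r (κ t) u)
      (jet r (fun w => deriv (fun t => κ t w) 0) u) 0 :=
    hasDerivAt_pi.2 fun i => hasDerivAt_iteratedFDeriv κ _ 0 u hline
  have hloc := eventually_isLocDiffeo hκ hinv
  have hpar : ∀ᶠ t in 𝓝 (0 : ℝ), IsParam c (κ t u) := hk.continuousAt.eventually hc.eventually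
  have heq : (fun t => s (P t) u) =ᶠ[𝓝 0]
      fun t => A.act (jet r (κ t) u) (s c (κ t u)) := by
    filter_upwards [hloc, hpar, hP] with t h1 h2 h3
    exact hs.transform c (P t) (κ t) u h2 h1 h3
  refine HasDerivAt.congr_of_eventuallyEq ?_ heq
  have hv : HasDerivAt (fun t : ℝ => s c (κ t u))
      (fderiv ℝ (s c) (κ 0 u) (deriv (fun t => κ t u) 0)) 0 :=
    ((hs.smooth c _ hc).differentiableAt (by simp)).hasFDerivAt.comp_hasDerivAt (0 : ℝ)
      (hk.differentiableAt (by simp)).hasDerivAt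
  have hA := (A.contDiffAt (q := (jet r (κ 0) u, s c (κ 0 u)))
    (by simpa [linPart_jet] using hinv)).differentiableAt (by simp)
  exact HasFDerivAt.comp_hasDerivAt (f := fun t : ℝ => (jet r (κ t) u, s c (κ t u)))
    (0 : ℝ) hA.hasFDerivAt (hj.prodMk hv)

end Fields

section Fields

variable {E : Type*} [NormedAddCommGroup E] [NormedSpace ℝ E] [FiniteDimensional ℝ E]
  {V : Type*} [NormedAddCommGroup V] [NormedSpace ℝ V] [FiniteDimensional ℝ V]
  {M : Type*} [TopologicalSpace M] [ChartedSpace E M] [IsManifold 𝓘(ℝ, E) ∞ M] {r : ℕ}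

/-- `Γ(TM)`, the smooth vector fields on `M`. -/
abbrev VecField (E M : Type*) [NormedAddCommGroup E] [NormedSpace ℝ E]
    [TopologicalSpace M] [ChartedSpace E M] [IsManifold 𝓘(ℝ, E) ∞ M] : Type _ :=
  ContMDiffSection 𝓘(ℝ, E) E ∞ (TangentSpace 𝓘(ℝ, E) : M → Type _)

/-- The components of a vector field of `M` in the parametrization `p`. -/
noncomputable def coord (X : VecField E M) (p : E → M) : E → E :=
  VectorField.mpullback 𝓘(ℝ, E) 𝓘(ℝ, E) p X

/-- The derivative of `p : E → M` at `u`, as a map between the model spaces. -/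
noncomputable def paramDeriv (p : E → M) (u : E) : E →L[ℝ] E :=
  mfderiv 𝓘(ℝ, E) 𝓘(ℝ, E) p u

lemma coord_apply (X : VecField E M) (p : E → M) (u : E) :
    coord X p u = (mfderiv 𝓘(ℝ, E) 𝓘(ℝ, E) p u).inverse (X (p u)) := rfl

lemma mfderiv_coord (X : VecField E M) {p : E → M} {u : E} (hp : IsParam p u) :
    paramDeriv p u (coord X p u) = (X (p u) : E) :=
  hp.2.self_apply_inverse _

lemma contDiffAt_coord (X : VecField E M) {p : E → M} {u : E} (hp : IsParam p u) :
    ContDiffAt ℝ ∞ (coord X p) u := by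
  have : CompleteSpace E := FiniteDimensional.complete ℝ E
  exact contMDiffAt_vectorSpace_iff_contDiffAt.1
    (ContMDiffAt.mpullback_vectorField_preimage (n := ∞) (X.contMDiff (p u)) hp.contMDiffAt
    hp.2 (by simp))

lemma coord_comp (X : VecField E M) {p q : E → M} {f : E → E} {u : E} (hp : IsParam p (f u))
    (hf : IsLocDiffeo f u) (hq : q =ᶠ[𝓝 u] p ∘ f) :
    fderiv ℝ f u (coord X q u) = coord X p (f u) := by
  have hqp := hp.comp hf hq
  have h1 := mfderiv_coord X hqp
  have h2 := mfderiv_coord X hp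
  have hqu : q u = p (f u) := hq.self_of_nhds
  have h3 : paramDeriv q u = (paramDeriv p (f u)).comp (fderiv ℝ f u) := by
    unfold paramDeriv
    rw [hq.mfderiv_eq, mfderiv_comp u hp.mdifferentiableAt
      (hf.1.self_of_nhds.differentiableAt (by simp)).mdifferentiableAt, mfderiv_eq_fderiv]
    rfl
  have h4 : ((X (q u) : TangentSpace 𝓘(ℝ, E) (q u)) : E) = X (p (f u)) := by rw [hqu]
  apply hp.2.injective
  have h5 : paramDeriv p (f u) (fderiv ℝ f u (coord X q u)) =
      paramDeriv p (f u) (coord X p (f u)) := by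
    rw [h2, ← h4, ← h1, h3]
    rfl
  exact h5

open Classical in
/-- The Lie derivative `𝔏_X s` of the section `s` along the vector field `X`: the velocity at
`τ = 0` of the pullback of `s` by the curve of local diffeomorphisms of `M` which is
`w ↦ w + τ X(w)` in the parametrization `p`. -/
noncomputable def lieDeriv (X : VecField E M) (s : (E → M) → E → V) : (E → M) → E → V :=
  fun p u => if IsParam p u then deriv (fun τ : ℝ => s (p ∘ fun w => w + τ • coord X p w) u) 0
    else 0

lemma contDiffAt_euler {Y : E → E} {w : E} (hY : ContDiffAt ℝ ∞ Y w) (τ : ℝ) :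
    ContDiffAt ℝ ∞ (uncurry fun (τ : ℝ) (w : E) => w + τ • Y w) (τ, w) :=
  contDiffAt_snd.add (contDiffAt_fst.smul (hY.comp (τ, w) contDiffAt_snd))

lemma eventually_euler {Y : E → E} {u : E} (hY : ∀ᶠ w in 𝓝 u, ContDiffAt ℝ ∞ Y w) :
    ∀ᶠ z in 𝓝 ((0 : ℝ), u), ContDiffAt ℝ ∞ (uncurry fun (τ : ℝ) (w : E) => w + τ • Y w) z :=
  (continuous_snd.tendsto ((0 : ℝ), u) |>.eventually hY).mono fun z hz => contDiffAt_euler hz z.1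

lemma deriv_euler (Y : E → E) (w : E) : deriv (fun τ : ℝ => w + τ • Y w) 0 = Y w := by
  have : HasDerivAt (fun τ : ℝ => w + τ • Y w) ((1 : ℝ) • Y w) 0 :=
    ((hasDerivAt_id (0 : ℝ)).smul_const (Y w)).const_add w
  simpa using this.deriv

lemma hasDerivAt_lieDeriv {A : AffineJetAction E V r} {s : (E → M) → E → V} (hs : IsSection A s)
    (X : VecField E M) {p : E → M} {u : E} (hp : IsParam p u) :
    HasDerivAt (fun τ : ℝ => s (p ∘ fun w => w + τ • coord X p w) u)
      (variation A s p (jet r id u) u (jet r (coord X p) u) (coord X p u)) 0 := by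
  have : CompleteSpace E := FiniteDimensional.complete ℝ E
  have h0 : (fun w : E => w + (0 : ℝ) • coord X p w) = id := by ext; simp
  have := hasDerivAt_family hs (c := p) (κ := fun (τ : ℝ) (w : E) => w + τ • coord X p w) (u := u)
    (P := fun τ => p ∘ fun w => w + τ • coord X p w)
    (eventually_euler (hp.eventually.mono fun w hw => contDiffAt_coord X hw))
    (by rw [h0, fderiv_id]; exact ⟨ContinuousLinearEquiv.refl ℝ E, rfl⟩) (by simpa using hp)
    (Eventually.of_forall fun t => EventuallyEq.rfl)
  have h1 : (fun w => deriv (fun τ : ℝ => w + τ • coord X p w) 0) = coord X p :=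
    funext fun w => deriv_euler _ w
  simp only [h0, h1] at this
  rw [deriv_euler] at this
  simpa only [zero_smul, add_zero] using this

lemma lieDeriv_apply {A : AffineJetAction E V r} {s : (E → M) → E → V} (hs : IsSection A s)
    (X : VecField E M) {p : E → M} {u : E} (hp : IsParam p u) :
    lieDeriv X s p u = variation A s p (jet r id u) u (jet r (coord X p) u) (coord X p u) := by
  rw [lieDeriv, if_pos hp, (hasDerivAt_lieDeriv hs X hp).deriv]

/-- `c` is a family of component functions which is jointly smooth in the parameter (in the set
`U`) and in the point of `M`. -/
def JointlySmoothOn {F : Type*} [NormedAddCommGroup F] [NormedSpace ℝ F] (U : Set F)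
    (c : F → (E → M) → E → V) : Prop :=
  ∀ y ∈ U, ∀ (p : E → M) (u : E), IsParam p u →
    ContDiffAt ℝ ∞ (fun z : F × E => c z.1 p z.2) (y, u)

lemma jointlySmoothOn_lieDeriv {F : Type*} [NormedAddCommGroup F] [NormedSpace ℝ F] {U : Set F}
    {A : AffineJetAction E V r} {c : F → (E → M) → E → V} (hc : ∀ y, IsSection A (c y))
    {X : F → VecField E M} (h : JointlySmoothOn U c)
    (hX : JointlySmoothOn U (fun y => coord (X y))) :
    JointlySmoothOn U (fun y => lieDeriv (X y) (c y)) := by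
  have : CompleteSpace E := FiniteDimensional.complete ℝ E
  intro y hy p u hp
  have hev : ∀ᶠ z in 𝓝 (y, u), IsParam p z.2 :=
    (continuous_snd.tendsto (y, u)).eventually hp.eventually
  have heq : (fun z : F × E => lieDeriv (X z.1) (c z.1) p z.2) =ᶠ[𝓝 (y, u)] fun z =>
      variation A (c z.1) p (jet r id z.2) z.2 (jet r (coord (X z.1) p) z.2)
        (coord (X z.1) p z.2) := hev.mono fun z hz => lieDeriv_apply (hc _) _ hz
  refine ContDiffAt.congr_of_eventuallyEq ?_ heq
  have hid : ContDiffAt ℝ ∞ (fun z : F × E => jet r id z.2) (y, u) :=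
    contDiffAt_jet_param (fun _ : F => (id : E → E)) (y, u) contDiffAt_snd
  have hj : ContDiffAt ℝ ∞ (fun z : F × E => jet r (coord (X z.1) p) z.2) (y, u) :=
    contDiffAt_jet_param (fun y => coord (X y) p) (y, u) (hX y hy p u hp)
  have hs := h y hy p u hp
  have hdx := hX y hy p u hp
  have hds : ContDiffAt ℝ ∞ (fun z : F × E => fderiv ℝ (c z.1 p) z.2) (y, u) := by
    refine ContDiffAt.fderiv (f := fun z : F × E => c z.1 p) (g := Prod.snd)
      (n := ∞) ?_ contDiffAt_snd (by simp)
    exact ContDiffAt.comp (g := fun z : F × E => c z.1 p z.2)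
      (f := fun w : (F × E) × E => (w.1.1, w.2)) ((y, u), u) hs
      ((contDiffAt_fst.comp _ contDiffAt_fst).prodMk contDiffAt_snd)
  have hA : ContDiffAt ℝ ∞ (fderiv ℝ (fun q : Jet E r × V => A.act q.1 q.2))
      (jet r id u, c y p u) :=
    (A.contDiffAt (by
      rw [linPart_jet, fderiv_id]; exact ⟨ContinuousLinearEquiv.refl ℝ E, rfl⟩)).fderiv_right
      (m := ∞) (by simp)
  have h1 : ContDiffAt ℝ ∞ (fun z : F × E => fderiv ℝ (fun q : Jet E r × V => A.act q.1 q.2)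
      (jet r id z.2, c z.1 p z.2)) (y, u) :=
    hA.comp (y, u) (f := fun z : F × E => (jet r id z.2, c z.1 p z.2)) (hid.prodMk hs)
  exact h1.clm_apply (hj.prodMk (hds.clm_apply hdx))

lemma isSection_lieDeriv {A : AffineJetAction E V r} {s : (E → M) → E → V} (hs : IsSection A s)
    (X : VecField E M) : IsSection A.lin (lieDeriv X s) where
  smooth p u hp := by
    have := jointlySmoothOn_lieDeriv (F := ℝ) (U := univ)  (A := A) (c := fun _ => s)
      (X := fun _ => X) (fun _ => hs)
      (fun y _ p u hp => (hs.smooth p u hp).comp (y, u) contDiffAt_snd)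
      (fun y _ p u hp => (contDiffAt_coord X hp).comp (y, u) contDiffAt_snd) 0 (mem_univ _) p u hp
    exact this.comp u (f := fun w => ((0 : ℝ), w)) (contDiffAt_const.prodMk contDiffAt_id)
  zero_off p u hp := by rw [lieDeriv, if_neg hp]
  transform p q f u hp hf hq := by
    have : CompleteSpace E := FiniteDimensional.complete ℝ E
    have hqp := hp.comp hf hq
    have hfc : ContinuousAt f u := hf.1.self_of_nhds.continuousAt
    have hYq : ∀ᶠ w in 𝓝 u, ContDiffAt ℝ ∞ (coord X q) w :=
      hqp.eventually.mono fun w hw => contDiffAt_coord X hw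
    have hYp : ∀ᶠ w in 𝓝 (f u), ContDiffAt ℝ ∞ (coord X p) w :=
      hp.eventually.mono fun w hw => contDiffAt_coord X hw
    -- the two families of local diffeomorphisms with the same velocity
    let κ₁ : ℝ → E → E := fun τ w => f (w + τ • coord X q w)
    let κ₂ : ℝ → E → E := fun τ w => f w + τ • coord X p (f w)
    have e1 : κ₁ 0 = f := by ext w; simp [κ₁]
    have e2 : κ₂ 0 = f := by ext w; simp [κ₂]
    have hκ₁ : ∀ᶠ z in 𝓝 ((0 : ℝ), u), ContDiffAt ℝ ∞ (uncurry κ₁) z := by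
      have hc : ContinuousAt (uncurry fun (τ : ℝ) (w : E) => w + τ • coord X q w) ((0 : ℝ), u) :=
        (contDiffAt_euler hYq.self_of_nhds 0).continuousAt
      have hc' : ∀ᶠ z in 𝓝 ((0 : ℝ), u), ContDiffAt ℝ ∞ f (z.2 + z.1 • coord X q z.2) :=
        hc.eventually (by simpa using hf.1)
      filter_upwards [eventually_euler hYq, hc'] with z h1 h2
      exact ContDiffAt.comp (g := f) z h2 h1
    have hκ₂ : ∀ᶠ z in 𝓝 ((0 : ℝ), u), ContDiffAt ℝ ∞ (uncurry κ₂) z := by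
      have hc : ∀ᶠ z in 𝓝 ((0 : ℝ), u), ContDiffAt ℝ ∞ f z.2 ∧ ContDiffAt ℝ ∞ (coord X p) (f z.2) :=
        (continuous_snd.tendsto ((0 : ℝ), u)).eventually (hf.1.and (hfc.eventually hYp))
      filter_upwards [hc] with z hz
      exact (contDiffAt_euler hz.2 z.1).comp z (f := fun z : ℝ × E => (z.1, f z.2))
        (contDiffAt_fst.prodMk (hz.1.comp z contDiffAt_snd))
    have hfd : ∀ᶠ w in 𝓝 u, deriv (fun t => κ₁ t w) 0 = coord X p (f w) := by
      filter_upwards [hf.eventually, hfc.eventually hp.eventually, hq.eventually_nhds]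
        with w h1 h2 h3
      have hd : HasDerivAt (fun τ : ℝ => w + τ • coord X q w) (coord X q w) 0 := by
        simpa using ((hasDerivAt_id (0 : ℝ)).smul_const (coord X q w)).const_add w
      have hfw : HasFDerivAt f (fderiv ℝ f w) (w + (0 : ℝ) • coord X q w) := by
        simpa using (h1.1.self_of_nhds.differentiableAt (by simp)).hasFDerivAt
      exact (hfw.comp_hasDerivAt (0 : ℝ) hd).deriv.trans (coord_comp X h2 h1 h3)
    have hfd2 : ∀ w, deriv (fun t => κ₂ t w) 0 = coord X p (f w) := fun w =>
      deriv_euler (fun _ => coord X p (f w)) (f w)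
    have hjet : jet r (fun w => deriv (fun t => κ₁ t w) 0) u =
        jet r (fun w => deriv (fun t => κ₂ t w) 0) u := by
      funext i
      refine (EventuallyEq.iteratedFDeriv (𝕜 := ℝ) ?_ _).self_of_nhds
      filter_upwards [hfd] with w hw
      rw [hw, hfd2]
    have D1 := hasDerivAt_family hs (c := p) hκ₁ (by rw [e1]; exact hf.2) (by rw [e1]; exact hp)
      (P := fun τ => q ∘ fun w => w + τ • coord X q w) (by
        have hc : ContinuousAt (fun z : ℝ × E => z.2 + z.1 • coord X q z.2) ((0 : ℝ), u) :=
          (contDiffAt_euler hYq.self_of_nhds 0).continuousAt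
        have hu : u + (0 : ℝ) • coord X q u = u := by simp
        have h : ∀ᶠ z in 𝓝 ((0 : ℝ), u), q (z.2 + z.1 • coord X q z.2) =
            (p ∘ f) (z.2 + z.1 • coord X q z.2) :=
          hc.eventually (p := fun w => q w = (p ∘ f) w) (by dsimp only; rw [hu]; exact hq)
        have h' := ((Continuous.prodMk_left u).tendsto (0 : ℝ)).eventually h.eventually_nhds
        exact h'.mono fun t ht => ((Continuous.prodMk_right t).tendsto u).eventually ht)
    have D2 := hasDerivAt_family hs (c := p) hκ₂ (by rw [e2]; exact hf.2) (by rw [e2]; exact hp)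
      (P := fun τ => (p ∘ fun w => w + τ • coord X p w) ∘ f)
      (Eventually.of_forall fun t => EventuallyEq.rfl)
    have hval := hfd.self_of_nhds
    rw [e1, hjet, hval] at D1
    rw [e2, hfd2 u] at D2
    have D3 := hasDerivAt_lieDeriv hs X hp
    have hpe : ∀ᶠ τ in 𝓝 (0 : ℝ), IsParam (p ∘ fun w => w + τ • coord X p w) (f u) := by
      have h0 : (fun w : E => w + (0 : ℝ) • coord X p w) = id := by ext; simp
      have hl := eventually_isLocDiffeo (eventually_euler hYp)
        (by rw [h0, fderiv_id]; exact ⟨ContinuousLinearEquiv.refl ℝ E, rfl⟩)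
      have hc : ContinuousAt (fun τ : ℝ => f u + τ • coord X p (f u)) 0 := by fun_prop
      have hu : f u + (0 : ℝ) • coord X p (f u) = f u := by simp
      have hl' : ∀ᶠ τ in 𝓝 (0 : ℝ), IsParam p (f u + τ • coord X p (f u)) :=
        hc.eventually (p := IsParam p) (by dsimp only; rw [hu]; exact hp.eventually)
      filter_upwards [hl, hl'] with τ h1 h2
      exact IsParam.comp h2 h1 EventuallyEq.rfl
    have D4 : (fun τ : ℝ => s ((p ∘ fun w => w + τ • coord X p w) ∘ f) u) =ᶠ[𝓝 0]
        fun τ => A.act (jet r f u) (s (p ∘ fun w => w + τ • coord X p w) (f u)) :=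
      hpe.mono fun τ hτ => hs.transform _ _ f u hτ hf EventuallyEq.rfl
    have D5 := D2.congr_of_eventuallyEq D4.symm
    have D3' : deriv (fun τ : ℝ => s (p ∘ fun w => w + τ • coord X p w) (f u)) 0 =
        lieDeriv X s p (f u) := by rw [lieDeriv, if_pos hp]
    have D6 : HasDerivAt (fun τ : ℝ => A.act (jet r f u)
        (s (p ∘ fun w => w + τ • coord X p w) (f u)))
        ((A.act (jet r f u)).linear (lieDeriv X s p (f u))) 0 := by
      rw [← D3']
      have h := ((A.act (jet r f u)).linear.toContinuousLinearMap.hasFDerivAt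
        (x := s (p ∘ fun w => w + (0 : ℝ) • coord X p w) (f u))).comp_hasDerivAt (0 : ℝ)
        D3.differentiableAt.hasDerivAt
      refine (h.add_const (A.act (jet r f u) 0)).congr_of_eventuallyEq
        (Eventually.of_forall fun τ => ?_)
      exact congrFun (A.act (jet r f u)).decomp _
    rw [lieDeriv, if_pos hqp, D1.deriv]
    exact D5.unique D6

end Fields

section Families

variable {X Y : Type*} [DiffeologicalSpace X] [DiffeologicalSpace Y]
  {F : Type*} [NormedAddCommGroup F] [NormedSpace ℝ F] [FiniteDimensional ℝ F]
  {G : Type*} [NormedAddCommGroup G] [NormedSpace ℝ G] [FiniteDimensional ℝ G]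

/-- Smooth families in `X` parametrized by a finite dimensional space. -/
def IsFam (c : F → X) : Prop := IsPlot (c ∘ (toEuclidean (E := F)).symm)

lemma IsFam.reparam {c : F → X} (hc : IsFam c) {g : G → F} (hg : ContDiff ℝ ∞ g) :
    IsFam (c ∘ g) := by
  have := isPlot_reparam hc ((toEuclidean (E := F)).contDiff.comp
    (hg.comp (toEuclidean (E := G)).symm.contDiff))
  unfold IsFam
  convert this using 1
  ext y; simp

lemma isPlot_iff_isFam {n : ℕ} {c : EuclideanSpace ℝ (Fin n) → X} : IsPlot c ↔ IsFam c := by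
  refine ⟨fun h => isPlot_reparam h (toEuclidean (E := EuclideanSpace ℝ (Fin n))).symm.contDiff,
    fun h => ?_⟩
  have := isPlot_reparam h (toEuclidean (E := EuclideanSpace ℝ (Fin n))).contDiff
  convert this using 1
  ext y; simp

lemma isFam_const (x : X) : IsFam (fun _ : F => x) := isPlot_const

lemma IsFam.dSmooth_comp {c : F → X} (hc : IsFam c) {f : X → Y} (hf : DSmooth f) :
    IsFam (fun y => f (c y)) := hf _ _ hc

lemma dSmooth_of_isFam {f : X → Y}
    (h : ∀ (n : ℕ) (c : EuclideanSpace ℝ (Fin n) → X), IsFam c → IsFam (fun y => f (c y))) :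
    DSmooth f :=
  fun n c hc => isPlot_iff_isFam.2 (h n c (isPlot_iff_isFam.1 hc))

lemma isFam_iff_contDiff {c : F → ℝ} : IsFam c ↔ ContDiff ℝ ∞ c := by
  constructor
  · intro h
    have h' : ContDiff ℝ ∞ _ := (IsPlot.contDiff h).comp (toEuclidean (E := F)).contDiff
    convert h' using 1
    ext y; simp
  · intro h
    exact (h.comp (toEuclidean (E := F)).symm.contDiff).isPlot

end Families

/-- A real vector space with a diffeology for which sums and multiples of smooth maps are
smooth. -/
class SmoothModule (W : Type*) [AddCommGroup W] [Module ℝ W] [DiffeologicalSpace W] : Prop where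
  isPlot_add : ∀ {n : ℕ} {c c' : EuclideanSpace ℝ (Fin n) → W}, IsPlot c → IsPlot c' →
    IsPlot (fun y => c y + c' y)
  isPlot_smul : ∀ {n : ℕ} {a : EuclideanSpace ℝ (Fin n) → ℝ} {c : EuclideanSpace ℝ (Fin n) → W},
    IsPlot a → IsPlot c → IsPlot (fun y => a y • c y)

/-- The space `C^∞(X, W)`. -/
def smoothMaps (X W : Type*) [DiffeologicalSpace X] [AddCommGroup W] [Module ℝ W]
    [DiffeologicalSpace W] [SmoothModule W] : Submodule ℝ (X → W) where
  carrier := {f | DSmooth f}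
  zero_mem' := dSmooth_const
  add_mem' hf hg := fun n c hc => SmoothModule.isPlot_add (hf n c hc) (hg n c hc)
  smul_mem' _ _ hf := fun n c hc => SmoothModule.isPlot_smul isPlot_const (hf n c hc)

instance : SmoothModule ℝ where
  isPlot_add h h' := (h.contDiff.add h'.contDiff).isPlot
  isPlot_smul h h' := (h.contDiff.mul h'.contDiff).isPlot

/-- A notion of velocity at time zero for the smooth curves in `W`. -/
class HasVelocity (W : Type*) where
  /-- The velocity `d/dt c(t)` at `t = 0` of the curve `c`. -/
  velocity : (ℝ → W) → W

open HasVelocity (velocity)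

/-- The rules of calculus for velocities. -/
class LawfulVelocity (W : Type*) [AddCommGroup W] [Module ℝ W] [DiffeologicalSpace W]
    [HasVelocity W] : Prop where
  isFam_velocity : ∀ {n : ℕ} {c : ℝ × EuclideanSpace ℝ (Fin n) → W}, IsFam c →
    IsFam fun y => velocity fun t => c (t, y)
  velocity_diag : ∀ {c : ℝ × ℝ → W}, IsFam c →
    velocity (fun t => c (t, t)) =
      velocity (fun t => c (t, 0)) + velocity (fun t => c (0, t))
  velocity_mul : ∀ {c : ℝ → W}, IsFam c → ∀ a : ℝ,
    velocity (fun t => c (t * a)) = a • velocity c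

section Spaces

variable {E : Type*} [NormedAddCommGroup E] [NormedSpace ℝ E] [FiniteDimensional ℝ E]
  {V : Type*} [NormedAddCommGroup V] [NormedSpace ℝ V] [FiniteDimensional ℝ V]
  {M : Type*} [TopologicalSpace M] [ChartedSpace E M] [IsManifold 𝓘(ℝ, E) ∞ M] {r : ℕ}

lemma JointlySmoothOn.comp {F G : Type*} [NormedAddCommGroup F] [NormedSpace ℝ F]
    [NormedAddCommGroup G] [NormedSpace ℝ G] {U : Set F} {W : Set G} {c : F → (E → M) → E → V}
    (hc : JointlySmoothOn U c) {f : G → F} (hf : ∀ y ∈ W, ContDiffAt ℝ ∞ f y)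
    (h : MapsTo f W U) : JointlySmoothOn W (c ∘ f) := by
  intro y hy p u hp
  exact ContDiffAt.comp (g := fun z : F × E => c z.1 p z.2) (f := fun z : G × E => (f z.1, z.2))
    (y, u) (hc _ (h hy) p u hp)
    (((hf y hy).comp (y, u) contDiffAt_fst).prodMk contDiffAt_snd)

lemma JointlySmoothOn.congr {F : Type*} [NormedAddCommGroup F] [NormedSpace ℝ F]
    {U : Set F} (hU : IsOpen U) {c c' : F → (E → M) → E → V}
    (hc : JointlySmoothOn U c) (h : EqOn c' c U) : JointlySmoothOn U c' := by
  intro y hy p u hp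
  refine (hc y hy p u hp).congr_of_eventuallyEq ?_
  filter_upwards [(continuous_fst.tendsto (y, u)).eventually (hU.mem_nhds hy)] with z hz
  rw [h hz]

/-- The diffeology of a space `S` of objects on `M` given by their component functions: the plots
are the families whose components are jointly smooth in the parameter and in the point. -/
@[reducible]
def componentDiffeology {S : Type*} (κ : S → (E → M) → E → V)
    (h : ∀ (s : S) (p : E → M) (u : E), IsParam p u → ContDiffAt ℝ ∞ (κ s p) u) :
    DiffeologicalSpace S :=
  .ofCorePlotsOn {
    isPlotOn := fun {_ U} _ c => JointlySmoothOn U (κ ∘ c)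
    isPlotOn_congr := fun hU _ _ h =>
      ⟨fun h' => h'.congr hU fun y hy => by simp [h hy],
        fun h' => h'.congr hU fun y hy => by simp [h hy]⟩
    isPlot_const := fun s y _ p u hp => (h s p u hp).comp (y, u) contDiffAt_snd
    isPlotOn_reparam := fun hW _ _ h hc hf =>
      hc.comp (fun y hy => hf.contDiffAt (hW.mem_nhds hy)) h
    locality := fun _ _ h y hy => by
      obtain ⟨W, _, hyW, hW⟩ := h y hy
      exact hW y hyW }

lemma isFam_componentDiffeology {S : Type*} [d : DiffeologicalSpace S] {κ : S → (E → M) → E → V}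
    {h : ∀ (s : S) (p : E → M) (u : E), IsParam p u → ContDiffAt ℝ ∞ (κ s p) u}
    (hd : d = componentDiffeology κ h)
    {F : Type*} [NormedAddCommGroup F] [NormedSpace ℝ F] [FiniteDimensional ℝ F] {c : F → S} :
    IsFam c ↔ JointlySmoothOn univ (κ ∘ c) := by
  subst hd
  constructor
  · intro hc
    have hc' : JointlySmoothOn univ (κ ∘ c ∘ (toEuclidean (E := F)).symm) := hc
    have := hc'.comp (W := univ) (f := toEuclidean (E := F))
      (fun y _ => (toEuclidean (E := F)).contDiff.contDiffAt) (mapsTo_univ _ _)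
    convert this using 1
    ext y; simp
  · intro hc
    exact hc.comp (W := univ) (f := (toEuclidean (E := F)).symm)
      (fun y _ => (toEuclidean (E := F)).symm.contDiff.contDiffAt) (mapsTo_univ _ _)

/-- The space of fields `Φ`: the smooth sections of the natural bundle over `M` with standard
fibre `A`. -/
@[ext]
structure FieldsOn (A : AffineJetAction E V r) (M : Type*) [TopologicalSpace M]
    [ChartedSpace E M] where
  /-- The components of the field in the local parametrizations. -/
  val : (E → M) → E → V
  property : IsSection A val

/-- The sections of the natural vector bundle with standard fibre the linear part of `A`, as a space
of functions. -/
def variations (A : AffineJetAction E V r) (M : Type*) [TopologicalSpace M] [ChartedSpace E M] :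
    Submodule ℝ ((E → M) → E → V) where
  carrier := {s | IsSection A.lin s}
  zero_mem' := ⟨fun _ _ _ => contDiffAt_const, fun p q f u _ _ _ => by
    simp [AffineJetAction.lin], fun _ _ _ => rfl⟩
  add_mem' {s s'} h h' := ⟨fun p u hp => (h.smooth p u hp).add (h'.smooth p u hp),
    fun p q f u hp hf hq => by
      have e1 := h.transform p q f u hp hf hq
      have e2 := h'.transform p q f u hp hf hq
      simp only [AffineJetAction.lin, LinearMap.coe_toAffineMap] at e1 e2 ⊢
      simp only [Pi.add_apply, e1, e2, map_add],
    fun p u hp => by simp [h.zero_off p u hp, h'.zero_off p u hp]⟩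
  smul_mem' a s h := ⟨fun p u hp => contDiffAt_const.smul (h.smooth p u hp),
    fun p q f u hp hf hq => by
      have e1 := h.transform p q f u hp hf hq
      simp only [AffineJetAction.lin, LinearMap.coe_toAffineMap] at e1 ⊢
      simp only [Pi.smul_apply, e1, map_smul],
    fun p u hp => by simp [h.zero_off p u hp]⟩

/-- The tangent space of `Φ` at any of its points: the vector space of smooth sections of the natural
vector bundle with standard fibre the linear part of `A`. -/
@[ext]
structure TFieldsOn (A : AffineJetAction E V r) (M : Type*) [TopologicalSpace M]
    [ChartedSpace E M] where
  /-- The components of the tangent vector in the local parametrizations. -/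
  val : (E → M) → E → V
  property : IsSection A.lin val

variable {A : AffineJetAction E V r}

/-- Tangent vectors as elements of a space of functions. -/
def tFieldsEquiv : TFieldsOn A M ≃ variations A M where
  toFun h := ⟨h.1, h.2⟩
  invFun h := ⟨h.1, h.2⟩
  left_inv _ := rfl
  right_inv _ := rfl

instance : AddCommGroup (TFieldsOn A M) := tFieldsEquiv.addCommGroup

instance : Module ℝ (TFieldsOn A M) := tFieldsEquiv.module ℝ

@[simp] lemma TFieldsOn.add_val (h h' : TFieldsOn A M) : (h + h').val = h.val + h'.val := rfl

@[simp] lemma TFieldsOn.zero_val : (0 : TFieldsOn A M).val = 0 := rfl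

@[simp] lemma TFieldsOn.neg_val (h : TFieldsOn A M) : (-h).val = -h.val := rfl

@[simp] lemma TFieldsOn.sub_val (h h' : TFieldsOn A M) : (h - h').val = h.val - h'.val := rfl

@[simp] lemma TFieldsOn.smul_val (a : ℝ) (h : TFieldsOn A M) : (a • h).val = a • h.val := rfl

/-- `φ + h` for a field `φ` and a tangent vector `h` at `φ`. -/
instance : VAdd (TFieldsOn A M) (FieldsOn A M) where
  vadd h φ := ⟨h.1 + φ.1, fun p u hp => (h.2.smooth p u hp).add (φ.2.smooth p u hp),
    fun p q f u hp hf hq => by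
      have e1 := h.2.transform p q f u hp hf hq
      have e2 := φ.2.transform p q f u hp hf hq
      simp only [AffineJetAction.lin, LinearMap.coe_toAffineMap] at e1
      simp only [Pi.add_apply, e1, e2]
      exact ((A.act (jet r f u)).map_vadd (φ.1 p (f u)) (h.1 p (f u))).symm,
    fun p u hp => by simp [h.2.zero_off p u hp, φ.2.zero_off p u hp]⟩

lemma vadd_val (h : TFieldsOn A M) (φ : FieldsOn A M) : (h +ᵥ φ).1 = h.1 + φ.1 := rfl

instance : DiffeologicalSpace (FieldsOn A M) :=
  componentDiffeology (fun φ => φ.1) fun φ => φ.2.smooth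

instance : DiffeologicalSpace (TFieldsOn A M) :=
  componentDiffeology (fun h => h.1) fun h => h.2.smooth

noncomputable instance : DiffeologicalSpace (VecField E M) :=
  componentDiffeology coord fun X _ _ => contDiffAt_coord X

variable {F : Type*} [NormedAddCommGroup F] [NormedSpace ℝ F] [FiniteDimensional ℝ F]

lemma isFam_field {c : F → FieldsOn A M} : IsFam c ↔ JointlySmoothOn univ fun y => (c y).1 :=
  isFam_componentDiffeology (h := fun φ : FieldsOn A M => φ.2.smooth) rfl

lemma isFam_tField {c : F → TFieldsOn A M} :
    IsFam c ↔ JointlySmoothOn univ fun y => (c y).1 :=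
  isFam_componentDiffeology (h := fun φ : TFieldsOn A M => φ.2.smooth) rfl

lemma isFam_vecField {c : F → VecField E M} :
    IsFam c ↔ JointlySmoothOn univ fun y => coord (c y) :=
  isFam_componentDiffeology (h := fun (X : VecField E M) _ _ => contDiffAt_coord X) rfl

lemma coord_add (X Y : VecField E M) (p : E → M) (u : E) :
    coord (X + Y) p u = coord X p u + coord Y p u :=
  map_add (mfderiv 𝓘(ℝ, E) 𝓘(ℝ, E) p u).inverse (X (p u)) (Y (p u))

lemma coord_smul (a : ℝ) (X : VecField E M) (p : E → M) (u : E) :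
    coord (a • X) p u = a • coord X p u :=
  map_smul (mfderiv 𝓘(ℝ, E) 𝓘(ℝ, E) p u).inverse a (X (p u))

instance : SmoothModule (TFieldsOn A M) where
  isPlot_add h h' := isPlot_iff_isFam.2 <| isFam_tField.2 fun y _ p u hp =>
    (isFam_tField.1 (isPlot_iff_isFam.1 h) y trivial p u hp).add
      (isFam_tField.1 (isPlot_iff_isFam.1 h') y trivial p u hp)
  isPlot_smul h h' := isPlot_iff_isFam.2 <| isFam_tField.2 fun y _ p u hp =>
    (h.contDiff.contDiffAt.comp (y, u) contDiffAt_fst).smul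
      (isFam_tField.1 (isPlot_iff_isFam.1 h') y trivial p u hp)

instance : SmoothModule (VecField E M) where
  isPlot_add h h' := isPlot_iff_isFam.2 <| isFam_vecField.2 fun y _ p u hp =>
    ((isFam_vecField.1 (isPlot_iff_isFam.1 h) y trivial p u hp).add
      (isFam_vecField.1 (isPlot_iff_isFam.1 h') y trivial p u hp)).congr_of_eventuallyEq
      (Eventually.of_forall fun z => coord_add _ _ p z.2)
  isPlot_smul h h' := isPlot_iff_isFam.2 <| isFam_vecField.2 fun y _ p u hp =>
    ((h.contDiff.contDiffAt.comp (y, u) contDiffAt_fst).smul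
      (isFam_vecField.1 (isPlot_iff_isFam.1 h') y trivial p u hp)).congr_of_eventuallyEq
      (Eventually.of_forall fun z => coord_smul _ _ p z.2)

end Spaces

section Velocities

variable {E : Type*} [NormedAddCommGroup E] [NormedSpace ℝ E] [FiniteDimensional ℝ E]
  {V : Type*} [NormedAddCommGroup V] [NormedSpace ℝ V] [FiniteDimensional ℝ V]
  {M : Type*} [TopologicalSpace M] [ChartedSpace E M] [IsManifold 𝓘(ℝ, E) ∞ M] {r : ℕ}

lemma contDiffAt_deriv_param {F G : Type*} [NormedAddCommGroup F] [NormedSpace ℝ F]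
    [NormedAddCommGroup G] [NormedSpace ℝ G] {g : ℝ × F → G} {y : F}
    (hg : ContDiffAt ℝ ∞ g (0, y)) : ContDiffAt ℝ ∞ (fun y => deriv (fun t => g (t, y)) 0) y := by
  have h1 : ContDiffAt ℝ ∞ (fun y => fderiv ℝ g (0, y) (1, 0)) y :=
    ((hg.fderiv_right (m := ∞) (by simp)).comp y (f := fun y => ((0 : ℝ), y))
      (contDiffAt_const.prodMk contDiffAt_id)).clm_apply contDiffAt_const
  have hev : ∀ᶠ z in 𝓝 y, DifferentiableAt ℝ g (0, z) := by
    have := (hg.of_le (m := 1) (by simp)).eventually (by simp)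
    exact ((Continuous.prodMk_right (0 : ℝ)).tendsto y |>.eventually this).mono
      fun z hz => hz.differentiableAt (by simp)
  refine h1.congr_of_eventuallyEq (hev.mono fun z hz => ?_)
  exact (HasFDerivAt.comp_hasDerivAt (f := fun t : ℝ => (t, z)) (0 : ℝ) hz.hasFDerivAt
    ((hasDerivAt_id (0 : ℝ)).prodMk (hasDerivAt_const (0 : ℝ) z))).deriv

lemma deriv_diag {G : Type*} [NormedAddCommGroup G] [NormedSpace ℝ G] {g : ℝ × ℝ → G}
    (hg : DifferentiableAt ℝ g (0, 0)) :
    deriv (fun t => g (t, t)) 0 = deriv (fun t => g (t, 0)) 0 + deriv (fun t => g (0, t)) 0 := by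
  have h1 : HasDerivAt (fun t : ℝ => g (t, t)) (fderiv ℝ g (0, 0) (1, 1)) 0 :=
    HasFDerivAt.comp_hasDerivAt (f := fun t : ℝ => (t, t)) (0 : ℝ) hg.hasFDerivAt
      ((hasDerivAt_id (0 : ℝ)).prodMk (hasDerivAt_id (0 : ℝ)))
  have h2 : HasDerivAt (fun t : ℝ => g (t, 0)) (fderiv ℝ g (0, 0) (1, 0)) 0 :=
    HasFDerivAt.comp_hasDerivAt (f := fun t : ℝ => (t, (0 : ℝ))) (0 : ℝ) hg.hasFDerivAt
      ((hasDerivAt_id (0 : ℝ)).prodMk (hasDerivAt_const (0 : ℝ) (0 : ℝ)))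
  have h3 : HasDerivAt (fun t : ℝ => g (0, t)) (fderiv ℝ g (0, 0) (0, 1)) 0 :=
    HasFDerivAt.comp_hasDerivAt (f := fun t : ℝ => ((0 : ℝ), t)) (0 : ℝ) hg.hasFDerivAt
      ((hasDerivAt_const (0 : ℝ) (0 : ℝ)).prodMk (hasDerivAt_id (0 : ℝ)))
  rw [h1.deriv, h2.deriv, h3.deriv, ← map_add]
  simp

lemma deriv_mul_right {G : Type*} [NormedAddCommGroup G] [NormedSpace ℝ G] {g : ℝ → G}
    (hg : DifferentiableAt ℝ g 0) (a : ℝ) : deriv (fun t => g (t * a)) 0 = a • deriv g 0 := by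
  have h : HasDerivAt g (deriv g 0) (0 * a) := by simpa using hg.hasDerivAt
  exact (h.scomp (0 : ℝ) (by simpa using (hasDerivAt_id (0 : ℝ)).mul_const a :
    HasDerivAt (fun t : ℝ => t * a) a 0)).deriv

noncomputable instance : HasVelocity ℝ := ⟨fun c => deriv c 0⟩

instance : LawfulVelocity ℝ where
  isFam_velocity {n c} hc := isFam_iff_contDiff.2 <| contDiff_iff_contDiffAt.2 fun y =>
    contDiffAt_deriv_param (g := c) (isFam_iff_contDiff.1 hc).contDiffAt
  velocity_diag hc := deriv_diag ((isFam_iff_contDiff.1 hc).contDiffAt.differentiableAt (by simp))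
  velocity_mul hc := deriv_mul_right
    ((isFam_iff_contDiff.1 hc).contDiffAt.differentiableAt (by simp))

lemma lawfulVelocity_of_components {W : Type*} [AddCommGroup W] [Module ℝ W]
    [DiffeologicalSpace W] [HasVelocity W] (κ : W → (E → M) → E → V)
    (hadd : ∀ w w' p u, κ (w + w') p u = κ w p u + κ w' p u)
    (hsmul : ∀ (a : ℝ) w p u, κ (a • w) p u = a • κ w p u)
    (hfam : ∀ {F : Type} [NormedAddCommGroup F] [NormedSpace ℝ F] [FiniteDimensional ℝ F]
      {c : F → W}, IsFam c ↔ JointlySmoothOn univ fun y => κ (c y))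
    (hinj : ∀ w w', (∀ p u, IsParam p u → κ w p u = κ w' p u) → w = w')
    (hvel : ∀ c : ℝ → W, IsFam c → ∀ p u, IsParam p u →
      κ (velocity c) p u = deriv (fun t => κ (c t) p u) 0) : LawfulVelocity W where
  isFam_velocity {n c} hc := by
    have : CompleteSpace E := FiniteDimensional.complete ℝ E
    refine hfam.2 fun y _ p u hp => ?_
    have h := hfam.1 hc (0, y) trivial p u hp
    have h' : ContDiffAt ℝ ∞ (fun w : ℝ × (EuclideanSpace ℝ (Fin n) × E) =>
        κ (c (w.1, w.2.1)) p w.2.2) (0, (y, u)) :=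
      h.comp (0, (y, u)) (f := fun w : ℝ × (EuclideanSpace ℝ (Fin n) × E) =>
        ((w.1, w.2.1), w.2.2)) (by fun_prop)
    refine (contDiffAt_deriv_param h').congr_of_eventuallyEq ?_
    filter_upwards [(continuous_snd.tendsto (y, u)).eventually hp.eventually] with z hz
    exact hvel _ (hc.reparam (g := fun t : ℝ => (t, z.1)) (by fun_prop)) p z.2 hz
  velocity_diag {c} hc := hinj _ _ fun p u hp => by
    have h : ContDiffAt ℝ ∞ (fun z : ℝ × ℝ => κ (c z) p u) (0, 0) :=
      (hfam.1 hc (0, 0) trivial p u hp).comp ((0 : ℝ), (0 : ℝ)) (f := fun z : ℝ × ℝ => (z, u))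
        (contDiffAt_id.prodMk contDiffAt_const)
    have e1 := hvel _ (hc.reparam (g := fun t : ℝ => (t, t)) (by fun_prop)) p u hp
    have e2 := hvel _ (hc.reparam (g := fun t : ℝ => (t, (0 : ℝ))) (by fun_prop)) p u hp
    have e3 := hvel _ (hc.reparam (g := fun t : ℝ => ((0 : ℝ), t)) (by fun_prop)) p u hp
    simp only [Function.comp_def] at e1 e2 e3
    rw [hadd, e1, e2, e3]
    exact deriv_diag (h.differentiableAt (by simp))
  velocity_mul {c} hc a := hinj _ _ fun p u hp => by
    have h : ContDiffAt ℝ ∞ (fun z : ℝ => κ (c z) p u) 0 :=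
      (hfam.1 hc 0 trivial p u hp).comp (0 : ℝ) (f := fun z : ℝ => (z, u))
        (contDiffAt_id.prodMk contDiffAt_const)
    have e1 := hvel _ (hc.reparam (g := fun t : ℝ => t * a) (by fun_prop)) p u hp
    simp only [Function.comp_def] at e1
    rw [hsmul, e1, hvel _ hc p u hp]
    exact deriv_mul_right (h.differentiableAt (by simp)) a

variable {A : AffineJetAction E V r}

open Classical in
noncomputable instance : HasVelocity (TFieldsOn A M) :=
  ⟨fun c => if h : ∃ w : TFieldsOn A M, ∀ p u, w.1 p u = deriv (fun t => (c t).1 p u) 0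
    then h.choose else 0⟩

lemma jointlySmoothOn_slice {c : ℝ → (E → M) → E → V} (hc : JointlySmoothOn univ c)
    {p : E → M} {u : E} (hp : IsParam p u) : ContDiffAt ℝ ∞ (fun t => c t p u) 0 :=
  (hc 0 trivial p u hp).comp (0 : ℝ) (f := fun z : ℝ => (z, u))
    (contDiffAt_id.prodMk contDiffAt_const)

lemma velocity_tField {c : ℝ → TFieldsOn A M} (hc : IsFam c) (p : E → M) (u : E) :
    (velocity c).1 p u = deriv (fun t => (c t).1 p u) 0 := by
  have h : ∃ w : TFieldsOn A M, ∀ p u, w.1 p u = deriv (fun t => (c t).1 p u) 0 := by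
    have hj := isFam_tField.1 hc
    refine ⟨⟨fun p u => deriv (fun t => (c t).1 p u) 0, fun p u hp => ?_,
      fun p q f u hp hf hq => ?_, fun p u hp => ?_⟩, fun p u => rfl⟩
    · exact contDiffAt_deriv_param (g := fun z : ℝ × E => (c z.1).1 p z.2) (hj 0 trivial p u hp)
    · have e : (fun t => (c t).1 q u) = fun t => (A.act (jet r f u)).linear ((c t).1 p (f u)) :=
        funext fun t => (c t).2.transform p q f u hp hf hq
      have hd := (jointlySmoothOn_slice hj hp).differentiableAt (by simp)
      have := ((A.act (jet r f u)).linear.toContinuousLinearMap.hasFDerivAt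
        (x := (c 0).1 p (f u))).comp_hasDerivAt (0 : ℝ) hd.hasDerivAt
      rw [e]
      exact this.deriv
    · have e : (fun t => (c t).1 p u) = fun _ => 0 := funext fun t => (c t).2.zero_off p u hp
      rw [e]; simp
  have e : velocity c = h.choose := dif_pos h
  rw [e]
  exact h.choose_spec p u

instance : LawfulVelocity (TFieldsOn A M) :=
  lawfulVelocity_of_components (E := E) (M := M) (V := V) (fun h => h.1) (fun _ _ _ _ => rfl)
    (fun _ _ _ _ => rfl) isFam_tField (fun w w' h => by
      refine TFieldsOn.ext (funext fun p => funext fun u => ?_)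
      by_cases hp : IsParam p u
      · exact h p u hp
      · rw [w.2.zero_off p u hp, w'.2.zero_off p u hp])
    (fun c hc p u _ => velocity_tField hc p u)

/-- The value of a vector field at `x`, as a vector of the model space of `T_x M`. -/
noncomputable def VecField.at (X : VecField E M) (x : M) : E := X x

open Classical in
noncomputable instance : HasVelocity (VecField E M) :=
  ⟨fun c => if h : ∃ w : VecField E M, ∀ x, w.at x = deriv (fun t => (c t).at x) 0
    then h.choose else 0⟩

lemma isParam_chart_symm {x y : M} (hy : y ∈ (extChartAt 𝓘(ℝ, E) x).source) :
    IsParam (extChartAt 𝓘(ℝ, E) x).symm (extChartAt 𝓘(ℝ, E) x y) := by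
  have ht : extChartAt 𝓘(ℝ, E) x y ∈ (extChartAt 𝓘(ℝ, E) x).target :=
    (extChartAt 𝓘(ℝ, E) x).map_source hy
  refine ⟨?_, ?_⟩
  · filter_upwards [(isOpen_extChartAt_target x).mem_nhds ht] with w hw
    exact (contMDiffOn_extChartAt_symm x).contMDiffAt ((isOpen_extChartAt_target x).mem_nhds hw)
  · have := isInvertible_mfderivWithin_extChartAt_symm (I := 𝓘(ℝ, E)) ht
    simpa [mfderivWithin_univ] using this

/-- A vector field with smooth components is smooth. -/
lemma exists_vecField (w : M → E) (h : ∀ (p : E → M) (u : E), IsParam p u →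
    ContDiffAt ℝ ∞ (fun u => (paramDeriv p u).inverse (w (p u))) u) :
    ∃ X : VecField E M, ∀ x, X.at x = w x := by
  let w' : (x : M) → TangentSpace 𝓘(ℝ, E) x := w
  refine ⟨⟨w', fun x => (Bundle.contMDiffAt_section
    (E := (TangentSpace 𝓘(ℝ, E) : M → Type _)) (s := w') x).2 ?_⟩, fun x => rfl⟩
  have hx := mem_extChartAt_source (I := 𝓘(ℝ, E)) x
  have h1 := h _ _ (isParam_chart_symm hx)
  have h2 : ContMDiffAt 𝓘(ℝ, E) 𝓘(ℝ, E) ∞ (extChartAt 𝓘(ℝ, E) x) x := contMDiffAt_extChartAt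
  refine (h1.contMDiffAt.comp x h2).congr_of_eventuallyEq ?_
  filter_upwards [(isOpen_extChartAt_source x).mem_nhds hx] with y hy
  have hy' : y ∈ (chartAt E x).source := by simpa using hy
  have e1 : (trivializationAt E (TangentSpace 𝓘(ℝ, E) : M → Type _) x ⟨y, w' y⟩).2 =
      (trivializationAt E (TangentSpace 𝓘(ℝ, E) : M → Type _) x).continuousLinearMapAt ℝ y (w' y) :=
    (congrFun (Bundle.Trivialization.coe_linearMapAt_of_mem (R := ℝ)
      (trivializationAt E (TangentSpace 𝓘(ℝ, E) : M → Type _) x) (b := y)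
      (by simpa using hy')) (w' y)).symm
  rw [e1, TangentBundle.continuousLinearMapAt_trivializationAt hy']
  have e2 := mfderivWithin_extChartAt_symm_comp_mfderiv_extChartAt' (I := 𝓘(ℝ, E)) hy
  have e3 := mfderiv_extChartAt_comp_mfderivWithin_extChartAt_symm' (I := 𝓘(ℝ, E)) hy
  simp only [modelWithCornersSelf_coe, range_id, mfderivWithin_univ] at e2 e3
  have e4 : (paramDeriv (extChartAt 𝓘(ℝ, E) x).symm (extChartAt 𝓘(ℝ, E) x y)).inverse =
      (mfderiv 𝓘(ℝ, E) 𝓘(ℝ, E) (extChartAt 𝓘(ℝ, E) x) y : E →L[ℝ] E) :=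
    ContinuousLinearMap.inverse_eq e2 e3
  have e5 : w ((extChartAt 𝓘(ℝ, E) x).symm (extChartAt 𝓘(ℝ, E) x y)) = w y := by
    rw [(extChartAt 𝓘(ℝ, E) x).left_inv hy]
  rw [Function.comp_apply, e4, e5]
  rfl

/-- Every point is in the image of a local parametrization. -/
lemma exists_isParam (x : M) : ∃ (p : E → M) (u : E), IsParam p u ∧ p u = x :=
  ⟨_, _, isParam_chart_symm (mem_extChartAt_source (I := 𝓘(ℝ, E)) x),
    (extChartAt 𝓘(ℝ, E) x).left_inv (mem_extChartAt_source x)⟩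

lemma coord_injective {X Y : VecField E M} (h : ∀ p u, IsParam p u → coord X p u = coord Y p u) :
    X = Y := by
  ext x
  obtain ⟨p, u, hp, rfl⟩ := exists_isParam (E := E) x
  have h1 := mfderiv_coord X hp
  rw [h p u hp] at h1
  exact h1.symm.trans (mfderiv_coord Y hp)

lemma velocity_vecField_apply {c : ℝ → VecField E M} (hc : IsFam c) :
    (∀ x, DifferentiableAt ℝ (fun t => (c t).at x) 0) ∧
    ∀ x, (velocity c).at x = deriv (fun t => (c t).at x) 0 := by
  have hj := isFam_vecField.1 hc
  have hd : ∀ x, DifferentiableAt ℝ (fun t => (c t).at x) 0 := by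
    intro x
    obtain ⟨p, u, hp, rfl⟩ := exists_isParam (E := E) x
    have e : (fun t => (c t).at (p u)) = fun t => paramDeriv p u (coord (c t) p u) :=
      funext fun t => (mfderiv_coord (c t) hp).symm
    rw [e]
    exact (paramDeriv p u).differentiableAt.comp (0 : ℝ)
      ((jointlySmoothOn_slice hj hp).differentiableAt (by simp))
  refine ⟨hd, ?_⟩
  have : CompleteSpace E := FiniteDimensional.complete ℝ E
  have h : ∃ w : VecField E M, ∀ x, w.at x = deriv (fun t => (c t).at x) 0 := by
    refine exists_vecField _ fun p u hp => ?_
    refine (contDiffAt_deriv_param (g := fun z : ℝ × E => coord (c z.1) p z.2)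
      (hj 0 trivial p u hp)).congr_of_eventuallyEq (Eventually.of_forall fun v => ?_)
    exact ((paramDeriv p v).inverse.hasFDerivAt.comp_hasDerivAt (0 : ℝ)
      (hd (p v)).hasDerivAt).deriv.symm
  have e : velocity c = h.choose := dif_pos h
  rw [e]
  exact h.choose_spec

lemma coord_velocity {c : ℝ → VecField E M} (hc : IsFam c) (p : E → M) (u : E) :
    coord (velocity c) p u = deriv (fun t => coord (c t) p u) 0 := by
  obtain ⟨hd, h⟩ := velocity_vecField_apply hc
  have e := ((paramDeriv p u).inverse.hasFDerivAt.comp_hasDerivAt (0 : ℝ)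
      (hd (p u)).hasDerivAt).deriv
  rw [← h] at e
  exact e.symm

instance : LawfulVelocity (VecField E M) :=
  lawfulVelocity_of_components (E := E) (M := M) (V := E) coord coord_add coord_smul
    isFam_vecField (fun _ _ => coord_injective) (fun _ hc p u _ => coord_velocity hc p u)

end Velocities

section Calculus

variable {E : Type*} [NormedAddCommGroup E] [NormedSpace ℝ E] [FiniteDimensional ℝ E]
  {V : Type*} [NormedAddCommGroup V] [NormedSpace ℝ V] [FiniteDimensional ℝ V]
  {M : Type*} [TopologicalSpace M] [ChartedSpace E M] [IsManifold 𝓘(ℝ, E) ∞ M] {r : ℕ}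
  {A : AffineJetAction E V r}
  {F : Type*} [NormedAddCommGroup F] [NormedSpace ℝ F] [FiniteDimensional ℝ F]
  {W : Type*} [AddCommGroup W] [Module ℝ W] [DiffeologicalSpace W] [SmoothModule W]
  [HasVelocity W] [LawfulVelocity W]

lemma isFam_translate {h : F → TFieldsOn A M} {c : F → FieldsOn A M} (hh : IsFam h)
    (hc : IsFam c) : IsFam fun y => h y +ᵥ c y :=
  isFam_field.2 fun y _ p u hp =>
    (isFam_tField.1 hh y trivial p u hp).add (isFam_field.1 hc y trivial p u hp)

lemma IsFam.smul {a : F → ℝ} {c : F → W} (ha : ContDiff ℝ ∞ a) (hc : IsFam c) :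
    IsFam fun y => a y • c y :=
  SmoothModule.isPlot_smul (isFam_iff_contDiff.2 ha) hc

lemma IsFam.add {c c' : F → W} (hc : IsFam c) (hc' : IsFam c') : IsFam fun y => c y + c' y :=
  SmoothModule.isPlot_add hc hc'

lemma isFam_line {n : ℕ} {h : EuclideanSpace ℝ (Fin n) → TFieldsOn A M}
    {c : EuclideanSpace ℝ (Fin n) → FieldsOn A M} (hh : IsFam h) (hc : IsFam c) :
    IsFam fun z : ℝ × EuclideanSpace ℝ (Fin n) => (z.1 • h z.2) +ᵥ c z.2 :=
  isFam_translate ((hh.reparam (g := Prod.snd) contDiff_snd).smul contDiff_fst)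
    (hc.reparam (g := Prod.snd) contDiff_snd)

/-- The derivative `D F (φ) h = d/dt F(φ + t h)` at `t = 0`. -/
def dirDeriv (F : FieldsOn A M → W) (φ : FieldsOn A M) (h : TFieldsOn A M) : W :=
  velocity fun t => F ((t • h) +ᵥ φ)

lemma zero_tvadd (φ : FieldsOn A M) : (0 : TFieldsOn A M) +ᵥ φ = φ :=
  FieldsOn.ext (zero_add φ.1)

lemma add_tvadd (h h' : TFieldsOn A M) (φ : FieldsOn A M) : (h + h') +ᵥ φ = h +ᵥ (h' +ᵥ φ) :=
  FieldsOn.ext (add_assoc h.1 h'.1 φ.1)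

lemma dirDeriv_add {F : FieldsOn A M → W} (hF : DSmooth F) (φ : FieldsOn A M)
    (h h' : TFieldsOn A M) : dirDeriv F φ (h + h') = dirDeriv F φ h + dirDeriv F φ h' := by
  have hc : IsFam fun z : ℝ × ℝ => F ((z.1 • h + z.2 • h') +ᵥ φ) :=
    (isFam_translate (((isFam_const h).smul contDiff_fst).add
      ((isFam_const h').smul contDiff_snd)) (isFam_const φ)).dSmooth_comp hF
  have := LawfulVelocity.velocity_diag hc
  simpa [dirDeriv] using this

lemma dirDeriv_smul {F : FieldsOn A M → W} (hF : DSmooth F) (φ : FieldsOn A M)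
    (a : ℝ) (h : TFieldsOn A M) : dirDeriv F φ (a • h) = a • dirDeriv F φ h := by
  have hc : IsFam fun t : ℝ => F ((t • h) +ᵥ φ) :=
    (isFam_translate ((isFam_const h).smul contDiff_id) (isFam_const φ)).dSmooth_comp hF
  have := LawfulVelocity.velocity_mul hc a
  simpa [dirDeriv, smul_smul] using this

/-- The derivative of a smooth map on `Φ` at `φ`, as a linear map on the tangent space. -/
def derivΦ (F : smoothMaps (FieldsOn A M) W) (φ : FieldsOn A M) : TFieldsOn A M →ₗ[ℝ] W where
  toFun h := dirDeriv F.1 φ h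
  map_add' := dirDeriv_add F.2 φ
  map_smul' := dirDeriv_smul F.2 φ

lemma isPlot_derivΦ (F : smoothMaps (FieldsOn A M) W) {n : ℕ}
    {c : EuclideanSpace ℝ (Fin n) → FieldsOn A M} {h : EuclideanSpace ℝ (Fin n) → TFieldsOn A M}
    (hc : IsPlot c) (hh : IsPlot h) : IsPlot fun y => derivΦ F (c y) (h y) :=
  isPlot_iff_isFam.2 <| LawfulVelocity.isFam_velocity
    ((isFam_line (isPlot_iff_isFam.1 hh) (isPlot_iff_isFam.1 hc)).dSmooth_comp F.2)

/-- The derivative `𝔛(F)` of `F` along the vector field `𝔛` of `Φ`. -/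
def deriveAlong (𝔛 : smoothMaps (FieldsOn A M) (TFieldsOn A M)) (F : smoothMaps (FieldsOn A M) W) :
    smoothMaps (FieldsOn A M) W :=
  ⟨fun φ => derivΦ F φ (𝔛.1 φ), fun n c hc => isPlot_derivΦ F hc (𝔛.2 n c hc)⟩

end Calculus

section Brackets

variable {E : Type*} [NormedAddCommGroup E] [NormedSpace ℝ E] [FiniteDimensional ℝ E]
  {V : Type*} [NormedAddCommGroup V] [NormedSpace ℝ V] [FiniteDimensional ℝ V]
  {M : Type*} [TopologicalSpace M] [ChartedSpace E M] [IsManifold 𝓘(ℝ, E) ∞ M] {r : ℕ}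
  {A : AffineJetAction E V r}

/-- The bracket `[𝔛, 𝔜] = D𝔜(𝔛) - D𝔛(𝔜)` of vector fields on `Φ`. -/
noncomputable def bracketΦ (𝔛 𝔜 : smoothMaps (FieldsOn A M) (TFieldsOn A M)) :
    smoothMaps (FieldsOn A M) (TFieldsOn A M) :=
  deriveAlong 𝔛 𝔜 - deriveAlong 𝔜 𝔛

/-- The vertical vector field `X^v` of a field dependent vector field `X`: its value at `φ` is the
Lie derivative of `φ` along `X(φ)`. -/
noncomputable def vert (X : smoothMaps (FieldsOn A M) (VecField E M)) :
    smoothMaps (FieldsOn A M) (TFieldsOn A M) :=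
  ⟨fun φ => ⟨lieDeriv (X.1 φ) φ.1, isSection_lieDeriv φ.2 (X.1 φ)⟩, dSmooth_of_isFam fun _ c hc =>
    isFam_tField.2 <| jointlySmoothOn_lieDeriv (fun y => (c y).2) (isFam_field.1 hc)
      (isFam_vecField.1 (hc.dSmooth_comp X.2))⟩

lemma two_le_infty : (2 : ℕ∞ω) ≤ ∞ :=
  WithTop.coe_le_coe.2 (le_top : (2 : ℕ∞) ≤ ⊤)

lemma mlieBracket_eq_lieBracket (X Y : (x : E) → TangentSpace 𝓘(ℝ, E) x) :
    VectorField.mlieBracket 𝓘(ℝ, E) X Y = VectorField.lieBracket ℝ X Y := by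
  rw [← VectorField.mlieBracketWithin_univ, VectorField.mlieBracketWithin_eq_lieBracketWithin]
  exact VectorField.lieBracketWithin_univ

/-- The bracket `[X, Y]` of vector fields on `M`. -/
noncomputable def bracketM (X Y : VecField E M) : VecField E M :=
  ⟨VectorField.mlieBracket 𝓘(ℝ, E) X Y, fun x => by
    have : CompleteSpace E := FiniteDimensional.complete ℝ E
    have : IsManifold 𝓘(ℝ, E) (((⊤ : ℕ∞) : ℕ∞ω) + 1) M := by simpa
    have : IsManifold 𝓘(ℝ, E) (minSmoothness ℝ 2) M :=
    IsManifold.of_le (n := ∞) (by simpa using two_le_infty)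
    exact ContMDiffAt.mlieBracket_vectorField (n := ⊤) (m := ⊤) (X.contMDiff x) (Y.contMDiff x)
      (by simp)⟩

lemma coord_bracketM (X Y : VecField E M) {p : E → M} {u : E} (hp : IsParam p u) :
    coord (bracketM X Y) p u = VectorField.lieBracket ℝ (coord X p) (coord Y p) u := by
  have : CompleteSpace E := FiniteDimensional.complete ℝ E
  have e : VectorField.mlieBracket 𝓘(ℝ, E) (coord X p) (coord Y p) =
      VectorField.lieBracket ℝ (coord X p) (coord Y p) :=
    mlieBracket_eq_lieBracket (coord X p) (coord Y p)
  rw [← e]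
  have : IsManifold 𝓘(ℝ, E) (minSmoothness ℝ 2) M :=
    IsManifold.of_le (n := ∞) (by simpa using two_le_infty)
  exact VectorField.mpullback_mlieBracket (n := ∞)
    ((X.contMDiff (p u)).mdifferentiableAt (by simp))
    ((Y.contMDiff (p u)).mdifferentiableAt (by simp)) hp.contMDiffAt
    (by simpa using two_le_infty)

lemma isFam_bracketM {F : Type*} [NormedAddCommGroup F] [NormedSpace ℝ F] [FiniteDimensional ℝ F]
    {X Y : F → VecField E M} (hX : IsFam X) (hY : IsFam Y) :
    IsFam fun y => bracketM (X y) (Y y) := by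
  have : CompleteSpace E := FiniteDimensional.complete ℝ E
  refine isFam_vecField.2 fun y _ p u hp => ?_
  have hX' := isFam_vecField.1 hX y trivial p u hp
  have hY' := isFam_vecField.1 hY y trivial p u hp
  have hd : ∀ {X : F → VecField E M}, IsFam X →
      ContDiffAt ℝ ∞ (fun z : F × E => fderiv ℝ (coord (X z.1) p) z.2) (y, u) := fun {X} hX =>
    ContDiffAt.fderiv (f := fun z : F × E => coord (X z.1) p) (g := Prod.snd) (n := ∞)
      (ContDiffAt.comp (g := fun z : F × E => coord (X z.1) p z.2)
        (f := fun w : (F × E) × E => (w.1.1, w.2)) ((y, u), u)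
        (isFam_vecField.1 hX y trivial p u hp)
        ((contDiffAt_fst.comp _ contDiffAt_fst).prodMk contDiffAt_snd)) contDiffAt_snd (by simp)
  refine (((hd hY).clm_apply hX').sub ((hd hX).clm_apply hY')).congr_of_eventuallyEq ?_
  filter_upwards [(continuous_snd.tendsto (y, u)).eventually hp.eventually] with z hz
  exact coord_bracketM _ _ hz

/-- The pointwise bracket `[X, Y]` of field dependent vector fields. -/
noncomputable def bracketPt (X Y : smoothMaps (FieldsOn A M) (VecField E M)) :
    smoothMaps (FieldsOn A M) (VecField E M) :=
  ⟨fun φ => bracketM (X.1 φ) (Y.1 φ), dSmooth_of_isFam fun _ _ hc =>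
    isFam_bracketM (hc.dSmooth_comp X.2) (hc.dSmooth_comp Y.2)⟩

/-- The bracket `[X, Y]_diff = -[X, Y]` of field dependent vector fields, where `-[·, ·]` is the
bracket of the Lie algebra of the diffeomorphism group. -/
noncomputable def bracketDiff (X Y : smoothMaps (FieldsOn A M) (VecField E M)) :
    smoothMaps (FieldsOn A M) (VecField E M) :=
  -bracketPt X Y

/-- The extended bracket `{X, Y} = [X, Y]_diff + X^v(Y) - Y^v(X)`. -/
noncomputable def extBracket (X Y : smoothMaps (FieldsOn A M) (VecField E M)) :
    smoothMaps (FieldsOn A M) (VecField E M) :=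
  bracketDiff X Y + deriveAlong (vert X) Y - deriveAlong (vert Y) X

end Brackets

section Forms

variable {E : Type*} [NormedAddCommGroup E] [NormedSpace ℝ E] [FiniteDimensional ℝ E]
  {V : Type*} [NormedAddCommGroup V] [NormedSpace ℝ V] [FiniteDimensional ℝ V]
  {M : Type*} [TopologicalSpace M] [ChartedSpace E M] [IsManifold 𝓘(ℝ, E) ∞ M] {r : ℕ}
  {A : AffineJetAction E V r}

/-- The pullback `ψ^* φ` of a field by a diffeomorphism of `M`. -/
noncomputable def pullback (ψ : M ≃ₘ^∞⟮𝓘(ℝ, E), 𝓘(ℝ, E)⟯ M) (φ : FieldsOn A M) : FieldsOn A M :=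
  ⟨fun p => φ.1 (ψ ∘ p), by
    have key : ∀ (χ : M ≃ₘ^∞⟮𝓘(ℝ, E), 𝓘(ℝ, E)⟯ M) (p : E → M) (u : E), IsParam p u →
        IsParam (χ ∘ p) u := by
      intro χ p u hp
      refine ⟨hp.1.mono fun w hw => χ.contMDiff.contMDiffAt.comp w hw, ?_⟩
      rw [mfderiv_comp u (χ.contMDiff.contMDiffAt.mdifferentiableAt (by simp))
        hp.mdifferentiableAt]
      exact ContinuousLinearMap.IsInvertible.comp
        ⟨χ.mfderivToContinuousLinearEquiv (by simp) (p u), rfl⟩ hp.2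
    refine ⟨fun p u hp => φ.2.smooth _ u (key ψ p u hp), fun p q f u hp hf hq =>
      φ.2.transform _ _ f u (key ψ p (f u) hp) hf (hq.mono fun w hw => by simp [hw]),
      fun p u hp => φ.2.zero_off _ u fun h => hp ?_⟩
    have e : ψ.symm ∘ ψ ∘ p = p := by ext w; simp
    rw [← e]
    exact key ψ.symm _ u h⟩

variable {W : Type*} [AddCommGroup W] [Module ℝ W] [DiffeologicalSpace W] [SmoothModule W]

/-- `Ω^k(Φ; W)`, the smooth differential forms of degree `k` on `Φ` with values in `W`. -/
def Form (A : AffineJetAction E V r) (M : Type*) [TopologicalSpace M] [ChartedSpace E M]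
    [IsManifold 𝓘(ℝ, E) ∞ M] (k : ℕ) (W : Type*) [AddCommGroup W] [Module ℝ W]
    [DiffeologicalSpace W] [SmoothModule W] :
    Submodule ℝ (FieldsOn A M → TFieldsOn A M [⋀^Fin k]→ₗ[ℝ] W) where
  carrier := {α | ∀ (n : ℕ) (c : EuclideanSpace ℝ (Fin n) → FieldsOn A M)
    (h : Fin k → EuclideanSpace ℝ (Fin n) → TFieldsOn A M), IsPlot c → (∀ i, IsPlot (h i)) →
    IsPlot fun y => α (c y) fun i => h i y}
  zero_mem' _ _ _ _ _ := isPlot_const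
  add_mem' hα hα' n c h hc hh := SmoothModule.isPlot_add (hα n c h hc hh) (hα' n c h hc hh)
  smul_mem' _ _ hα n c h hc hh := SmoothModule.isPlot_smul isPlot_const (hα n c h hc hh)

/-- The same form, when `k = l`. -/
noncomputable def formCast {k l : ℕ} (e : k = l) (α : Form A M k W) : Form A M l W :=
  ⟨fun φ => (α.1 φ).domDomCongr (finCongr e), fun n c h hc hh =>
    α.2 n c (fun i => h (finCongr e i)) hc fun _ => hh _⟩

/-- A smooth function as a form of degree `0`. -/
noncomputable def ofMap (F : smoothMaps (FieldsOn A M) W) : Form A M 0 W :=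
  ⟨fun φ => AlternatingMap.constOfIsEmpty ℝ (TFieldsOn A M) (Fin 0) (F.1 φ),
    fun n c _ hc _ => F.2 n c hc⟩

/-- The value of a form on constant vector fields. -/
noncomputable def onConst {k : ℕ} (α : Form A M k W) (h : Fin k → TFieldsOn A M) :
    smoothMaps (FieldsOn A M) W :=
  ⟨fun φ => α.1 φ h, fun n c hc => α.2 n c (fun i _ => h i) hc fun _ => isPlot_const⟩

lemma differentiableAt_line (F : smoothMaps (FieldsOn A M) ℝ) (φ : FieldsOn A M)
    (h : TFieldsOn A M) : DifferentiableAt ℝ (fun t : ℝ => F.1 ((t • h) +ᵥ φ)) 0 := by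
  have hc : IsFam fun t : ℝ => F.1 ((t • h) +ᵥ φ) :=
    (isFam_translate ((isFam_const h).smul contDiff_id) (isFam_const φ)).dSmooth_comp F.2
  exact (isFam_iff_contDiff.1 hc).contDiffAt.differentiableAt (by simp)

lemma derivΦ_add (F G : smoothMaps (FieldsOn A M) ℝ) (φ : FieldsOn A M) (h : TFieldsOn A M) :
    derivΦ (F + G) φ h = derivΦ F φ h + derivΦ G φ h :=
  deriv_fun_add (differentiableAt_line F φ h) (differentiableAt_line G φ h)

lemma derivΦ_smul (a : ℝ) (F : smoothMaps (FieldsOn A M) ℝ) (φ : FieldsOn A M)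
    (h : TFieldsOn A M) : derivΦ (a • F) φ h = a • derivΦ F φ h :=
  deriv_fun_const_smul a (differentiableAt_line F φ h)

lemma derivΦ_zero (φ : FieldsOn A M) (h : TFieldsOn A M) :
    derivΦ (0 : smoothMaps (FieldsOn A M) ℝ) φ h = 0 :=
  deriv_const (0 : ℝ) (0 : ℝ)

/-- The derivative of a form at `φ`: the value on `h` and `h₁, …, h_k` is the derivative along `h`
of `α(h₁, …, h_k)`, for constant vector fields `h_i`. -/
noncomputable def derivForm {k : ℕ} (α : Form A M k ℝ) (φ : FieldsOn A M) :
    TFieldsOn A M →ₗ[ℝ] TFieldsOn A M [⋀^Fin k]→ₗ[ℝ] ℝ where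
  toFun h :=
    { toFun := fun hs => derivΦ (onConst α hs) φ h
      map_update_add' := fun hs i a b => by
        rw [← derivΦ_add]
        congr 1
        exact congrArg (derivΦ · φ) (Subtype.ext (funext fun φ' =>
          (α.1 φ').map_update_add _ _ _ _))
      map_update_smul' := fun hs i a b => by
        rw [← derivΦ_smul]
        congr 1
        exact congrArg (derivΦ · φ) (Subtype.ext (funext fun φ' =>
          (α.1 φ').map_update_smul _ _ _ _))
      map_eq_zero_of_eq' := fun hs i j hij hne => by
        rw [← derivΦ_zero φ h]
        congr 1
        exact congrArg (derivΦ · φ) (Subtype.ext (funext fun φ' =>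
          (α.1 φ').map_eq_zero_of_eq _ hij hne)) }
  map_add' h h' := by
    ext hs
    exact map_add (derivΦ (onConst α hs) φ) h h'
  map_smul' a h := by
    ext hs
    exact map_smul (derivΦ (onConst α hs) φ) a h

/-- The exterior derivative `(dα)(h₀, …, h_k) = ∑ᵢ (-1)^i D(α(h₀, …, ĥᵢ, …, h_k))(hᵢ)`. -/
noncomputable def extDeriv {k : ℕ} (α : Form A M k ℝ) : Form A M (k + 1) ℝ :=
  ⟨fun φ => AlternatingMap.alternatizeUncurryFin (derivForm α φ), fun n c h hc hh => by
    simp only [AlternatingMap.alternatizeUncurryFin_apply]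
    refine isPlot_iff_isFam.2 (isFam_iff_contDiff.2 (ContDiff.sum fun i _ =>
      ContDiff.const_smul _ (isFam_iff_contDiff.1 ?_)))
    have hl := isFam_line (isPlot_iff_isFam.1 (hh i)) (isPlot_iff_isFam.1 hc)
    have hα : IsFam fun z : ℝ × EuclideanSpace ℝ (Fin n) =>
        α.1 ((z.1 • h i z.2) +ᵥ c z.2) (i.removeNth fun j => h j z.2) :=
      α.2 _ _ (fun j w => h (i.succAbove j) ((toEuclidean (E := ℝ × EuclideanSpace ℝ (Fin n))).symm
        w).2) hl fun j =>
        (isPlot_iff_isFam.1 (hh (i.succAbove j))).reparam (g := Prod.snd) contDiff_snd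
    exact LawfulVelocity.isFam_velocity hα⟩

lemma isPlot_sum {n : ℕ} {ι : Type*} (s : Finset ι) {c : ι → EuclideanSpace ℝ (Fin n) → W}
    (hc : ∀ i, IsPlot (c i)) : IsPlot fun y => ∑ i ∈ s, c i y := by
  classical
  induction s using Finset.induction_on with
  | empty => simpa using isPlot_const
  | insert i s hi ih =>
    simp only [Finset.sum_insert hi]
    exact SmoothModule.isPlot_add (hc i) ih

lemma isPlot_units_smul {n : ℕ} (a : ℤˣ) {c : EuclideanSpace ℝ (Fin n) → W}
    (hc : IsPlot c) : IsPlot fun y => a • c y := by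
  have := SmoothModule.isPlot_smul (isPlot_const (x := ((a : ℤ) : ℝ))) hc
  convert this using 2 with y
  rw [Units.smul_def, Int.cast_smul_eq_zsmul]

/-- The insertion of a vector valued form `K` of degree `k` in a form `α` of degree `q + 1`: the
value of `ι_K α` on `h₁, …, h_{k+q}` is the sum over all permutations `σ` of
`sign σ / (k! q!) * α(K(h_σ(1), …, h_σ(k)), h_σ(k+1), …, h_σ(k+q))`. -/
noncomputable def insForm {k q : ℕ} (K : Form A M k (TFieldsOn A M)) (α : Form A M (q + 1) W) :
    Form A M (k + q) W :=
  ⟨fun φ => ((k.factorial * q.factorial : ℝ)⁻¹) • MultilinearMap.alternatization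
      ((((AlternatingMap.toMultilinearMapLM ∘ₗ (α.1 φ).curryLeft).compMultilinearMap
        (K.1 φ).toMultilinearMap).uncurrySum).domDomCongr finSumFinEquiv),
    fun n c h hc hh => by
      simp only [AlternatingMap.smul_apply, MultilinearMap.alternatization_apply]
      refine SmoothModule.isPlot_smul isPlot_const (isPlot_sum _ fun σ => isPlot_units_smul _ ?_)
      have hK : IsPlot fun y => K.1 (c y) fun i => h (σ (finSumFinEquiv (.inl i))) y :=
        K.2 n c _ hc fun i => hh _
      have := α.2 n c (Fin.cons (fun y => K.1 (c y) fun i => h (σ (finSumFinEquiv (.inl i))) y)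
        fun i => h (σ (finSumFinEquiv (.inr i)))) hc (Fin.cases hK fun i => hh _)
      convert this using 2 with y
      refine congrArg (α.1 (c y)) (funext fun i => ?_)
      cases i using Fin.cases <;> rfl⟩

/-- The Nijenhuis-Lie derivative `L_K α = ι_K dα - (-1)^(k - 1) d ι_K α`, where `ι_K` is zero on
forms of degree `0`. -/
noncomputable def lieForm {k : ℕ} (K : Form A M k (TFieldsOn A M)) :
    {q : ℕ} → Form A M q ℝ → Form A M (k + q) ℝ
  | 0, α => insForm K (extDeriv α)
  | _ + 1, α => insForm K (extDeriv α) - (-1 : ℝ) ^ ((k : ℤ) - 1) • extDeriv (insForm K α)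

/-- The Lie derivative of forms along a vector field `𝔛` of `Φ`. -/
noncomputable def lieAlong (𝔛 : smoothMaps (FieldsOn A M) (TFieldsOn A M)) {q : ℕ}
    (α : Form A M q ℝ) : Form A M q ℝ :=
  formCast (Nat.zero_add q) (lieForm (ofMap 𝔛) α)

/-- The insertion of a vector valued form in a vector valued form of any degree: it is zero on
forms of degree `0`. -/
noncomputable def insVec {k : ℕ} (K : Form A M k (TFieldsOn A M)) :
    {l : ℕ} → Form A M l (TFieldsOn A M) → Form A M (k + l - 1) (TFieldsOn A M)
  | 0, _ => 0
  | _ + 1, J => insForm K J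

/-- The Nijenhuis-Richardson bracket `[K, J]_NR = ι_K J - (-1)^((k - 1)(l - 1)) ι_J K`. -/
noncomputable def bracketNR {k l : ℕ} (K : Form A M k (TFieldsOn A M))
    (J : Form A M l (TFieldsOn A M)) : Form A M (k + l - 1) (TFieldsOn A M) :=
  insVec K J - (-1 : ℝ) ^ (((k : ℤ) - 1) * ((l : ℤ) - 1)) •
    formCast (by rw [Nat.add_comm]) (insVec J K)

/-- `N` is the Frölicher-Nijenhuis bracket of `K` and `J`: the Nijenhuis-Lie derivative `L_N` is
the graded commutator `L_K L_J - (-1)^(k l) L_J L_K`. -/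
def IsBracketFN {k l : ℕ} (K : Form A M k (TFieldsOn A M)) (J : Form A M l (TFieldsOn A M))
    (N : Form A M (k + l) (TFieldsOn A M)) : Prop :=
  ∀ (q : ℕ) (α : Form A M q ℝ),
    lieForm K (lieForm J α) - (-1 : ℝ) ^ (k * l) •
      formCast (Nat.add_left_comm l k q) (lieForm J (lieForm K α)) =
    formCast (Nat.add_assoc k l q) (lieForm N α)

lemma nat_le_infty {n : ℕ} : (n : ℕ∞ω) ≤ ∞ :=
  WithTop.coe_le_coe.2 (le_top : (n : ℕ∞) ≤ ⊤)

lemma jet_add {f g : E → E} {u : E} (hf : ContDiffAt ℝ ∞ f u) (hg : ContDiffAt ℝ ∞ g u) :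
    jet r (f + g) u = jet r f u + jet r g u :=
  funext fun _ => iteratedFDeriv_add_apply (hf.of_le nat_le_infty) (hg.of_le nat_le_infty)

lemma jet_smul (a : ℝ) {f : E → E} {u : E} (hf : ContDiffAt ℝ ∞ f u) :
    jet r (a • f) u = a • jet r f u :=
  funext fun _ => iteratedFDeriv_const_smul_apply (hf.of_le nat_le_infty)

/-- The Lie derivative of a field `φ` along the vector fields of `M`, as a linear map. -/
noncomputable def lieAt (φ : FieldsOn A M) : VecField E M →ₗ[ℝ] TFieldsOn A M where
  toFun X := ⟨lieDeriv X φ.1, isSection_lieDeriv φ.2 X⟩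
  map_add' X Y := by
    refine TFieldsOn.ext (funext fun p => funext fun u => ?_)
    change lieDeriv (X + Y) φ.1 p u = lieDeriv X φ.1 p u + lieDeriv Y φ.1 p u
    by_cases hp : IsParam p u
    · have e : coord (X + Y) p = coord X p + coord Y p := funext fun u => coord_add X Y p u
      simp only [lieDeriv_apply φ.2 _ hp]
      rw [e, jet_add (contDiffAt_coord X hp) (contDiffAt_coord Y hp)]
      simp only [variation, Pi.add_apply, map_add (fderiv ℝ (φ.val p) u)]
      exact map_add (fderiv ℝ (fun q : Jet E r × V => A.act q.1 q.2) (jet r id u, φ.val p u))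
        (jet r (coord X p) u, fderiv ℝ (φ.val p) u (coord X p u))
        (jet r (coord Y p) u, fderiv ℝ (φ.val p) u (coord Y p u))
    · simp [lieDeriv, hp]
  map_smul' a X := by
    refine TFieldsOn.ext (funext fun p => funext fun u => ?_)
    change lieDeriv (a • X) φ.1 p u = a • lieDeriv X φ.1 p u
    by_cases hp : IsParam p u
    · have e : coord (a • X) p = a • coord X p := funext fun u => coord_smul a X p u
      simp only [lieDeriv_apply φ.2 _ hp]
      rw [e, jet_smul a (contDiffAt_coord X hp)]
      simp only [variation, Pi.smul_apply, map_smul (fderiv ℝ (φ.val p) u)]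
      exact map_smul (fderiv ℝ (fun q : Jet E r × V => A.act q.1 q.2) (jet r id u, φ.val p u)) a
        (jet r (coord X p) u, fderiv ℝ (φ.val p) u (coord X p u))
    · simp [lieDeriv, hp]

/-- The vertical one-form `(dY)^v`: its value at `φ` on `h` is the Lie derivative of `φ` along the
vector field `(dY)_φ(h)`. -/
noncomputable def vertD (Y : smoothMaps (FieldsOn A M) (VecField E M)) :
    Form A M 1 (TFieldsOn A M) :=
  ⟨fun φ => AlternatingMap.ofSubsingleton ℝ (TFieldsOn A M) (TFieldsOn A M) (0 : Fin 1)
    (lieAt φ ∘ₗ derivΦ Y φ), fun _ c _ hc hh =>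
      isPlot_iff_isFam.2 <| isFam_tField.2 <| jointlySmoothOn_lieDeriv (fun y => (c y).2)
        (isFam_field.1 (isPlot_iff_isFam.1 hc))
        (isFam_vecField.1 (isPlot_iff_isFam.1 (isPlot_derivΦ Y hc (hh 0))))⟩

/-- `b` is a Lie bracket on the real vector space `L`. -/
structure IsLieBracket {L : Type*} [AddCommGroup L] [Module ℝ L] (b : L → L → L) : Prop where
  add_left : ∀ x y z, b (x + y) z = b x z + b y z
  add_right : ∀ x y z, b x (y + z) = b x y + b x z
  smul_left : ∀ (a : ℝ) x y, b (a • x) y = a • b x y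
  smul_right : ∀ (a : ℝ) x y, b x (a • y) = a • b x y
  self : ∀ x, b x x = 0
  jacobi : ∀ x y z, b x (b y z) + b y (b z x) + b z (b x y) = 0

end Forms

end FieldSpace

open FieldSpace

/-! Everything rests on one identity for Lie derivatives of sections and on the Cartan calculus of
`Φ`; neither needs a topology on `Φ`, because every derivative is taken along a smooth
finite-dimensional family.

In a parametrization `p`, set `G(j, x) = s(x) · j` (`jetMap`), where `j` is a jet and `x` a point.
By the transformation law, `𝔏_X s` at `u` is the first derivative of `G` at `(jet of id, u)` in the
direction `(jet of X, X(u))`. Only the velocity of a curve of diffeomorphisms and the jet of that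
velocity enter, which gives the pullback formula (`hasDerivAt_pullback`). Deriving once more gives
`𝔏_X 𝔏_Y s = D²G(X, Y) + DG(DY(X))` (`lieDeriv_lieDeriv`). The second derivative is symmetric and
`DG` is linear, so `𝔏_X 𝔏_Y - 𝔏_Y 𝔏_X = 𝔏_[X,Y]` (`lieDeriv_bracketM`).

Since `φ + t h` has Lie derivative `𝔏_Y φ + t 𝔏_Y h`, the derivative of `Y^v` along `h` is
`𝔏_{DY(h)} φ + 𝔏_{Y(φ)} h` (`derivΦ_vert`). Put `h = X^v` and antisymmetrize: the terms in which the
fields are derived give `X^v(Y) - Y^v(X)`, and the double Lie derivatives give `𝔏_Y 𝔏_X φ - 𝔏_X 𝔏_Y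
φ`, that is `-𝔏_[X,Y] φ`. This is `bracketΦ_vert`, and it explains the sign in `[ , ]_diff`.

For the Jacobi identities, vector fields on `Φ` are identified with the derivations they induce on
functions; the commutator of derivations is the bracket (`deriveAlong_bracketΦ`), because second
derivatives are symmetric. The extended bracket is the bracket of an action Lie algebroid: `X ↦
X^v(·)` acts by derivations of the pointwise bracket and, by `bracketΦ_vert`, represents `{ , }` by
commutators (`isLieBracket_of_action`).

On forms, the insertion and the Nijenhuis-Lie derivative of a vector-valued `0`-form are the
classical `ι_𝔛` and `L_𝔛 = ι_𝔛 d + d ι_𝔛`. From `d² = 0` and `L_𝔛 ι_𝔜 - ι_𝔜 L_𝔛 = ι_[𝔛,𝔜]` follows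
`[L_𝔛, L_𝔜] = L_[𝔛,𝔜]` (`lieVF_bracketΦ`). A `0`-form is determined by its action on functions, so
the Frölicher-Nijenhuis bracket is the bracket of vector fields.

One analytic point needs care. The product rule for `β_φ(𝔜(φ))` requires a smooth linear functional
to commute with velocities, although it is only known to preserve smooth families. Hadamard's lemma
supplies this: write `k(s) = k(0) + s k₁(s)` with `k₁` smooth and apply the functional
(`hasDerivAt_linear`). -/

namespace FieldSpace

open FieldSpace.HasVelocity (velocity)

/-! ### Hadamard's lemma with parameters -/

section Hadamard

variable {Z : Type*} [NormedAddCommGroup Z] [NormedSpace ℝ Z]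
  {G : Type*} [NormedAddCommGroup G] [NormedSpace ℝ G]

/-- Differentiation under the integral sign. The dominating function is a constant, obtained from
compactness of `[0, 1]`, so `Z` may be infinite-dimensional. -/
lemma hasFDerivAt_integral_param [CompleteSpace G] {f : ℝ × Z → G} {U : Set Z} (hU : IsOpen U)
    (hf : ∀ θ ∈ Icc (0 : ℝ) 1, ∀ z ∈ U, ContDiffAt ℝ ∞ f (θ, z)) {z : Z} (hz : z ∈ U) :
    HasFDerivAt (fun z => ∫ θ in (0 : ℝ)..1, f (θ, z))
      (∫ θ in (0 : ℝ)..1, (fderiv ℝ f (θ, z)).comp (ContinuousLinearMap.inr ℝ ℝ Z)) z := by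
  have hIoc : ∀ {θ : ℝ}, θ ∈ uIoc (0 : ℝ) 1 → θ ∈ Icc (0 : ℝ) 1 := fun h =>
    Ioc_subset_Icc_self (by rwa [uIoc_of_le zero_le_one] at h)
  have hcont : ∀ z ∈ U, ContinuousOn (fun θ => f (θ, z)) (Icc 0 1) := fun z hz θ hθ =>
    (ContinuousAt.comp (f := fun θ : ℝ => (θ, z)) (hf θ hθ z hz).continuousAt
      (by fun_prop)).continuousWithinAt
  have hg : ∀ θ ∈ Icc (0 : ℝ) 1, ∀ z ∈ U, ContinuousAt
      (fun q => (fderiv ℝ f q).comp (ContinuousLinearMap.inr ℝ ℝ Z)) (θ, z) := fun θ hθ z hz =>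
    (((hf θ hθ z hz).fderiv_right (m := 0) (by simp)).clm_comp
      contDiffAt_const).continuousAt
  have hgc : ContinuousOn
      (fun θ => (fderiv ℝ f (θ, z)).comp (ContinuousLinearMap.inr ℝ ℝ Z)) (Icc 0 1) :=
    fun θ hθ => (ContinuousAt.comp (f := fun θ : ℝ => (θ, z)) (hg θ hθ z hz)
      (by fun_prop)).continuousWithinAt
  obtain ⟨C, hC⟩ := (isCompact_Icc.image_of_continuousOn hgc).isBounded.exists_norm_le
  -- Tube lemma: near each `(θ, z)` the partial derivative has norm below `C + 1`, and finitely many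
  -- such neighbourhoods cover `[0, 1] × {z}`.
  have hb : ∀ᶠ w in 𝓝 z, ∀ θ ∈ Icc (0 : ℝ) 1,
      ‖(fderiv ℝ f (θ, w)).comp (ContinuousLinearMap.inr ℝ ℝ Z)‖ ≤ C + 1 := by
    refine isCompact_Icc.eventually_forall_of_forall_eventually fun θ hθ => ?_
    have h1 := (hg θ hθ z hz).norm.comp (x := (z, θ)) (f := Prod.swap)
      continuous_swap.continuousAt
    exact (h1.eventually_lt_const (u := C + 1) ((hC _ (mem_image_of_mem
      (fun θ => (fderiv ℝ f (θ, z)).comp (ContinuousLinearMap.inr ℝ ℝ Z)) hθ)).trans_lt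
        (lt_add_one C))).mono fun q hq => hq.le
  have hm : ∀ w ∈ U, MeasureTheory.AEStronglyMeasurable (fun θ => f (θ, w))
      (MeasureTheory.volume.restrict (uIoc 0 1)) := fun w hw => by
    rw [uIoc_of_le zero_le_one]
    exact ((hcont w hw).mono
      Ioc_subset_Icc_self).aestronglyMeasurable measurableSet_Ioc
  refine intervalIntegral.hasFDerivAt_integral_of_dominated_of_fderiv_le
    (F := fun w θ => f (θ, w)) (bound := fun _ => C + 1)
    (F' := fun w θ => (fderiv ℝ f (θ, w)).comp (ContinuousLinearMap.inr ℝ ℝ Z))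
    (hb.and (hU.mem_nhds hz)) ?_ ?_ ?_ ?_ ?_ ?_
  · filter_upwards [hU.mem_nhds hz] with w hw using hm w hw
  · refine ContinuousOn.intervalIntegrable ?_
    rw [uIcc_of_le zero_le_one]
    exact hcont z hz
  · rw [uIoc_of_le zero_le_one]
    exact (hgc.mono Ioc_subset_Icc_self).aestronglyMeasurable measurableSet_Ioc
  · exact Eventually.of_forall fun θ hθ w hw => hw.1 θ (hIoc hθ)
  · exact intervalIntegrable_const
  · exact Eventually.of_forall fun θ hθ w hw =>
      ((hf θ (hIoc hθ) w hw.2).differentiableAt (by simp)).hasFDerivAt.comp w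
        (hasFDerivAt_prodMk_right θ w)

universe u v

/-- The derivative of the integral is again an integral of the same kind, with values in `Z →L[ℝ]
G`. The induction therefore runs over all target spaces at once, in a universe closed under this
operation. -/
lemma contDiffAt_integral_param_aux {Z : Type u} [NormedAddCommGroup Z] [NormedSpace ℝ Z]
    {U : Set Z} (hU : IsOpen U) (n : ℕ) :
    ∀ {G : Type max u v} [NormedAddCommGroup G] [NormedSpace ℝ G] [CompleteSpace G]
      {f : ℝ × Z → G}, (∀ θ ∈ Icc (0 : ℝ) 1, ∀ z ∈ U, ContDiffAt ℝ ∞ f (θ, z)) →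
      ∀ z ∈ U, ContDiffAt ℝ n (fun z => ∫ θ in (0 : ℝ)..1, f (θ, z)) z := by
  induction n with
  | zero =>
    intro G _ _ _ f hf z hz
    exact contDiffAt_zero.2 ⟨U, hU.mem_nhds hz, fun w hw =>
      (hasFDerivAt_integral_param hU hf hw).continuousAt.continuousWithinAt⟩
  | succ n ih =>
    intro G _ _ _ f hf z hz
    refine contDiffAt_succ_iff_hasFDerivAt.2 ⟨_, ⟨U, hU.mem_nhds hz, fun w hw =>
      hasFDerivAt_integral_param hU hf hw⟩, ?_⟩
    exact ih (f := fun q => (fderiv ℝ f q).comp (ContinuousLinearMap.inr ℝ ℝ Z))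
      (fun θ hθ z hz => ((hf θ hθ z hz).fderiv_right (m := ∞) (by simp)).clm_comp
        contDiffAt_const) z hz

/-- The integral of a smooth function of a parameter is smooth. -/
lemma contDiffAt_integral_param {Z : Type u} [NormedAddCommGroup Z] [NormedSpace ℝ Z]
    {G : Type v} [NormedAddCommGroup G] [NormedSpace ℝ G] [CompleteSpace G]
    {U : Set Z} (hU : IsOpen U) {f : ℝ × Z → G}
    (hf : ∀ θ ∈ Icc (0 : ℝ) 1, ∀ z ∈ U, ContDiffAt ℝ ∞ f (θ, z)) {z : Z} (hz : z ∈ U) :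
    ContDiffAt ℝ ∞ (fun z => ∫ θ in (0 : ℝ)..1, f (θ, z)) z := by
  -- The target is lifted to the universe in which the induction was carried out.
  let e : ULift.{max u v} G ≃ₗᵢ[ℝ] G := LinearIsometryEquiv.ulift ℝ G
  have : CompleteSpace (ULift.{max u v} G) :=
    (completeSpace_congr (e := e.toEquiv) e.isometry.isUniformEmbedding).2 ‹_›
  refine contDiffAt_infty.2 fun n => ?_
  have h := contDiffAt_integral_param_aux.{u, max u v} hU n (f := fun q => e.symm (f q))
    (fun θ hθ z hz => e.symm.contDiff.contDiffAt.comp _ (hf θ hθ z hz)) z hz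
  have h' := e.contDiff.contDiffAt.comp z h
  refine h'.congr_of_eventuallyEq (Eventually.of_forall fun w => ?_)
  exact (e.toLinearIsometry.intervalIntegral_comp_comm fun θ => e.symm (f (θ, w))).symm.trans
    (by simp) |>.symm

/-- Hadamard's lemma: the difference quotient of a smooth function is smooth. -/
lemma contDiffAt_dslope_param [CompleteSpace G] {f : ℝ × Z → G} {z : Z}
    (hf : ∀ᶠ q in 𝓝 ((0 : ℝ), z), ContDiffAt ℝ ∞ f q) :
    ContDiffAt ℝ ∞ (fun q : ℝ × Z => dslope (fun t => f (t, q.2)) 0 q.1) (0, z) := by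
  obtain ⟨ε, hε, hball⟩ := Metric.eventually_nhds_iff_ball.1 hf
  -- A ball of the maximum metric centred at time `0` is stable under shrinking the time by `θ`.
  have hmem : ∀ θ ∈ Icc (0 : ℝ) 1, ∀ q ∈ Metric.ball ((0 : ℝ), z) ε,
      (θ * q.1, q.2) ∈ Metric.ball ((0 : ℝ), z) ε := by
    rintro θ ⟨h0, h1⟩ ⟨s, w⟩ hq
    rw [Metric.mem_ball, Prod.dist_eq, max_lt_iff, Real.dist_eq, sub_zero] at hq ⊢
    refine ⟨lt_of_le_of_lt ?_ hq.1, hq.2⟩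
    rw [abs_mul, abs_of_nonneg h0]
    exact mul_le_of_le_one_left (abs_nonneg s) h1
  have hsm : ∀ θ ∈ Icc (0 : ℝ) 1, ∀ q ∈ Metric.ball ((0 : ℝ), z) ε,
      ContDiffAt ℝ ∞ (fun y : ℝ × (ℝ × Z) => fderiv ℝ f (y.1 * y.2.1, y.2.2) (1, 0)) (θ, q) :=
    fun θ hθ q hq => (((hball _ (hmem θ hθ q hq)).fderiv_right (m := ∞) (by simp)).comp (θ, q)
      (f := fun y : ℝ × (ℝ × Z) => (y.1 * y.2.1, y.2.2)) (by fun_prop)).clm_apply contDiffAt_const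
  have hd : ∀ q ∈ Metric.ball ((0 : ℝ), z) ε,
      HasDerivAt (fun t => f (t, q.2)) (fderiv ℝ f q (1, 0)) q.1 := fun q hq =>
    ((hball q hq).differentiableAt (by simp)).hasFDerivAt.comp_hasDerivAt q.1
      (f := fun t => (t, q.2)) ((hasDerivAt_id _).prodMk (hasDerivAt_const _ _))
  -- The difference quotient is `∫₀¹ ∂ₜf(θ t, z) dθ`, also at `t = 0`, where `dslope` is the
  -- derivative.
  refine (contDiffAt_integral_param Metric.isOpen_ball hsm
    (Metric.mem_ball_self hε)).congr_of_eventuallyEq ?_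
  filter_upwards [Metric.ball_mem_nhds _ hε] with q hq
  have hint : ∀ θ ∈ uIcc (0 : ℝ) 1, HasDerivAt (fun θ => f (θ * q.1, q.2))
      (q.1 • fderiv ℝ f (θ * q.1, q.2) (1, 0)) θ := fun θ hθ =>
    HasDerivAt.scomp (g₁ := fun t => f (t, q.2)) (h := fun θ => θ * q.1) θ
      (hd _ (hmem θ (by rwa [uIcc_of_le zero_le_one] at hθ) q hq))
      (by simpa using (hasDerivAt_id θ).mul_const q.1)
  by_cases h0 : q.1 = 0
  · have h := (hd _ (hmem 0 (by simp) q hq)).deriv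
    simp only [zero_mul] at h
    simp [h0, h]
  · have hI : IntervalIntegrable (fun θ => q.1 • fderiv ℝ f (θ * q.1, q.2) (1, 0))
        MeasureTheory.volume 0 1 := by
      refine ContinuousOn.intervalIntegrable fun θ hθ => ContinuousAt.continuousWithinAt ?_
      rw [uIcc_of_le zero_le_one] at hθ
      exact (ContinuousAt.comp (f := fun θ : ℝ => (θ, q)) (hsm θ hθ q hq).continuousAt
        (by fun_prop)).const_smul q.1
    have h := intervalIntegral.integral_eq_sub_of_hasDerivAt hint hI
    rw [intervalIntegral.integral_smul] at h
    rw [dslope_of_ne _ h0, slope_def_module]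
    simp only [one_mul, zero_mul] at h
    rw [sub_zero, ← h, inv_smul_smul₀ h0]

end Hadamard

section Fields

variable {E : Type*} [NormedAddCommGroup E] [NormedSpace ℝ E] [FiniteDimensional ℝ E]
  {V : Type*} [NormedAddCommGroup V] [NormedSpace ℝ V] [FiniteDimensional ℝ V]
  {M : Type*} [TopologicalSpace M] [ChartedSpace E M] [IsManifold 𝓘(ℝ, E) ∞ M] {r : ℕ}
  {A : AffineJetAction E V r}

/-! ### Smooth linear functionals and velocities -/

section LinearFunctionals

/-- Hadamard's lemma for curves of tangent vectors. -/
lemma exists_difference_quotient {k : ℝ → TFieldsOn A M} (hk : IsFam k) :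
    ∃ k₁ : ℝ → TFieldsOn A M, IsFam k₁ ∧ k₁ 0 = velocity k ∧ ∀ s, k s = k 0 + s • k₁ s := by
  classical
  have : CompleteSpace E := FiniteDimensional.complete ℝ E
  have : CompleteSpace V := FiniteDimensional.complete ℝ V
  have hj := isFam_tField.1 hk
  -- Built from tangent vectors, so that each value is a section; its components are then the
  -- functions `dslope`, to which Hadamard's lemma applies near `s = 0`.
  let k₁ : ℝ → TFieldsOn A M := fun s => if s = 0 then velocity k else s⁻¹ • (k s - k 0)
  have e : ∀ s p u, (k₁ s).1 p u = dslope (fun t => (k t).1 p u) 0 s := by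
    intro s p u
    by_cases hs : s = 0
    · simp [k₁, hs, velocity_tField hk p u]
    · simp [k₁, hs, dslope_of_ne _ hs, slope_def_module]
  refine ⟨k₁, isFam_tField.2 fun s _ p u hp => ?_, by simp [k₁], fun s => ?_⟩
  · by_cases hs : s = 0
    · subst hs
      have hev : ∀ᶠ q in 𝓝 ((0 : ℝ), u), ContDiffAt ℝ ∞ (fun z : ℝ × E => (k z.1).1 p z.2) q :=
        ((continuous_snd.tendsto ((0 : ℝ), u)).eventually hp.eventually).mono
          fun q hq => hj q.1 trivial p q.2 hq
      exact (contDiffAt_dslope_param hev).congr_of_eventuallyEq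
        (Eventually.of_forall fun q => e _ _ _)
    · have h1 : ContDiffAt ℝ ∞ (fun z : ℝ × E => (k 0).1 p z.2) (s, u) :=
        ((k 0).2.smooth p u hp).comp (s, u) contDiffAt_snd
      have h2 : ContDiffAt ℝ ∞ (fun z : ℝ × E => z.1⁻¹) (s, u) := contDiffAt_fst.inv hs
      refine (h2.smul ((hj s trivial p u hp).sub h1)).congr_of_eventuallyEq ?_
      filter_upwards [(continuous_fst.tendsto (s, u)).eventually (isOpen_ne.mem_nhds hs)] with z hz
      simp [k₁, show z.1 ≠ 0 from hz]
  · by_cases hs : s = 0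
    · simp [hs]
    · simp [k₁, hs, smul_smul]

/-- Smooth linear functionals on the tangent space commute with derivatives. -/
lemma hasDerivAt_linear {ℓ : TFieldsOn A M →ₗ[ℝ] ℝ} (hℓ : DSmooth ℓ) {k : ℝ → TFieldsOn A M}
    (hk : IsFam k) : HasDerivAt (fun s => ℓ (k s)) (ℓ (velocity k)) 0 := by
  obtain ⟨k₁, hk₁, h0, h⟩ := exists_difference_quotient hk
  have hd : HasDerivAt (fun s => ℓ (k₁ s)) (deriv (fun s => ℓ (k₁ s)) 0) 0 :=
    ((isFam_iff_contDiff.1 (hk₁.dSmooth_comp hℓ)).contDiffAt.differentiableAt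
      (by simp)).hasDerivAt
  -- By linearity alone; the derivative at `0` is then `ℓ (k₁ 0)`, with no continuity of `ℓ` used
  -- beyond the smoothness of `ℓ ∘ k₁`.
  have e : (fun s => ℓ (k s)) = fun s => ℓ (k 0) + s * ℓ (k₁ s) :=
    funext fun s => by rw [h s]; simp
  rw [e]
  simpa [h0] using ((hasDerivAt_id (0 : ℝ)).mul hd).const_add (ℓ (k 0))

/-- A smooth linear functional which commutes with velocities. -/
structure IsSmoothFunctional {W : Type*} [AddCommGroup W] [Module ℝ W] [DiffeologicalSpace W]
    [HasVelocity W] (ℓ : W →ₗ[ℝ] ℝ) : Prop where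
  dSmooth : DSmooth ℓ
  hasDerivAt : ∀ {c : ℝ → W}, IsFam c → HasDerivAt (fun t => ℓ (c t)) (ℓ (velocity c)) 0

/-- The smooth linear functionals which commute with velocities separate the points. -/
class SeparatedVelocity (W : Type*) [AddCommGroup W] [Module ℝ W] [DiffeologicalSpace W]
    [HasVelocity W] : Prop where
  eq_of_forall : ∀ {w w' : W}, (∀ ℓ : W →ₗ[ℝ] ℝ, IsSmoothFunctional ℓ → ℓ w = ℓ w') → w = w'

instance : SeparatedVelocity ℝ where
  eq_of_forall h := h LinearMap.id ⟨fun _ _ hc => hc, fun hc =>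
    ((isFam_iff_contDiff.1 hc).contDiffAt.differentiableAt (by simp)).hasDerivAt⟩

/-- The functional `h ↦ l (h p u)` on the tangent space. -/
def evalT (p : E → M) (u : E) (l : V →ₗ[ℝ] ℝ) : TFieldsOn A M →ₗ[ℝ] ℝ where
  toFun h := l (h.1 p u)
  map_add' _ _ := map_add l _ _
  map_smul' a _ := map_smul l a _

/-- The functional `X ↦ l (X p u)` on the vector fields on `M`. -/
noncomputable def evalX (p : E → M) (u : E) (l : E →ₗ[ℝ] ℝ) : VecField E M →ₗ[ℝ] ℝ where
  toFun X := l (coord X p u)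
  map_add' X Y := by rw [coord_add, map_add]
  map_smul' a X := by rw [coord_smul, map_smul]; rfl

lemma eq_of_forall_linear {G : Type*} [AddCommGroup G] [Module ℝ G] {v w : G}
    (h : ∀ l : G →ₗ[ℝ] ℝ, l v = l w) : v = w :=
  (Module.forall_dual_apply_eq_zero_iff ℝ (v - w)).1 (fun l => by rw [map_sub, h l, sub_self]) |>
    sub_eq_zero.1

lemma contDiff_eval {F : Type*} [NormedAddCommGroup F] [NormedSpace ℝ F]
    {c : F → (E → M) → E → V} (hc : JointlySmoothOn univ c) {p : E → M} {u : E}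
    (hp : IsParam p u) : ContDiff ℝ ∞ fun y => c y p u :=
  contDiff_iff_contDiffAt.2 fun y => (hc y trivial p u hp).comp y (f := fun y => (y, u))
    (contDiffAt_id.prodMk contDiffAt_const)

/-- Velocities of curves of tangent vectors are computed componentwise, so evaluation at a point
commutes with them. These functionals already separate the tangent vectors. -/
lemma isSmoothFunctional_evalT {p : E → M} {u : E} (hp : IsParam p u) (l : V →ₗ[ℝ] ℝ) :
    IsSmoothFunctional (evalT (A := A) p u l) where
  dSmooth := dSmooth_of_isFam fun _ _ hc => isFam_iff_contDiff.2
    (l.toContinuousLinearMap.contDiff.comp (contDiff_eval (isFam_tField.1 hc) hp))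
  hasDerivAt {c} hc := by
    have h := ((contDiff_eval (isFam_tField.1 hc) hp).contDiffAt (x := 0)).differentiableAt
      (by simp) |>.hasDerivAt
    rw [← velocity_tField hc p u] at h
    exact l.toContinuousLinearMap.hasFDerivAt.comp_hasDerivAt (0 : ℝ) h

lemma isSmoothFunctional_evalX {p : E → M} {u : E} (hp : IsParam p u) (l : E →ₗ[ℝ] ℝ) :
    IsSmoothFunctional (evalX p u l) where
  dSmooth := dSmooth_of_isFam fun _ _ hc => isFam_iff_contDiff.2
    (l.toContinuousLinearMap.contDiff.comp (contDiff_eval (isFam_vecField.1 hc) hp))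
  hasDerivAt {c} hc := by
    have h := ((contDiff_eval (isFam_vecField.1 hc) hp).contDiffAt (x := 0)).differentiableAt
      (by simp) |>.hasDerivAt
    rw [← coord_velocity hc p u] at h
    exact l.toContinuousLinearMap.hasFDerivAt.comp_hasDerivAt (0 : ℝ) h

lemma tFields_ext {w w' : TFieldsOn A M} (h : ∀ p u, IsParam p u → w.1 p u = w'.1 p u) :
    w = w' := by
  refine TFieldsOn.ext (funext fun p => funext fun u => ?_)
  by_cases hp : IsParam p u
  · exact h p u hp
  · rw [w.2.zero_off p u hp, w'.2.zero_off p u hp]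

instance : SeparatedVelocity (TFieldsOn A M) where
  eq_of_forall h := tFields_ext fun p u hp => eq_of_forall_linear fun l =>
    h (evalT p u l) (isSmoothFunctional_evalT hp l)

instance : SeparatedVelocity (VecField E M) where
  eq_of_forall h := coord_injective fun p u hp => eq_of_forall_linear fun l =>
    h (evalX p u l) (isSmoothFunctional_evalX hp l)

end LinearFunctionals

/-! ### Vector fields on `Φ` as derivations -/

section Derivations

variable {W : Type*} [AddCommGroup W] [Module ℝ W] [DiffeologicalSpace W] [SmoothModule W]
  [HasVelocity W] [LawfulVelocity W]

/-- A constant smooth map. -/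
def constMap (w : W) : smoothMaps (FieldsOn A M) W := ⟨fun _ => w, dSmooth_const⟩

/-- The composition of a smooth map with a smooth linear functional. -/
def postcomp (ℓ : W →ₗ[ℝ] ℝ) (hℓ : DSmooth ℓ) (F : smoothMaps (FieldsOn A M) W) :
    smoothMaps (FieldsOn A M) ℝ := ⟨fun φ => ℓ (F.1 φ), fun n c hc => hℓ n _ (F.2 n c hc)⟩

lemma isFam_straight (φ : FieldsOn A M) (h : TFieldsOn A M) :
    IsFam fun t : ℝ => (t • h) +ᵥ φ :=
  isFam_translate ((isFam_const h).smul contDiff_id) (isFam_const φ)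

lemma derivΦ_postcomp {ℓ : W →ₗ[ℝ] ℝ} (hℓ : IsSmoothFunctional ℓ)
    (F : smoothMaps (FieldsOn A M) W) (φ : FieldsOn A M) (h : TFieldsOn A M) :
    derivΦ (postcomp ℓ hℓ.dSmooth F) φ h = ℓ (derivΦ F φ h) :=
  (hℓ.hasDerivAt ((isFam_straight φ h).dSmooth_comp F.2)).deriv

lemma deriveAlong_postcomp {ℓ : W →ₗ[ℝ] ℝ} (hℓ : IsSmoothFunctional ℓ)
    (𝔛 : smoothMaps (FieldsOn A M) (TFieldsOn A M)) (F : smoothMaps (FieldsOn A M) W) :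
    deriveAlong 𝔛 (postcomp ℓ hℓ.dSmooth F) = postcomp ℓ hℓ.dSmooth (deriveAlong 𝔛 F) :=
  Subtype.ext (funext fun φ => derivΦ_postcomp hℓ F φ _)

section Separated

variable [SeparatedVelocity W]

lemma smoothMaps_ext {F G : smoothMaps (FieldsOn A M) W}
    (h : ∀ (ℓ : W →ₗ[ℝ] ℝ) (hℓ : IsSmoothFunctional ℓ),
      postcomp ℓ hℓ.dSmooth F = postcomp ℓ hℓ.dSmooth G) : F = G :=
  Subtype.ext (funext fun φ => SeparatedVelocity.eq_of_forall fun ℓ hℓ =>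
    congrFun (congrArg Subtype.val (h ℓ hℓ)) φ)

/-- Testing against separating functionals reduces the sum rule in `W`, whose velocity is only
axiomatized, to that for real functions. -/
lemma derivΦ_map_add (F G : smoothMaps (FieldsOn A M) W) (φ : FieldsOn A M)
    (h : TFieldsOn A M) : derivΦ (F + G) φ h = derivΦ F φ h + derivΦ G φ h := by
  refine SeparatedVelocity.eq_of_forall fun ℓ hℓ => ?_
  rw [map_add, ← derivΦ_postcomp hℓ, ← derivΦ_postcomp hℓ, ← derivΦ_postcomp hℓ, ← derivΦ_add]
  exact congrArg (derivΦ · φ h) (Subtype.ext (funext fun φ => map_add ℓ _ _))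

lemma derivΦ_map_smul (a : ℝ) (F : smoothMaps (FieldsOn A M) W) (φ : FieldsOn A M)
    (h : TFieldsOn A M) : derivΦ (a • F) φ h = a • derivΦ F φ h := by
  refine SeparatedVelocity.eq_of_forall fun ℓ hℓ => ?_
  rw [map_smul, ← derivΦ_postcomp hℓ, ← derivΦ_postcomp hℓ, ← derivΦ_smul]
  exact congrArg (derivΦ · φ h) (Subtype.ext (funext fun φ => map_smul ℓ _ _))

/-- The derivative along a vector field, as a bilinear map. -/
def deriveLM : smoothMaps (FieldsOn A M) (TFieldsOn A M) →ₗ[ℝ]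
    smoothMaps (FieldsOn A M) W →ₗ[ℝ] smoothMaps (FieldsOn A M) W :=
  LinearMap.mk₂ ℝ deriveAlong
    (fun _ _ F => Subtype.ext (funext fun φ => map_add (derivΦ F φ) _ _))
    (fun a _ F => Subtype.ext (funext fun φ => map_smul (derivΦ F φ) a _))
    (fun _ F G => Subtype.ext (funext fun φ => derivΦ_map_add F G φ _))
    (fun a _ F => Subtype.ext (funext fun φ => derivΦ_map_smul a F φ _))

end Separated

/-- A one-form on `Φ` evaluated on a vector field. -/
def pair (β : FieldsOn A M → TFieldsOn A M →ₗ[ℝ] ℝ)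
    (hβ : ∀ (n : ℕ) (c : EuclideanSpace ℝ (Fin n) → FieldsOn A M)
      (h : EuclideanSpace ℝ (Fin n) → TFieldsOn A M), IsPlot c → IsPlot h →
      IsPlot fun y => β (c y) (h y)) (𝔜 : smoothMaps (FieldsOn A M) (TFieldsOn A M)) :
    smoothMaps (FieldsOn A M) ℝ :=
  ⟨fun φ => β φ (𝔜.1 φ), fun n c hc => hβ n c _ hc (𝔜.2 n c hc)⟩

/-- The product rule for the evaluation of a one-form on a vector field. -/
lemma derivΦ_pair {β : FieldsOn A M → TFieldsOn A M →ₗ[ℝ] ℝ}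
    (hβ : ∀ (n : ℕ) (c : EuclideanSpace ℝ (Fin n) → FieldsOn A M)
      (h : EuclideanSpace ℝ (Fin n) → TFieldsOn A M), IsPlot c → IsPlot h →
      IsPlot fun y => β (c y) (h y)) (𝔜 : smoothMaps (FieldsOn A M) (TFieldsOn A M))
    (φ : FieldsOn A M) (x : TFieldsOn A M) :
    derivΦ (pair β hβ 𝔜) φ x =
      derivΦ (pair β hβ (constMap (𝔜.1 φ))) φ x + β φ (derivΦ 𝔜 φ x) := by
  -- The two occurrences of the time are made independent; the derivative along the diagonal is the
  -- sum of the two partial derivatives.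
  have hc : IsFam fun z : ℝ × ℝ => β ((z.1 • x) +ᵥ φ) (𝔜.1 ((z.2 • x) +ᵥ φ)) :=
    hβ _ _ _ ((isFam_straight φ x).reparam (g := Prod.fst) contDiff_fst)
      (((isFam_straight φ x).dSmooth_comp 𝔜.2).reparam (g := Prod.snd) contDiff_snd)
  have h := LawfulVelocity.velocity_diag hc
  simp only [zero_smul, zero_tvadd] at h
  refine h.trans (congrArg₂ (· + ·) rfl ?_)
  -- At the fixed base point `φ` the form is a smooth linear functional, so it commutes with the
  -- velocity of `𝔜`.
  exact (hasDerivAt_linear (ℓ := β φ) (fun n c hc => hβ n _ c isPlot_const hc)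
    ((isFam_straight φ x).dSmooth_comp 𝔜.2)).deriv

/-- Second derivatives are symmetric. -/
lemma derivΦ_derivΦ_comm (F : smoothMaps (FieldsOn A M) ℝ) (φ : FieldsOn A M)
    (x y : TFieldsOn A M) :
    derivΦ (deriveAlong (constMap y) F) φ x = derivΦ (deriveAlong (constMap x) F) φ y := by
  let g : ℝ × ℝ → ℝ := fun z => F.1 ((z.1 • x + z.2 • y) +ᵥ φ)
  have hg : ContDiff ℝ ∞ g := isFam_iff_contDiff.1
    ((isFam_translate (((isFam_const x).smul contDiff_fst).add
      ((isFam_const y).smul contDiff_snd)) (isFam_const φ)).dSmooth_comp F.2)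
  -- Schwarz's theorem for the function `F(φ + t x + s y)` of two real variables.
  have h := hasDerivAt_fderiv_swap (fun t s => g (t, s)) 0 0 hg.contDiffAt
  have h' := (h.clm_apply (hasDerivAt_const (0 : ℝ) (1 : ℝ))).deriv
  simp only [fderiv_apply_one_eq_deriv, map_zero, add_zero] at h'
  refine Eq.trans ?_ (h'.trans ?_)
  · change deriv (fun s => deriv (fun t => F.1 ((t • y) +ᵥ ((s • x) +ᵥ φ))) 0) 0 = _
    simp only [g, ← add_tvadd, add_comm]
  · change _ = deriv (fun s => deriv (fun t => F.1 ((t • x) +ᵥ ((s • y) +ᵥ φ))) 0) 0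
    simp only [g, ← add_tvadd]

lemma isPlot_derivΦ_pair (F : smoothMaps (FieldsOn A M) W) : ∀ (n : ℕ)
    (c : EuclideanSpace ℝ (Fin n) → FieldsOn A M) (h : EuclideanSpace ℝ (Fin n) → TFieldsOn A M),
    IsPlot c → IsPlot h → IsPlot fun y => derivΦ F (c y) (h y) :=
  fun _ _ _ hc hh => isPlot_derivΦ F hc hh

/-- The product rule for the one-form `DF` paired with `𝔜`; the first term is the second derivative
of `F`, with `𝔜` frozen at `φ`. -/
lemma derivΦ_deriveAlong (𝔜 : smoothMaps (FieldsOn A M) (TFieldsOn A M))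
    (F : smoothMaps (FieldsOn A M) ℝ) (φ : FieldsOn A M) (x : TFieldsOn A M) :
    derivΦ (deriveAlong 𝔜 F) φ x =
      derivΦ (deriveAlong (constMap (𝔜.1 φ)) F) φ x + derivΦ F φ (derivΦ 𝔜 φ x) :=
  derivΦ_pair (isPlot_derivΦ_pair F) 𝔜 φ x

/-- In the commutator the second derivatives `D²F(𝔛, 𝔜)` cancel by symmetry, and `DF(D𝔜(𝔛) - D𝔛(𝔜))`
remains. -/
lemma deriveAlong_bracketΦ_real (𝔛 𝔜 : smoothMaps (FieldsOn A M) (TFieldsOn A M))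
    (F : smoothMaps (FieldsOn A M) ℝ) :
    deriveAlong (bracketΦ 𝔛 𝔜) F =
      deriveAlong 𝔛 (deriveAlong 𝔜 F) - deriveAlong 𝔜 (deriveAlong 𝔛 F) := by
  refine Subtype.ext (funext fun φ => ?_)
  change derivΦ F φ (derivΦ 𝔜 φ (𝔛.1 φ) - derivΦ 𝔛 φ (𝔜.1 φ)) =
    derivΦ (deriveAlong 𝔜 F) φ (𝔛.1 φ) - derivΦ (deriveAlong 𝔛 F) φ (𝔜.1 φ)
  rw [derivΦ_deriveAlong 𝔜, derivΦ_deriveAlong 𝔛, derivΦ_derivΦ_comm F φ (𝔛.1 φ), map_sub]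
  ring

/-- The bracket of vector fields acts by the commutator. -/
lemma deriveAlong_bracketΦ [SeparatedVelocity W]
    (𝔛 𝔜 : smoothMaps (FieldsOn A M) (TFieldsOn A M)) (F : smoothMaps (FieldsOn A M) W) :
    deriveAlong (bracketΦ 𝔛 𝔜) F =
      deriveAlong 𝔛 (deriveAlong 𝔜 F) - deriveAlong 𝔜 (deriveAlong 𝔛 F) := by
  refine smoothMaps_ext fun ℓ hℓ => ?_
  rw [← deriveAlong_postcomp hℓ, deriveAlong_bracketΦ_real, deriveAlong_postcomp hℓ,
    deriveAlong_postcomp hℓ, deriveAlong_postcomp hℓ, deriveAlong_postcomp hℓ]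
  exact Subtype.ext (funext fun φ => (map_sub ℓ _ _).symm)

/-- The smooth function `φ ↦ l (φ p u)`. -/
def evalField (p : E → M) (u : E) (hp : IsParam p u) (l : V →ₗ[ℝ] ℝ) :
    smoothMaps (FieldsOn A M) ℝ :=
  ⟨fun φ => l (φ.1 p u), dSmooth_of_isFam fun _ _ hc => isFam_iff_contDiff.2
    (l.toContinuousLinearMap.contDiff.comp (contDiff_eval (isFam_field.1 hc) hp))⟩

/-- The evaluation is affine along the line `φ + t h`. Hence these coordinate functions detect every
tangent vector. -/
lemma derivΦ_evalField {p : E → M} {u : E} (hp : IsParam p u) (l : V →ₗ[ℝ] ℝ)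
    (φ : FieldsOn A M) (h : TFieldsOn A M) :
    derivΦ (evalField p u hp l) φ h = l (h.1 p u) := by
  have hd : HasDerivAt (fun t : ℝ => t * l (h.1 p u) + l (φ.1 p u)) (l (h.1 p u)) 0 := by
    simpa using ((hasDerivAt_id (0 : ℝ)).mul_const (l (h.1 p u))).add_const (l (φ.1 p u))
  refine Eq.trans (congrArg (deriv · 0) (funext fun t => ?_)) hd.deriv
  change l ((t • h.1 + φ.1) p u) = _
  simp

/-- A vector field on `Φ` is determined by the derivatives of functions along it. -/
lemma vectorField_ext {𝔛 𝔜 : smoothMaps (FieldsOn A M) (TFieldsOn A M)}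
    (h : ∀ F : smoothMaps (FieldsOn A M) ℝ, deriveAlong 𝔛 F = deriveAlong 𝔜 F) : 𝔛 = 𝔜 := by
  refine Subtype.ext (funext fun φ => tFields_ext fun p u hp => eq_of_forall_linear fun l => ?_)
  have := congrFun (congrArg Subtype.val (h (evalField p u hp l))) φ
  exact (derivΦ_evalField hp l φ _).symm.trans (this.trans (derivΦ_evalField hp l φ _))

/-- Bilinearity and alternation come from the bilinear map `deriveLM`. Jacobi holds because vector
fields act faithfully on functions, and commutators of operators satisfy it. -/
lemma isLieBracket_bracketΦ :
    IsLieBracket (bracketΦ : smoothMaps (FieldsOn A M) (TFieldsOn A M) → _ → _) := by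
  have e : ∀ 𝔛 𝔜 : smoothMaps (FieldsOn A M) (TFieldsOn A M),
      bracketΦ 𝔛 𝔜 = deriveLM 𝔛 𝔜 - deriveLM 𝔜 𝔛 := fun _ _ => rfl
  refine ⟨fun x y z => ?_, fun x y z => ?_, fun a x y => ?_, fun a x y => ?_, fun x => ?_,
    fun x y z => ?_⟩
  · simp only [e, map_add, LinearMap.add_apply]; abel
  · simp only [e, map_add, LinearMap.add_apply]; abel
  · simp only [e, map_smul, LinearMap.smul_apply, smul_sub]
  · simp only [e, map_smul, LinearMap.smul_apply, smul_sub]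
  · simp [e]
  · refine vectorField_ext fun F => ?_
    change deriveLM _ F = deriveLM 0 F
    have h : ∀ (𝔛 𝔜 : smoothMaps (FieldsOn A M) (TFieldsOn A M))
      (F : smoothMaps (FieldsOn A M) ℝ), deriveLM (bracketΦ 𝔛 𝔜) F =
      deriveLM 𝔛 (deriveLM 𝔜 F) - deriveLM 𝔜 (deriveLM 𝔛 F) := deriveAlong_bracketΦ
    simp only [map_add, LinearMap.add_apply, h, map_sub, map_zero, LinearMap.zero_apply]
    abel

end Derivations

/-! ### Lie derivatives in parametrizations and the pullback formula -/

section LieDerivatives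

lemma jet_congr {f g : E → E} {u : E} (h : f =ᶠ[𝓝 u] g) : jet r f u = jet r g u :=
  funext fun _ => (EventuallyEq.iteratedFDeriv (𝕜 := ℝ) h _).self_of_nhds

lemma fderiv_euler_isInvertible (Y : E → E) (u : E) :
    (fderiv ℝ ((fun (τ : ℝ) (w : E) => w + τ • Y w) 0) u).IsInvertible := by
  have h0 : (fun w : E => w + (0 : ℝ) • Y w) = id := by ext; simp
  simp only [h0, fderiv_id]
  exact ⟨ContinuousLinearEquiv.refl ℝ E, rfl⟩

/-- The Lie derivative in the parametrization `q`, in terms of the parametrization `p`. -/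
lemma lieDeriv_eq_variation {s : (E → M) → E → V} (hs : IsSection A s) (X : VecField E M)
    {p q : E → M} {f : E → E} {u : E} (hp : IsParam p (f u)) (hf : IsLocDiffeo f u)
    (hq : q =ᶠ[𝓝 u] p ∘ f) :
    lieDeriv X s q u = variation A s p (jet r f u) (f u) (jet r (coord X p ∘ f) u)
      (coord X p (f u)) := by
  have : CompleteSpace E := FiniteDimensional.complete ℝ E
  have hqp := hp.comp hf hq
  have hfc : ContinuousAt f u := hf.1.self_of_nhds.continuousAt
  have hYq : ∀ᶠ w in 𝓝 u, ContDiffAt ℝ ∞ (coord X q) w :=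
    hqp.eventually.mono fun w hw => contDiffAt_coord X hw
  -- The curve defining `𝔏_X s` in `q`, read in `p`. It starts at `f`, and by naturality of the
  -- components of `X` its velocity is `coord X p ∘ f`.
  let κ : ℝ → E → E := fun τ w => f (w + τ • coord X q w)
  have e1 : κ 0 = f := by ext w; simp [κ]
  have hc : ContinuousAt (uncurry fun (τ : ℝ) (w : E) => w + τ • coord X q w) ((0 : ℝ), u) :=
    (contDiffAt_euler hYq.self_of_nhds 0).continuousAt
  have hκ : ∀ᶠ z in 𝓝 ((0 : ℝ), u), ContDiffAt ℝ ∞ (uncurry κ) z := by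
    have hc' : ∀ᶠ z in 𝓝 ((0 : ℝ), u), ContDiffAt ℝ ∞ f (z.2 + z.1 • coord X q z.2) :=
      hc.eventually (by simpa using hf.1)
    filter_upwards [eventually_euler hYq, hc'] with z h1 h2
    exact ContDiffAt.comp (g := f) z h2 h1
  have hfd : ∀ᶠ w in 𝓝 u, deriv (fun t => κ t w) 0 = (coord X p ∘ f) w := by
    filter_upwards [hf.eventually, hfc.eventually hp.eventually, hq.eventually_nhds]
      with w h1 h2 h3
    have hd : HasDerivAt (fun τ : ℝ => w + τ • coord X q w) (coord X q w) 0 := by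
      simpa using ((hasDerivAt_id (0 : ℝ)).smul_const (coord X q w)).const_add w
    have hfw : HasFDerivAt f (fderiv ℝ f w) (w + (0 : ℝ) • coord X q w) := by
      simpa using (h1.1.self_of_nhds.differentiableAt (by simp)).hasFDerivAt
    exact (hfw.comp_hasDerivAt (0 : ℝ) hd).deriv.trans (coord_comp X h2 h1 h3)
  have hjet : jet r (fun w => deriv (fun t => κ t w) 0) u = jet r (coord X p ∘ f) u :=
    jet_congr hfd
  have D1 := hasDerivAt_family hs (c := p) hκ (by rw [e1]; exact hf.2) (by rw [e1]; exact hp)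
    (P := fun τ => q ∘ fun w => w + τ • coord X q w) (by
      have hu : u + (0 : ℝ) • coord X q u = u := by simp
      have h : ∀ᶠ z in 𝓝 ((0 : ℝ), u), q (z.2 + z.1 • coord X q z.2) =
          (p ∘ f) (z.2 + z.1 • coord X q z.2) :=
        Tendsto.eventually (f := fun z : ℝ × E => z.2 + z.1 • coord X q z.2) hc
          (p := fun w => q w = (p ∘ f) w) (by simp only [uncurry]; rw [hu]; exact hq)
      have h' := ((Continuous.prodMk_left u).tendsto (0 : ℝ)).eventually h.eventually_nhds
      exact h'.mono fun t ht => ((Continuous.prodMk_right t).tendsto u).eventually ht)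
  rw [e1, hjet, hfd.self_of_nhds] at D1
  rw [lieDeriv, if_pos hqp, D1.deriv]
  rfl

/-- Read in a chart, `ψ_τ ∘ p` is a family of local diffeomorphisms whose initial value and initial
velocity field agree with those of the family defining `𝔏_X s`. The derivative of the components
depends only on these two data and their jets. -/
lemma hasDerivAt_pullback {s : (E → M) → E → V} (hs : IsSection A s) (X : VecField E M)
    {ψ : ℝ → M → M}
    (hψ : ContMDiff (𝓘(ℝ, ℝ).prod 𝓘(ℝ, E)) 𝓘(ℝ, E) ∞ (fun z : ℝ × M => ψ z.1 z.2))
    (h0 : ∀ x, ψ 0 x = x)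
    (hX : ∀ x, HasMFDerivAt 𝓘(ℝ, ℝ) 𝓘(ℝ, E) (fun τ => ψ τ x) 0
        ((1 : ℝ →L[ℝ] ℝ).smulRight (X (ψ 0 x))))
    {p : E → M} {u : E} (hp : IsParam p u) :
    HasDerivAt (fun τ => s (ψ τ ∘ p) u) (lieDeriv X s p u) 0 := by
  have : CompleteSpace E := FiniteDimensional.complete ℝ E
  let e := extChartAt 𝓘(ℝ, E) (p u)
  let κ : ℝ → E → E := fun τ w => e (ψ τ (p w))
  have hx : p u ∈ e.source := mem_extChartAt_source _
  have hes : IsOpen e.source := isOpen_extChartAt_source (p u)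
  have hκ0 : κ 0 = e ∘ p := by ext w; simp [κ, h0]
  have hloc : IsLocDiffeo (e ∘ p) u :=
    ⟨(eventually_smooth_chart hp.1 hx).mono fun w hw => hw.2, (isParam_iff_chart hp.1 hx).1 hp.2⟩
  have hc : IsParam e.symm ((e ∘ p) u) := isParam_chart_symm hx
  have hF : ∀ᶠ z in 𝓝 ((0 : ℝ), u), ContMDiffAt 𝓘(ℝ, ℝ × E) 𝓘(ℝ, E) ∞
      (fun z : ℝ × E => ψ z.1 (p z.2)) z := by
    filter_upwards [(continuous_snd.tendsto ((0 : ℝ), u)).eventually hp.1] with z hz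
    have h1 : ContMDiffAt 𝓘(ℝ, ℝ × E) (𝓘(ℝ, ℝ).prod 𝓘(ℝ, E)) ∞
        (fun z : ℝ × E => (z.1, p z.2)) z := by
      rw [modelWithCornersSelf_prod, ← chartedSpaceSelf_prod]
      exact contMDiffAt_fst.prodMk (hz.comp z contMDiffAt_snd)
    exact hψ.contMDiffAt.comp z h1
  have hsrc : ∀ᶠ z in 𝓝 ((0 : ℝ), u), ψ z.1 (p z.2) ∈ e.source :=
    hF.self_of_nhds.continuousAt.eventually (hes.mem_nhds (by simpa [h0] using hx))
  have hκ : ∀ᶠ z in 𝓝 ((0 : ℝ), u), ContDiffAt ℝ ∞ (uncurry κ) z := by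
    filter_upwards [hF, hsrc] with z h1 h2
    rw [← contMDiffAt_iff_contDiffAt]
    exact (contMDiffAt_extChartAt' (n := ∞) (by simpa [e] using h2)).comp z h1
  -- For small times the curve stays in a single chart domain, near `u` and uniformly in the point.
  have hP : ∀ᶠ t in 𝓝 (0 : ℝ), ψ t ∘ p =ᶠ[𝓝 u] e.symm ∘ κ t := by
    have h' := ((Continuous.prodMk_left u).tendsto (0 : ℝ)).eventually hsrc.eventually_nhds
    refine h'.mono fun t ht => (((Continuous.prodMk_right t).tendsto u).eventually ht).mono
      fun w hw => (e.left_inv hw).symm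
  have hpe : p =ᶠ[𝓝 u] e.symm ∘ (e ∘ p) := by
    filter_upwards [eventually_smooth_chart hp.1 hx] with w hw using (e.left_inv hw.1).symm
  have hd : ∀ᶠ w in 𝓝 u, deriv (fun t => κ t w) 0 = (coord X e.symm ∘ (e ∘ p)) w := by
    filter_upwards [hp.eventually, eventually_smooth_chart hp.1 hx, hpe.eventually_nhds,
      hloc.eventually, hloc.1.self_of_nhds.continuousAt.eventually hc.eventually]
      with w h1 h2 h3 h4 h5
    have h6 := coord_comp X h5 h4 h3
    have hm : MDifferentiableAt 𝓘(ℝ, E) 𝓘(ℝ, E) e (p w) :=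
      (contMDiffAt_extChartAt' (n := ∞) (by simpa [e] using h2.1)).mdifferentiableAt (by simp)
    have h7 : fderiv ℝ (e ∘ p) w (coord X p w) =
        (mfderiv 𝓘(ℝ, E) 𝓘(ℝ, E) e (p w) : E →L[ℝ] E) (X (p w)) := by
      rw [← mfderiv_eq_fderiv, mfderiv_comp w hm h1.mdifferentiableAt]
      exact congrArg (mfderiv 𝓘(ℝ, E) 𝓘(ℝ, E) e (p w) : E →L[ℝ] E) (mfderiv_coord X h1)
    have hm' : HasMFDerivAt 𝓘(ℝ, E) 𝓘(ℝ, E) e (ψ 0 (p w))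
        (mfderiv 𝓘(ℝ, E) 𝓘(ℝ, E) e (ψ 0 (p w))) := by
      rw [h0]; exact hm.hasMFDerivAt
    -- An opaque copy of the derivative of the chart, with values in a type independent of the base
    -- point, so that `ψ 0 (p w)` can be replaced by `p w`.
    obtain ⟨D, hD⟩ : ∃ D : M → E →L[ℝ] E, ∀ y, D y = mfderiv 𝓘(ℝ, E) 𝓘(ℝ, E) e y :=
      ⟨fun y => mfderiv 𝓘(ℝ, E) 𝓘(ℝ, E) e y, fun _ => rfl⟩
    have h8 : HasFDerivAt (fun t => κ t w)
        ((D (ψ 0 (p w))).comp ((1 : ℝ →L[ℝ] ℝ).smulRight (X.at (ψ 0 (p w))))) 0 := by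
      rw [hD]; exact (hm'.comp (0 : ℝ) (hX (p w))).hasFDerivAt
    rw [h8.hasDerivAt.deriv, comp_apply, ← h6, h7, h0]
    refine Eq.trans ?_ (congrArg (fun L : E →L[ℝ] E => L (X.at (p w))) (hD (p w)))
    simp
  have hjet : jet r (fun w => deriv (fun t => κ t w) 0) u = jet r (coord X e.symm ∘ (e ∘ p)) u :=
    jet_congr hd
  have D := hasDerivAt_family hs hκ (by rw [hκ0]; exact hloc.2) (by rw [hκ0]; exact hc) hP
  rw [hκ0, hjet, hd.self_of_nhds] at D
  rw [lieDeriv_eq_variation hs X hc hloc hpe]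
  exact D

/-! ### Second Lie derivatives and their commutator -/

lemma isInvertible_linPart_jet_id (u : E) : (linPart (jet r id u)).IsInvertible := by
  rw [linPart_jet, fderiv_id]; exact ⟨ContinuousLinearEquiv.refl ℝ E, rfl⟩

/-- The action of jets on the values of the section `s`. -/
noncomputable def jetMap (A : AffineJetAction E V r) (s : (E → M) → E → V) (p : E → M)
    (z : Jet E r × E) : V :=
  A.act z.1 (s p z.2)

lemma contDiffAt_jetMap {s : (E → M) → E → V} (hs : IsSection A s) {p : E → M} {j : Jet E r}
    {x : E} (hj : (linPart j).IsInvertible) (hx : IsParam p x) :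
    ContDiffAt ℝ ∞ (jetMap A s p) (j, x) :=
  (A.contDiffAt (q := (j, s p x)) hj).comp (j, x)
    (f := fun z : Jet E r × E => (z.1, s p z.2))
    (contDiffAt_fst.prodMk ((hs.smooth p x hx).comp (j, x) contDiffAt_snd))

/-- The chain rule. Collecting the dependence on jet and point in the one map `jetMap` makes the
symmetry of its second derivative available. -/
lemma variation_eq_fderiv {s : (E → M) → E → V} (hs : IsSection A s) {p : E → M} {j : Jet E r}
    {x : E} (hj : (linPart j).IsInvertible) (hx : IsParam p x) (dj : Jet E r) (dx : E) :
    variation A s p j x dj dx = fderiv ℝ (jetMap A s p) (j, x) (dj, dx) := by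
  have h1 := ((A.contDiffAt (q := (j, s p x)) hj).differentiableAt (by simp)).hasFDerivAt
  have h2 := ((hs.smooth p x hx).differentiableAt (by simp)).hasFDerivAt
  have h3 := h1.comp (j, x) (f := fun z : Jet E r × E => (z.1, s p z.2))
    (hasFDerivAt_fst.prodMk (h2.comp (j, x) hasFDerivAt_snd))
  exact (congrArg (fun L => L (dj, dx)) h3.fderiv).symm

/-- Time and space derivatives commute, so the jets of a family move with the jet of its velocity.
-/
lemma hasDerivAt_jet_prodMk {κ : ℝ → E → E} {u : E} {v : E → E}
    (hκ : ∀ᶠ z in 𝓝 ((0 : ℝ), u), ContDiffAt ℝ ∞ (uncurry κ) z)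
    (hv : ∀ᶠ w in 𝓝 u, deriv (fun t => κ t w) 0 = v w) :
    HasDerivAt (fun τ => (jet r (κ τ) u, κ τ u)) (jet r v u, v u) 0 := by
  have hline : ∀ᶠ w in 𝓝 u, ContDiffAt ℝ ∞ (uncurry κ) ((0 : ℝ), w) :=
    (Continuous.prodMk_right (0 : ℝ)).tendsto u |>.eventually hκ
  rw [← jet_congr hv, ← hv.self_of_nhds]
  refine HasDerivAt.prodMk (hasDerivAt_pi.2 fun i => hasDerivAt_iteratedFDeriv κ _ 0 u hline) ?_
  exact ((hκ.self_of_nhds.comp (0 : ℝ) (f := fun t : ℝ => (t, u))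
    (contDiffAt_id.prodMk contDiffAt_const)).differentiableAt (by simp)).hasDerivAt

lemma hasDerivAt_fderiv_apply {H K : Type*} [NormedAddCommGroup H] [NormedSpace ℝ H]
    [NormedAddCommGroup K] [NormedSpace ℝ K] {G : H → K} {z v : ℝ → H} {z₀ z' v₀ v' : H}
    (hG : ContDiffAt ℝ ∞ G z₀) (hz : HasDerivAt z z' 0) (hv : HasDerivAt v v' 0) (hz₀ : z 0 = z₀)
    (hv₀ : v 0 = v₀) : HasDerivAt (fun τ => fderiv ℝ G (z τ) (v τ))
      (fderiv ℝ (fderiv ℝ G) z₀ z' v₀ + fderiv ℝ G z₀ v') 0 := by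
  subst hz₀ hv₀
  exact (((hG.fderiv_right (m := ∞) (by simp)).differentiableAt
    (by simp)).hasFDerivAt.comp_hasDerivAt (0 : ℝ) hz).clm_apply hv

/-- With `a_τ(w) = w + τ X(w)`, the components of `𝔏_Y s` in `p ∘ a_τ` are `DG` at the jet and value
of `a_τ`, applied to the jet and value of `Y ∘ a_τ`. The product rule at `τ = 0` gives the two
terms: the base point moves with velocity `X`, the argument with velocity `DY(X)`. -/
lemma lieDeriv_lieDeriv {s : (E → M) → E → V} (hs : IsSection A s) (X Y : VecField E M)
    {p : E → M} {u : E} (hp : IsParam p u) :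
    lieDeriv X (lieDeriv Y s) p u =
      fderiv ℝ (fderiv ℝ (jetMap A s p)) (jet r id u, u)
        (jet r (coord X p) u, coord X p u) (jet r (coord Y p) u, coord Y p u) +
      variation A s p (jet r id u) u (jet r (fun w => fderiv ℝ (coord Y p) w (coord X p w)) u)
        (fderiv ℝ (coord Y p) u (coord X p u)) := by
  have : CompleteSpace E := FiniteDimensional.complete ℝ E
  have hX : ∀ᶠ w in 𝓝 u, ContDiffAt ℝ ∞ (coord X p) w :=
    hp.eventually.mono fun w hw => contDiffAt_coord X hw
  have hY : ∀ᶠ w in 𝓝 u, ContDiffAt ℝ ∞ (coord Y p) w :=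
    hp.eventually.mono fun w hw => contDiffAt_coord Y hw
  have ha := eventually_euler hX
  have ha' : ∀ τ w, HasDerivAt (fun τ : ℝ => w + τ • coord X p w) (coord X p w) τ := fun τ w => by
    simpa using ((hasDerivAt_id τ).smul_const (coord X p w)).const_add w
  have hdX : ∀ w, deriv (fun τ : ℝ => w + τ • coord X p w) 0 = coord X p w := fun w =>
    (ha' 0 w).deriv
  have ha0 : (fun w : E => w + (0 : ℝ) • coord X p w) = id := by ext; simp
  have hu : u + (0 : ℝ) • coord X p u = u := by simp
  have hYa : ∀ᶠ z in 𝓝 ((0 : ℝ), u), ContDiffAt ℝ ∞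
      (uncurry fun (τ : ℝ) (w : E) => coord Y p (w + τ • coord X p w)) z := by
    have h1 : ∀ᶠ z in 𝓝 ((0 : ℝ), u), ContDiffAt ℝ ∞ (coord Y p) (z.2 + z.1 • coord X p z.2) :=
      Tendsto.eventually (f := fun z : ℝ × E => z.2 + z.1 • coord X p z.2)
        (contDiffAt_euler hX.self_of_nhds 0).continuousAt (by simpa [uncurry] using hY)
    filter_upwards [ha, h1] with z h2 h3 using ContDiffAt.comp (g := coord Y p) z h3 h2
  have hdY : ∀ᶠ w in 𝓝 u, deriv (fun τ : ℝ => coord Y p (w + τ • coord X p w)) 0 =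
      fderiv ℝ (coord Y p) w (coord X p w) := by
    filter_upwards [hY] with w hw
    have hfw : HasFDerivAt (coord Y p) (fderiv ℝ (coord Y p) w) (w + (0 : ℝ) • coord X p w) := by
      simpa using (hw.differentiableAt (by simp)).hasFDerivAt
    exact (hfw.comp_hasDerivAt (0 : ℝ) (ha' 0 w)).deriv
  have D1 := hasDerivAt_jet_prodMk (r := r) ha (Eventually.of_forall hdX)
  have D2 := hasDerivAt_jet_prodMk (r := r) hYa hdY
  have hG0 := contDiffAt_jetMap hs (isInvertible_linPart_jet_id (r := r) u) hp
  have D3 := hasDerivAt_fderiv_apply (v₀ := (jet r (coord Y p) u, coord Y p u)) hG0 D1 D2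
    (by rw [ha0, hu]) (by simp only [zero_smul, add_zero])
  have hev : (fun τ : ℝ => lieDeriv Y s (p ∘ fun w => w + τ • coord X p w) u) =ᶠ[𝓝 0]
      fun τ => fderiv ℝ (jetMap A s p) (jet r (fun w => w + τ • coord X p w) u,
        u + τ • coord X p u) (jet r (fun w => coord Y p (w + τ • coord X p w)) u,
          coord Y p (u + τ • coord X p u)) := by
    have h1 : ∀ᶠ τ in 𝓝 (0 : ℝ), IsParam p (u + τ • coord X p u) :=
      Tendsto.eventually (f := fun τ : ℝ => u + τ • coord X p u) (ha' 0 u).continuousAt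
        (by simpa using hp.eventually)
    filter_upwards [eventually_isLocDiffeo ha (fderiv_euler_isInvertible _ u), h1] with τ h2 h3
    rw [lieDeriv_eq_variation (f := fun w => w + τ • coord X p w) hs Y h3 h2 EventuallyEq.rfl,
      variation_eq_fderiv hs (by rw [linPart_jet]; exact h2.2) h3]
    rfl
  have D4 := (hasDerivAt_lieDeriv (isSection_lieDeriv hs Y) X hp).deriv
  rw [lieDeriv_apply (isSection_lieDeriv hs Y) X hp, ← D4, hev.deriv_eq]
  rw [D3.deriv, variation_eq_fderiv hs (isInvertible_linPart_jet_id u) hp]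

/-- The commutator of Lie derivatives. -/
lemma lieDeriv_bracketM {s : (E → M) → E → V} (hs : IsSection A s) (X Y : VecField E M)
    {p : E → M} {u : E} (hp : IsParam p u) :
    lieDeriv (bracketM X Y) s p u =
      lieDeriv X (lieDeriv Y s) p u - lieDeriv Y (lieDeriv X s) p u := by
  have : CompleteSpace E := FiniteDimensional.complete ℝ E
  have hG := contDiffAt_jetMap hs (isInvertible_linPart_jet_id (r := r) u) hp
  have sym := (hG.of_le two_le_infty).isSymmSndFDerivAt (by simp)
  have hX := contDiffAt_coord X hp
  have hY := contDiffAt_coord Y hp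
  have hb := contDiffAt_coord (bracketM X Y) hp
  have hXY : ContDiffAt ℝ ∞ (fun w => fderiv ℝ (coord X p) w (coord Y p w)) u :=
    (hX.fderiv_right (m := ∞) (by simp)).clm_apply hY
  -- `DY(X) = [X, Y] + DX(Y)` on a neighbourhood, since the jets of both sides are compared. The
  -- Hessian terms are exchanged by `sym`, and linearity of the variation leaves only the bracket.
  have hev : (fun w => fderiv ℝ (coord Y p) w (coord X p w)) =ᶠ[𝓝 u]
      coord (bracketM X Y) p + fun w => fderiv ℝ (coord X p) w (coord Y p w) := by
    filter_upwards [hp.eventually] with w hw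
    simp [coord_bracketM X Y hw, VectorField.lieBracket]
  have hj : jet r (fun w => fderiv ℝ (coord Y p) w (coord X p w)) u =
      jet r (coord (bracketM X Y) p) u +
        jet r (fun w => fderiv ℝ (coord X p) w (coord Y p w)) u := by
    rw [← jet_add hb hXY]
    exact jet_congr hev
  have hu : fderiv ℝ (coord Y p) u (coord X p u) =
    coord (bracketM X Y) p u + fderiv ℝ (coord X p) u (coord Y p u) := hev.self_of_nhds
  rw [lieDeriv_lieDeriv hs X Y hp, lieDeriv_lieDeriv hs Y X hp, lieDeriv_apply hs _ hp, sym,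
    add_sub_add_left_eq_sub, hj, hu]
  simp only [variation, map_add (fderiv ℝ (s p) u), ← Prod.mk_add_mk,
    map_add (fderiv ℝ (fun q : Jet E r × V => A.act q.1 q.2) (jet r id u, s p u)),
    add_sub_cancel_right]

/-! ### Vertical vector fields -/

lemma lieDeriv_vadd (X : VecField E M) (h : TFieldsOn A M) (φ : FieldsOn A M) {p : E → M} {u : E}
    (hp : IsParam p u) :
    lieDeriv X (h +ᵥ φ).1 p u = lieDeriv X h.1 p u + lieDeriv X φ.1 p u := by
  have h1 := (hasDerivAt_lieDeriv h.2 X hp).differentiableAt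
  have h2 := (hasDerivAt_lieDeriv φ.2 X hp).differentiableAt
  simp only [lieDeriv, if_pos hp]
  exact deriv_fun_add h1 h2

lemma lieDeriv_smul (X : VecField E M) (a : ℝ) (h : TFieldsOn A M) {p : E → M} {u : E}
    (hp : IsParam p u) : lieDeriv X (a • h).1 p u = a • lieDeriv X h.1 p u := by
  have h1 := (hasDerivAt_lieDeriv h.2 X hp).differentiableAt
  simp only [lieDeriv, if_pos hp]
  exact deriv_fun_const_smul a h1

/-- At a point, the Lie derivative is a fixed continuous linear function of the jet and value of the
vector field, and these commute with velocities. -/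
lemma hasDerivAt_lieDeriv_velocity (φ : FieldsOn A M) {c : ℝ → VecField E M} (hc : IsFam c)
    {p : E → M} {u : E} (hp : IsParam p u) :
    HasDerivAt (fun t => lieDeriv (c t) φ.1 p u) (lieDeriv (velocity c) φ.1 p u) 0 := by
  have : CompleteSpace E := FiniteDimensional.complete ℝ E
  have hj := isFam_vecField.1 hc
  have h1 : ∀ᶠ w in 𝓝 u, ContDiffAt ℝ ∞ (uncurry fun t => coord (c t) p) ((0 : ℝ), w) :=
    hp.eventually.mono fun w hw => hj 0 trivial p w hw
  have h2 : HasDerivAt (fun t => jet r (coord (c t) p) u) (jet r (coord (velocity c) p) u) 0 := by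
    rw [show coord (velocity c) p = fun w => deriv (fun t => coord (c t) p w) 0 from
      funext fun w => coord_velocity hc p w]
    exact hasDerivAt_pi.2 fun i => hasDerivAt_iteratedFDeriv _ _ 0 u h1
  have h3 : HasDerivAt (fun t => coord (c t) p u) (coord (velocity c) p u) 0 := by
    rw [coord_velocity hc p u]
    exact ((contDiff_eval hj hp).contDiffAt.differentiableAt (by simp)).hasDerivAt
  have h4 := (fderiv ℝ (fun q : Jet E r × V => A.act q.1 q.2)
    (jet r id u, φ.1 p u)).hasFDerivAt.comp_hasDerivAt (0 : ℝ)
    (h2.prodMk ((fderiv ℝ (φ.1 p) u).hasFDerivAt.comp_hasDerivAt (0 : ℝ) h3))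
  rw [lieDeriv_apply φ.2 _ hp]
  simp only [lieDeriv_apply φ.2 _ hp]
  exact h4

/-- The derivative of a vertical vector field. -/
lemma derivΦ_vert (Y : smoothMaps (FieldsOn A M) (VecField E M)) (φ : FieldsOn A M)
    (h : TFieldsOn A M) {p : E → M} {u : E} (hp : IsParam p u) :
    (derivΦ (vert Y) φ h).1 p u =
      lieDeriv (derivΦ Y φ h) φ.1 p u + lieDeriv (Y.1 φ) h.1 p u := by
  have hc := (isFam_straight φ h).dSmooth_comp Y.2
  have h1 := hasDerivAt_lieDeriv_velocity φ hc hp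
  have h2 : DifferentiableAt ℝ (fun t : ℝ => lieDeriv (Y.1 ((t • h) +ᵥ φ)) h.1 p u) 0 :=
    (contDiff_eval (jointlySmoothOn_lieDeriv (A := A.lin) (c := fun _ : ℝ => h.1) (fun _ => h.2)
      (fun y _ p u hp => (h.2.smooth p u hp).comp (y, u) contDiffAt_snd)
      (isFam_vecField.1 hc)) hp).contDiffAt.differentiableAt (by simp)
  have h3 := (hasDerivAt_id (0 : ℝ)).smul h2.hasDerivAt
  -- At `t = 0` the derivative of the first summand is the coefficient of `t`; the second varies
  -- only through the vector field.
  have e : (fun t : ℝ => ((vert Y).1 ((t • h) +ᵥ φ)).1 p u) = fun t : ℝ =>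
      t • lieDeriv (Y.1 ((t • h) +ᵥ φ)) h.1 p u + lieDeriv (Y.1 ((t • h) +ᵥ φ)) φ.1 p u :=
    funext fun t => (lieDeriv_vadd _ _ _ hp).trans (by rw [lieDeriv_smul _ _ _ hp])
  refine (velocity_tField ((isFam_straight φ h).dSmooth_comp (vert Y).2) p u).trans ?_
  rw [e]
  refine (h3.add h1).deriv.trans ?_
  simp only [id, zero_smul, one_smul, zero_add, zero_tvadd, add_comm]
  rfl

lemma vert_add (X Y : smoothMaps (FieldsOn A M) (VecField E M)) :
    vert (X + Y) = vert X + vert Y :=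
  Subtype.ext (funext fun φ => map_add (lieAt φ) _ _)

lemma vert_smul (a : ℝ) (X : smoothMaps (FieldsOn A M) (VecField E M)) :
    vert (a • X) = a • vert X :=
  Subtype.ext (funext fun φ => map_smul (lieAt φ) a _)

/-- `X ↦ X^v` is a morphism of Lie algebras. -/
lemma bracketΦ_vert (X Y : smoothMaps (FieldsOn A M) (VecField E M)) :
    bracketΦ (vert X) (vert Y) = vert (extBracket X Y) := by
  refine Subtype.ext (funext fun φ => tFields_ext fun p u hp => ?_)
  have e : (vert (extBracket X Y)).1 φ = -lieAt φ (bracketM (X.1 φ) (Y.1 φ)) +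
      lieAt φ (derivΦ Y φ ((vert X).1 φ)) - lieAt φ (derivΦ X φ ((vert Y).1 φ)) := by
    rw [← map_neg, ← map_add, ← map_sub]; rfl
  rw [e]
  change (derivΦ (vert Y) φ ((vert X).1 φ)).1 p u - (derivΦ (vert X) φ ((vert Y).1 φ)).1 p u =
    -lieDeriv (bracketM (X.1 φ) (Y.1 φ)) φ.1 p u +
      lieDeriv (derivΦ Y φ ((vert X).1 φ)) φ.1 p u - lieDeriv (derivΦ X φ ((vert Y).1 φ)) φ.1 p u
  -- `D(Y^v)(X^v)` contributes `𝔏_Y 𝔏_X φ`, in this order, whence the sign of the bracket on `M`.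
  rw [derivΦ_vert _ _ _ hp, derivΦ_vert _ _ _ hp, lieDeriv_bracketM φ.2 _ _ hp]
  simp only [vert]
  abel

end LieDerivatives

/-! ### The pointwise bracket and the Lie algebra of field-dependent vector fields -/

section PointwiseBracket

lemma differentiableAt_coord (X : VecField E M) {p : E → M} {u : E} (hp : IsParam p u) :
    DifferentiableAt ℝ (coord X p) u :=
  (contDiffAt_coord X hp).differentiableAt (by simp)

lemma coord_add' (X Y : VecField E M) (p : E → M) : coord (X + Y) p = coord X p + coord Y p :=
  funext fun u => coord_add X Y p u

lemma coord_smul' (a : ℝ) (X : VecField E M) (p : E → M) : coord (a • X) p = a • coord X p :=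
  funext fun u => coord_smul a X p u

lemma bracketM_swap (X Y : VecField E M) : bracketM X Y = -bracketM Y X := by
  rw [← neg_one_smul ℝ]
  refine coord_injective fun p u hp => ?_
  rw [coord_smul, coord_bracketM _ _ hp, coord_bracketM _ _ hp, VectorField.lieBracket_swap]
  simp

lemma bracketM_add_right (X Y Z : VecField E M) :
    bracketM X (Y + Z) = bracketM X Y + bracketM X Z := by
  refine coord_injective fun p u hp => ?_
  rw [coord_add, coord_bracketM _ _ hp, coord_bracketM _ _ hp, coord_bracketM _ _ hp, coord_add',
    VectorField.lieBracket_add_right (differentiableAt_coord Y hp) (differentiableAt_coord Z hp)]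

lemma bracketM_smul_right (a : ℝ) (X Y : VecField E M) :
    bracketM X (a • Y) = a • bracketM X Y := by
  refine coord_injective fun p u hp => ?_
  rw [coord_smul, coord_bracketM _ _ hp, coord_bracketM _ _ hp, coord_smul',
    VectorField.lieBracket_const_smul_right (differentiableAt_coord Y hp)]

/-- The outer bracket differentiates the inner one, so the component formula is needed near `u`;
being a parametrization is an open condition. -/
lemma coord_bracketM_bracketM (X Y Z : VecField E M) {p : E → M} {u : E} (hp : IsParam p u) :
    coord (bracketM X (bracketM Y Z)) p u = VectorField.lieBracket ℝ (coord X p)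
      (VectorField.lieBracket ℝ (coord Y p) (coord Z p)) u := by
  have : CompleteSpace E := FiniteDimensional.complete ℝ E
  rw [coord_bracketM _ _ hp]
  exact EventuallyEq.lieBracket_vectorField_eq EventuallyEq.rfl
    (hp.eventually.mono fun w hw => coord_bracketM Y Z hw)

lemma bracketM_jacobi (X Y Z : VecField E M) : bracketM X (bracketM Y Z) +
    bracketM Y (bracketM Z X) + bracketM Z (bracketM X Y) = 0 := by
  have : CompleteSpace E := FiniteDimensional.complete ℝ E
  have h2 : ∀ X : VecField E M, ∀ {p : E → M} {u : E}, IsParam p u →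
      ContDiffAt ℝ (minSmoothness ℝ 2) (coord X p) u := fun X p u hp =>
    (contDiffAt_coord X hp).of_le (by simpa using two_le_infty)
  have h : bracketM X (bracketM Y Z) = -bracketM Z (bracketM X Y) +
      bracketM Y (bracketM X Z) := by
    rw [← bracketM_swap]
    refine coord_injective fun p u hp => ?_
    have h := VectorField.leibniz_identity_lieBracket le_rfl (h2 X hp) (h2 Y hp) (h2 Z hp)
    rw [coord_add, bracketM_swap (bracketM X Y), ← neg_one_smul ℝ, coord_smul,
      coord_bracketM_bracketM _ _ _ hp, coord_bracketM_bracketM _ _ _ hp,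
      coord_bracketM_bracketM _ _ _ hp, h, VectorField.lieBracket_swap (x := u)
        (V := VectorField.lieBracket ℝ (coord X p) (coord Y p))]
    simp
  rw [h, bracketM_swap Z X, ← neg_one_smul ℝ (bracketM X Z), bracketM_smul_right]
  simp

/-- The pointwise bracket of field dependent vector fields, as a bilinear map. -/
noncomputable def bracketPtLM : smoothMaps (FieldsOn A M) (VecField E M) →ₗ[ℝ]
    smoothMaps (FieldsOn A M) (VecField E M) →ₗ[ℝ] smoothMaps (FieldsOn A M) (VecField E M) :=
  LinearMap.mk₂ ℝ bracketPt
    (fun X Y Z => Subtype.ext (funext fun φ => by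
      change bracketM (X.1 φ + Y.1 φ) (Z.1 φ) = bracketM (X.1 φ) (Z.1 φ) + bracketM (Y.1 φ) (Z.1 φ)
      rw [bracketM_swap, bracketM_add_right, bracketM_swap (X.1 φ), bracketM_swap (Y.1 φ)]
      abel))
    (fun a X Y => Subtype.ext (funext fun φ => by
      change bracketM (a • X.1 φ) (Y.1 φ) = a • bracketM (X.1 φ) (Y.1 φ)
      rw [bracketM_swap, bracketM_smul_right, bracketM_swap (X.1 φ), smul_neg]))
    (fun X Y Z => Subtype.ext (funext fun _ => bracketM_add_right _ _ _))
    (fun a X Y => Subtype.ext (funext fun _ => bracketM_smul_right _ _ _))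

lemma bracketPtLM_swap (X Y : smoothMaps (FieldsOn A M) (VecField E M)) :
    bracketPtLM X Y = -bracketPtLM Y X :=
  Subtype.ext (funext fun _ => bracketM_swap _ _)

lemma bracketPtLM_jacobi (X Y Z : smoothMaps (FieldsOn A M) (VecField E M)) :
    bracketPtLM X (bracketPtLM Y Z) + bracketPtLM Y (bracketPtLM Z X) +
      bracketPtLM Z (bracketPtLM X Y) = 0 :=
  Subtype.ext (funext fun _ => bracketM_jacobi _ _ _)

lemma hasDerivAt_fderiv_coord {c c' : ℝ → VecField E M} (hc : IsFam c) (hc' : IsFam c')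
    {p : E → M} {u : E} (hp : IsParam p u) :
    HasDerivAt (fun t => fderiv ℝ (coord (c t) p) u (coord (c' t) p u))
      (fderiv ℝ (coord (velocity c) p) u (coord (c' 0) p u) +
        fderiv ℝ (coord (c 0) p) u (coord (velocity c') p u)) 0 := by
  have h1 := hasDerivAt_fderiv_swap (fun t => coord (c t) p) 0 u
    (isFam_vecField.1 hc 0 trivial p u hp)
  rw [show (fun w => deriv (fun t => coord (c t) p w) 0) = coord (velocity c) p from
    funext fun w => (coord_velocity hc p w).symm] at h1
  have h2 := ((contDiff_eval (isFam_vecField.1 hc') hp).contDiffAt (x := 0)).differentiableAt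
    (by simp) |>.hasDerivAt
  rw [← coord_velocity hc' p u] at h2
  exact h1.clm_apply h2

/-- The derivative along a vector field is a derivation of the pointwise bracket. -/
lemma deriveLM_bracketPtLM (𝔛 : smoothMaps (FieldsOn A M) (TFieldsOn A M))
    (Y Z : smoothMaps (FieldsOn A M) (VecField E M)) :
    deriveLM 𝔛 (bracketPtLM Y Z) =
      bracketPtLM (deriveLM 𝔛 Y) Z + bracketPtLM Y (deriveLM 𝔛 Z) := by
  refine Subtype.ext (funext fun φ => coord_injective fun p u hp => ?_)
  have hc := isFam_straight φ (𝔛.1 φ)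
  -- In components the bracket is `DZ(Y) - DY(Z)`; each part obeys a product rule along the line
  -- through `φ` in the direction of `𝔛`.
  have h := (hasDerivAt_fderiv_coord (hc.dSmooth_comp Z.2) (hc.dSmooth_comp Y.2) hp).sub
    (hasDerivAt_fderiv_coord (hc.dSmooth_comp Y.2) (hc.dSmooth_comp Z.2) hp)
  have e := coord_velocity (hc.dSmooth_comp (bracketPt Y Z).2) p u
  simp only [bracketPt, coord_bracketM _ _ hp, VectorField.lieBracket] at e
  refine e.trans (h.deriv.trans ?_)
  simp only [zero_smul, zero_tvadd]
  change _ = coord (bracketM (derivΦ Y φ (𝔛.1 φ)) (Z.1 φ) + bracketM (Y.1 φ) (derivΦ Z φ (𝔛.1 φ)))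
    p u
  rw [coord_add, coord_bracketM _ _ hp, coord_bracketM _ _ hp]
  simp only [VectorField.lieBracket]
  change fderiv ℝ (coord (derivΦ Z φ (𝔛.1 φ)) p) u _ + fderiv ℝ _ u (coord (derivΦ Y φ (𝔛.1 φ)) p u) -
    (fderiv ℝ (coord (derivΦ Y φ (𝔛.1 φ)) p) u _ +
      fderiv ℝ _ u (coord (derivΦ Z φ (𝔛.1 φ)) p u)) = _
  abel

/-- The bracket of an action Lie algebroid: if `ρ` is an action by derivations of the Lie bracket
`-B` which is compatible with the bracket `-B(x, y) + ρ(x) y - ρ(y) x`, the latter is a Lie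
bracket. -/
lemma isLieBracket_of_action {L : Type*} [AddCommGroup L] [Module ℝ L] (B ρ : L →ₗ[ℝ] L →ₗ[ℝ] L)
    {b : L → L → L} (hb : ∀ x y, b x y = -B x y + ρ x y - ρ y x)
    (swap : ∀ x y, B x y = -B y x)
    (jacobi : ∀ x y z, B x (B y z) + B y (B z x) + B z (B x y) = 0)
    (deriv : ∀ x y z, ρ x (B y z) = B (ρ x y) z + B y (ρ x z))
    (comm : ∀ x y z, ρ (b x y) z = ρ x (ρ y z) - ρ y (ρ x z)) : IsLieBracket b := by
  refine ⟨fun x y z => ?_, fun x y z => ?_, fun a x y => ?_, fun a x y => ?_, fun x => ?_,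
    fun x y z => ?_⟩
  · simp only [hb, map_add, LinearMap.add_apply]; abel
  · simp only [hb, map_add, LinearMap.add_apply]; abel
  · simp only [hb, map_smul, LinearMap.smul_apply, smul_sub, smul_add, smul_neg]
  · simp only [hb, map_smul, LinearMap.smul_apply, smul_sub, smul_add, smul_neg]
  · have h : B x x = 0 := by
      have := swap x x
      rwa [eq_neg_iff_add_eq_zero, ← two_smul ℝ, smul_eq_zero_iff_right two_ne_zero] at this
    simp [hb, h]
  -- In the cyclic sum, the terms with two actions cancel by `comm`, those with one action and one
  -- `B` by `deriv` and antisymmetry, and the terms `B x (B y z)` form the Jacobi sum of `B`, which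
  -- is put in place of the zero on the right.
  · rw [hb x (b y z), hb y (b z x), hb z (b x y), comm, comm, comm, ← jacobi x y z, hb, hb, hb]
    simp only [map_add, map_sub, map_neg, deriv]
    rw [swap (ρ x y) z, swap (ρ y z) x, swap (ρ z x) y]
    have h0 := jacobi x y z
    have h1 : B z (B x y) = -B x (B y z) - B y (B z x) := by
      rw [eq_sub_iff_add_eq, eq_neg_iff_add_eq_zero, ← h0]; abel
    rw [h1]
    abel

/-- The map `X ↦ X^v`, as a linear map. -/
noncomputable def vertLM : smoothMaps (FieldsOn A M) (VecField E M) →ₗ[ℝ]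
    smoothMaps (FieldsOn A M) (TFieldsOn A M) where
  toFun := vert
  map_add' := vert_add
  map_smul' := vert_smul

/-- Here `ρ(X) = X^v(·)`. The compatibility of `ρ` with the extended bracket is the morphism
property of `X ↦ X^v` followed by the commutator formula for `bracketΦ`. -/
lemma isLieBracket_extBracket :
    IsLieBracket (extBracket : smoothMaps (FieldsOn A M) (VecField E M) → _ → _) :=
  isLieBracket_of_action bracketPtLM (deriveLM ∘ₗ vertLM) (fun _ _ => rfl) bracketPtLM_swap
    bracketPtLM_jacobi (fun _ => deriveLM_bracketPtLM _) fun X Y Z =>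
      (congrArg (fun 𝔛 => deriveAlong 𝔛 Z) (bracketΦ_vert X Y).symm).trans
        (deriveAlong_bracketΦ _ _ _)

end PointwiseBracket

/-! ### Insertions and the exterior derivative on `Φ` -/

section CartanCalculus

section Insertion

variable {W : Type*} [AddCommGroup W] [Module ℝ W] [DiffeologicalSpace W] [SmoothModule W]

lemma form_ext {k : ℕ} {α β : Form A M k W} (h : ∀ φ hs, α.1 φ hs = β.1 φ hs) : α = β :=
  Subtype.ext (funext fun φ => AlternatingMap.ext (h φ))

/-- The insertion of a vector field in a form. -/
noncomputable def insVF (𝔛 : smoothMaps (FieldsOn A M) (TFieldsOn A M)) {q : ℕ}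
    (α : Form A M (q + 1) W) : Form A M q W :=
  ⟨fun φ => (α.1 φ).curryLeft (𝔛.1 φ), fun n c h hc hh => by
    have := α.2 n c (Fin.cons (fun y => 𝔛.1 (c y)) h) hc (Fin.cases (𝔛.2 n c hc) hh)
    convert this using 2 with y
    refine congrArg (α.1 (c y)) (funext fun i => ?_)
    cases i using Fin.cases <;> rfl⟩

lemma insVF_apply (𝔛 : smoothMaps (FieldsOn A M) (TFieldsOn A M)) {q : ℕ}
    (α : Form A M (q + 1) W) (φ : FieldsOn A M) (hs : Fin q → TFieldsOn A M) :
    (insVF 𝔛 α).1 φ hs = α.1 φ (Fin.cons (𝔛.1 φ) hs) := rfl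

lemma formCast_formCast {k l m : ℕ} (e : k = l) (e' : l = m) (α : Form A M k W) :
    formCast e' (formCast e α) = formCast (e.trans e') α := by
  subst e e'; rfl

lemma formCast_add {k l : ℕ} (e : k = l) (α β : Form A M k W) :
    formCast e (α + β) = formCast e α + formCast e β := by
  subst e; rfl

lemma formCast_sub {k l : ℕ} (e : k = l) (α β : Form A M k W) :
    formCast e (α - β) = formCast e α - formCast e β := by
  subst e; rfl

lemma formCast_injective {k l : ℕ} (e : k = l) {α β : Form A M k W}
    (h : formCast e α = formCast e β) : α = β := by
  subst e; exact h

/-- For `k = 0` the summand is already alternating in its `q` arguments, so summing over the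
permutations multiplies it by `q!`, which the normalization `1 / (0! q!)` removes. -/
lemma insForm_ofMap (𝔛 : smoothMaps (FieldsOn A M) (TFieldsOn A M)) {q : ℕ}
    (α : Form A M (q + 1) W) :
    insForm (ofMap 𝔛) α = formCast (Nat.zero_add q).symm (insVF 𝔛 α) := by
  refine Subtype.ext (funext fun φ => ?_)
  have e : ((((AlternatingMap.toMultilinearMapLM ∘ₗ (α.1 φ).curryLeft).compMultilinearMap
        ((ofMap 𝔛).1 φ).toMultilinearMap).uncurrySum).domDomCongr finSumFinEquiv) =
      ((formCast (Nat.zero_add q).symm (insVF 𝔛 α)).1 φ).toMultilinearMap := by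
    ext v
    change (α.1 φ) (Fin.cons (𝔛.1 φ) fun i => v (finSumFinEquiv (.inr i))) =
      (α.1 φ) (Fin.cons (𝔛.1 φ) fun i => v (finCongr _ i))
    congr 2
    funext i
    congr 1
    ext
    simp
  change ((Nat.factorial 0 * q.factorial : ℝ)⁻¹) • MultilinearMap.alternatization _ = _
  rw [e, AlternatingMap.coe_alternatization]
  ext v
  simp only [AlternatingMap.smul_apply, Fintype.card_fin, Nat.zero_add, Nat.factorial_zero,
    Nat.cast_one, one_mul, ← Nat.cast_smul_eq_nsmul ℝ]
  exact inv_smul_smul₀ (Nat.cast_ne_zero.2 q.factorial_ne_zero) _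

end Insertion

lemma derivForm_add {k : ℕ} (α β : Form A M k ℝ) (φ : FieldsOn A M) :
    derivForm (α + β) φ = derivForm α φ + derivForm β φ := by
  ext h hs
  exact derivΦ_add (onConst α hs) (onConst β hs) φ h

lemma derivForm_smul {k : ℕ} (a : ℝ) (α : Form A M k ℝ) (φ : FieldsOn A M) :
    derivForm (a • α) φ = a • derivForm α φ := by
  ext h hs
  exact derivΦ_smul a (onConst α hs) φ h

lemma extDeriv_add {k : ℕ} (α β : Form A M k ℝ) :
    extDeriv (α + β) = extDeriv α + extDeriv β := by
  refine Subtype.ext (funext fun φ => ?_)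
  change AlternatingMap.alternatizeUncurryFin (derivForm (α + β) φ) = _
  rw [derivForm_add, AlternatingMap.alternatizeUncurryFin_add]
  rfl

lemma extDeriv_apply {k : ℕ} (α : Form A M k ℝ) (φ : FieldsOn A M)
    (hs : Fin (k + 1) → TFieldsOn A M) :
    (extDeriv α).1 φ hs =
      ∑ i : Fin (k + 1), (-1 : ℤ) ^ (i : ℕ) • derivΦ (onConst α (i.removeNth hs)) φ (hs i) :=
  AlternatingMap.alternatizeUncurryFin_apply _ _

/-- The derivative of a form along a constant vector field. -/
noncomputable def constDerivForm {k : ℕ} (α : Form A M k ℝ) (y : TFieldsOn A M) : Form A M k ℝ :=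
  ⟨fun φ => derivForm α φ y, fun n c h hc hh => by
    have hl := isFam_line (isFam_const y) (isPlot_iff_isFam.1 hc)
    have hα : IsFam fun z : ℝ × EuclideanSpace ℝ (Fin n) =>
        α.1 ((z.1 • y) +ᵥ c z.2) fun j => h j z.2 :=
      α.2 _ _ (fun j w => h j ((toEuclidean (E := ℝ × EuclideanSpace ℝ (Fin n))).symm
        w).2) hl fun j => (isPlot_iff_isFam.1 (hh j)).reparam (g := Prod.snd) contDiff_snd
    exact isPlot_iff_isFam.2 (LawfulVelocity.isFam_velocity hα)⟩

/-- The second derivative of a form. -/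
noncomputable def derivForm₂ {k : ℕ} (α : Form A M k ℝ) (φ : FieldsOn A M) :
    TFieldsOn A M →ₗ[ℝ] TFieldsOn A M →ₗ[ℝ] TFieldsOn A M [⋀^Fin k]→ₗ[ℝ] ℝ :=
  LinearMap.mk₂ ℝ (fun x y => derivForm (constDerivForm α y) φ x)
    (fun x x' y => map_add _ x x') (fun a x y => map_smul _ a x)
    (fun x y y' => by
      have e : constDerivForm α (y + y') = constDerivForm α y + constDerivForm α y' :=
        Subtype.ext (funext fun φ => map_add (derivForm α φ) y y')
      rw [e, derivForm_add, LinearMap.add_apply])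
    (fun a x y => by
      have e : constDerivForm α (a • y) = a • constDerivForm α y :=
        Subtype.ext (funext fun φ => map_smul (derivForm α φ) a y)
      rw [e, derivForm_smul, LinearMap.smul_apply])

lemma derivΦ_sum {ι : Type*} (s : Finset ι) (F : ι → smoothMaps (FieldsOn A M) ℝ)
    (φ : FieldsOn A M) (x : TFieldsOn A M) :
    derivΦ (∑ i ∈ s, F i) φ x = ∑ i ∈ s, derivΦ (F i) φ x := by
  classical
  induction s using Finset.induction_on with
  | empty => simpa using derivΦ_zero φ x
  | insert i s hi ih => rw [Finset.sum_insert hi, Finset.sum_insert hi, derivΦ_add, ih]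

lemma derivΦ_zsmul (a : ℤ) (F : smoothMaps (FieldsOn A M) ℝ) (φ : FieldsOn A M)
    (x : TFieldsOn A M) : derivΦ (a • F) φ x = a • derivΦ F φ x := by
  rw [← Int.cast_smul_eq_zsmul ℝ, derivΦ_smul, Int.cast_smul_eq_zsmul]

/-- Evaluated on constant fields, `dα` is a signed sum of smooth functions, ready to be
differentiated a second time. -/
lemma onConst_extDeriv {k : ℕ} (α : Form A M k ℝ) (hs : Fin (k + 1) → TFieldsOn A M) :
    onConst (extDeriv α) hs = ∑ i : Fin (k + 1), (-1 : ℤ) ^ (i : ℕ) •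
      onConst (constDerivForm α (hs i)) (i.removeNth hs) := by
  refine Subtype.ext (funext fun φ => (extDeriv_apply α φ hs).trans ?_)
  simp only [Submodule.coe_sum, Finset.sum_apply]
  rfl

/-- `d² = 0`. -/
lemma extDeriv_extDeriv {k : ℕ} (α : Form A M k ℝ) : extDeriv (extDeriv α) = 0 := by
  refine Subtype.ext (funext fun φ => ?_)
  -- `d²α` is the double alternatization of the second derivative of `α`, which vanishes because
  -- that derivative is symmetric.
  have e : derivForm (extDeriv α) φ = AlternatingMap.alternatizeUncurryFinLM ∘ₗ derivForm₂ α φ := by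
    ext x hs
    change derivΦ (onConst (extDeriv α) hs) φ x = _
    rw [onConst_extDeriv, derivΦ_sum]
    simp only [derivΦ_zsmul]
    exact (AlternatingMap.alternatizeUncurryFin_apply (derivForm₂ α φ x) hs).symm
  change AlternatingMap.alternatizeUncurryFin (derivForm (extDeriv α) φ) = 0
  rw [e]
  refine AlternatingMap.alternatizeUncurryFin_alternatizeUncurryFinLM_comp_of_symmetric
    fun x y => AlternatingMap.ext fun hs => ?_
  exact derivΦ_derivΦ_comm (onConst α hs) φ x y

/-! ### Cartan calculus along vector fields -/

/-- The Lie derivative of forms along a vector field. -/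
noncomputable def lieVF (𝔛 : smoothMaps (FieldsOn A M) (TFieldsOn A M)) :
    {q : ℕ} → Form A M q ℝ → Form A M q ℝ
  | 0, α => insVF 𝔛 (extDeriv α)
  | _ + 1, α => insVF 𝔛 (extDeriv α) + extDeriv (insVF 𝔛 α)

lemma insVF_add (𝔛 : smoothMaps (FieldsOn A M) (TFieldsOn A M)) {q : ℕ}
    (α β : Form A M (q + 1) ℝ) : insVF 𝔛 (α + β) = insVF 𝔛 α + insVF 𝔛 β := rfl

lemma insVF_zero (𝔛 : smoothMaps (FieldsOn A M) (TFieldsOn A M)) {q : ℕ} :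
    insVF 𝔛 (0 : Form A M (q + 1) ℝ) = 0 := rfl

lemma lieVF_add (𝔛 : smoothMaps (FieldsOn A M) (TFieldsOn A M)) {q : ℕ} (α β : Form A M q ℝ) :
    lieVF 𝔛 (α + β) = lieVF 𝔛 α + lieVF 𝔛 β := by
  cases q with
  | zero => simp only [lieVF, extDeriv_add, insVF_add]
  | succ q => simp only [lieVF, extDeriv_add, insVF_add]; abel

/-- By `d² = 0` both sides reduce to `d ι d α`. -/
lemma lieVF_extDeriv (𝔛 : smoothMaps (FieldsOn A M) (TFieldsOn A M)) {q : ℕ}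
    (α : Form A M q ℝ) : lieVF 𝔛 (extDeriv α) = extDeriv (lieVF 𝔛 α) := by
  cases q <;> simp [lieVF, extDeriv_add, extDeriv_extDeriv, insVF_zero]

lemma extDeriv_formCast {k l : ℕ} (e : k = l) (α : Form A M k ℝ) :
    extDeriv (formCast e α) = formCast (congrArg (· + 1) e) (extDeriv α) := by
  subst e; rfl

lemma lieForm_formCast {k l m : ℕ} (K : Form A M m (TFieldsOn A M)) (e : k = l)
    (α : Form A M k ℝ) : lieForm K (formCast e α) = formCast (congrArg (m + ·) e) (lieForm K α) := by
  subst e; rfl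

lemma lieForm_ofMap (𝔛 : smoothMaps (FieldsOn A M) (TFieldsOn A M)) {q : ℕ}
    (α : Form A M q ℝ) : lieForm (ofMap 𝔛) α = formCast (Nat.zero_add q).symm (lieVF 𝔛 α) := by
  cases q with
  | zero => exact insForm_ofMap 𝔛 (extDeriv α)
  | succ q =>
    -- The exponent is the integer `-1`; the sign turns the difference into Cartan's `ι d + d ι`.
    have h : (-1 : ℝ) ^ (((0 : ℕ) : ℤ) - 1) = -1 := by norm_num
    change insForm (ofMap 𝔛) (extDeriv α) -
      (-1 : ℝ) ^ (((0 : ℕ) : ℤ) - 1) • extDeriv (insForm (ofMap 𝔛) α) = _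
    rw [h, insForm_ofMap, insForm_ofMap, extDeriv_formCast, lieVF, formCast_add]
    refine form_ext fun φ hs => ?_
    change _ - (-1 : ℝ) * _ = _ + _
    ring

lemma lieAlong_eq_lieVF (𝔛 : smoothMaps (FieldsOn A M) (TFieldsOn A M)) {q : ℕ}
    (α : Form A M q ℝ) : lieAlong 𝔛 α = lieVF 𝔛 α := by
  rw [lieAlong, lieForm_ofMap, formCast_formCast]
  rfl

/-- Moving the first argument to slot `i` takes `i` transpositions. -/
lemma map_update_eq_cons {k : ℕ} (a : TFieldsOn A M [⋀^Fin (k + 1)]→ₗ[ℝ] ℝ)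
    (hs : Fin (k + 1) → TFieldsOn A M) (i : Fin (k + 1)) (y : TFieldsOn A M) :
    (-1 : ℤ) ^ (i : ℕ) • a (Fin.cons y (i.removeNth hs)) = a (Function.update hs i y) := by
  rw [← Fin.insertNth_removeNth]
  exact (a.map_insertNth i y _).symm

lemma removeNth_succ_cons {X : Type*} {k : ℕ} (x : X) (hs : Fin (k + 1) → X) (i : Fin (k + 1)) :
    i.succ.removeNth (Fin.cons x hs : Fin (k + 2) → X) = Fin.cons x (i.removeNth hs) := by
  funext j
  cases j using Fin.cases <;> simp [Fin.removeNth]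

/-- The derivative of the insertion of a vector field in a form. -/
lemma derivΦ_onConst_insVF (𝔛 : smoothMaps (FieldsOn A M) (TFieldsOn A M)) {q : ℕ}
    (α : Form A M (q + 1) ℝ) (φ : FieldsOn A M) (hs : Fin q → TFieldsOn A M)
    (x : TFieldsOn A M) :
    derivΦ (onConst (insVF 𝔛 α) hs) φ x = derivΦ (onConst α (Fin.cons (𝔛.1 φ) hs)) φ x +
      α.1 φ (Fin.cons (derivΦ 𝔛 φ x) hs) := by
  refine derivΦ_pair (β := fun φ =>
    { toFun := fun h => α.1 φ (Fin.cons h hs)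
      map_add' := fun h h' => congrArg (fun a => a hs) (map_add (α.1 φ).curryLeft h h')
      map_smul' := fun a h => congrArg (fun a => a hs) (map_smul (α.1 φ).curryLeft a h) })
    (fun n c h hc hh => ?_) 𝔛 φ x
  have := α.2 n c (Fin.cons h fun i _ => hs i) hc (Fin.cases hh fun _ => isPlot_const)
  convert this using 2 with y
  refine congrArg (α.1 (c y)) (funext fun i => ?_)
  cases i using Fin.cases <;> rfl

/-- Cartan's formula, evaluated on constant vector fields. -/
lemma lieVF_apply (𝔛 : smoothMaps (FieldsOn A M) (TFieldsOn A M)) {q : ℕ} (α : Form A M q ℝ)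
    (φ : FieldsOn A M) (hs : Fin q → TFieldsOn A M) :
    (lieVF 𝔛 α).1 φ hs = derivΦ (onConst α hs) φ (𝔛.1 φ) +
      ∑ i, α.1 φ (Function.update hs i (derivΦ 𝔛 φ (hs i))) := by
  have h : (insVF 𝔛 (extDeriv α)).1 φ hs = derivΦ (onConst α hs) φ (𝔛.1 φ) +
      ∑ i : Fin q, (-1 : ℤ) ^ (i.succ : ℕ) • derivΦ (onConst α
        (i.succ.removeNth (Fin.cons (𝔛.1 φ) hs : Fin (q + 1) → TFieldsOn A M))) φ (hs i) := by
    rw [insVF_apply, extDeriv_apply, Fin.sum_univ_succ]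
    simp
  cases q with
  | zero =>
    change (insVF 𝔛 (extDeriv α)).1 φ hs = _
    rw [h]
    simp
  | succ q =>
    change (insVF 𝔛 (extDeriv α)).1 φ hs + (extDeriv (insVF 𝔛 α)).1 φ hs = _
    rw [h, extDeriv_apply, add_assoc, ← Finset.sum_add_distrib]
    congr 1
    refine Finset.sum_congr rfl fun i _ => ?_
    -- `hs i` sits in slot `i + 1` of `ι d` and slot `i` of `d ι`: the derivatives of `α` cancel,
    -- and the term in which `𝔛` is derived survives.
    rw [derivΦ_onConst_insVF, ← map_update_eq_cons, Fin.val_succ, pow_succ, mul_neg_one, neg_smul,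
      smul_add, removeNth_succ_cons]
    abel

/-- By `lieVF_apply`, the two sides differ only in the first slot: on the left `𝔜` is derived along
`𝔛`, on the right `𝔛` along `𝔜`. The difference is the bracket. -/
lemma lieVF_insVF (𝔛 𝔜 : smoothMaps (FieldsOn A M) (TFieldsOn A M)) {q : ℕ}
    (α : Form A M (q + 1) ℝ) :
    lieVF 𝔛 (insVF 𝔜 α) = insVF 𝔜 (lieVF 𝔛 α) + insVF (bracketΦ 𝔛 𝔜) α := by
  refine form_ext fun φ hs => ?_
  change (lieVF 𝔛 (insVF 𝔜 α)).1 φ hs = (lieVF 𝔛 α).1 φ (Fin.cons (𝔜.1 φ) hs) +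
    (α.1 φ).curryLeft (derivΦ 𝔜 φ (𝔛.1 φ) - derivΦ 𝔛 φ (𝔜.1 φ)) hs
  rw [lieVF_apply, lieVF_apply, derivΦ_onConst_insVF, Fin.sum_univ_succ, map_sub]
  simp only [AlternatingMap.sub_apply, AlternatingMap.curryLeft_apply_apply, Fin.cons_zero,
    Fin.cons_succ, Fin.update_cons_zero, ← Fin.cons_update, insVF_apply, Matrix.vecCons]
  abel

/-- The commutator of Lie derivatives of forms. -/
lemma lieVF_bracketΦ (𝔛 𝔜 : smoothMaps (FieldsOn A M) (TFieldsOn A M)) {q : ℕ}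
    (α : Form A M q ℝ) :
    lieVF 𝔛 (lieVF 𝔜 α) - lieVF 𝔜 (lieVF 𝔛 α) = lieVF (bracketΦ 𝔛 𝔜) α := by
  cases q with
  | zero =>
    refine sub_eq_iff_eq_add'.2 ((lieVF_insVF 𝔛 𝔜 (extDeriv α)).trans ?_)
    rw [lieVF_extDeriv]
    rfl
  | succ q =>
    -- `L_𝔛` is moved past `ι_𝔜` and `d` in both terms of `L_𝔜 = ι_𝔜 d + d ι_𝔜`. The result is `L_𝔜
    -- L_𝔛` plus the two terms of `L_[𝔛,𝔜]`.
    have h1 : lieVF 𝔛 (lieVF 𝔜 α) = insVF 𝔜 (extDeriv (lieVF 𝔛 α)) + insVF (bracketΦ 𝔛 𝔜)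
        (extDeriv α) + (extDeriv (insVF 𝔜 (lieVF 𝔛 α)) + extDeriv (insVF (bracketΦ 𝔛 𝔜) α)) := by
      rw [← extDeriv_add, ← lieVF_insVF, ← lieVF_extDeriv, ← lieVF_insVF, ← lieVF_extDeriv,
        ← lieVF_add]
      rfl
    have h2 : lieVF 𝔜 (lieVF 𝔛 α) = insVF 𝔜 (extDeriv (lieVF 𝔛 α)) +
      extDeriv (insVF 𝔜 (lieVF 𝔛 α)) := rfl
    have h3 : lieVF (bracketΦ 𝔛 𝔜) α = insVF (bracketΦ 𝔛 𝔜) (extDeriv α) +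
      extDeriv (insVF (bracketΦ 𝔛 𝔜) α) := rfl
    rw [h1, h2, h3]
    abel

/-! ### Frölicher-Nijenhuis and Nijenhuis-Richardson brackets in low degree -/

lemma eq_ofMap (N : Form A M 0 (TFieldsOn A M)) : N = ofMap (onConst N Fin.elim0) :=
  form_ext fun φ _ => congrArg (N.1 φ) (Subsingleton.elim _ _)

/-- The sign `(-1)^(0 * 0)` is `1`; the rest identifies the degrees `0 + (0 + q)` and `0 + 0 + q`
with `q`. -/
lemma isBracketFN_ofMap_iff (𝔛 𝔜 ℨ : smoothMaps (FieldsOn A M) (TFieldsOn A M)) :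
    IsBracketFN (ofMap 𝔛) (ofMap 𝔜) (ofMap ℨ) ↔
      ∀ (q : ℕ) (α : Form A M q ℝ), lieVF 𝔛 (lieVF 𝔜 α) - lieVF 𝔜 (lieVF 𝔛 α) = lieVF ℨ α := by
  refine forall_congr' fun q => forall_congr' fun α => ?_
  have h1 : ∀ 𝔛 𝔜 : smoothMaps (FieldsOn A M) (TFieldsOn A M),
      lieForm (ofMap 𝔛) (lieForm (ofMap 𝔜) α) =
      formCast (by simp) (lieVF 𝔛 (lieVF 𝔜 α)) := fun 𝔛 𝔜 => by
    rw [lieForm_ofMap 𝔜, lieForm_formCast, lieForm_ofMap, formCast_formCast]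
  have h2 : formCast (Nat.add_assoc 0 0 q) (lieForm (k := 0 + 0) (ofMap ℨ) α) =
      formCast (by simp) (lieVF ℨ α) := by
    change formCast _ (lieForm (k := 0) (ofMap ℨ) α) = _
    rw [lieForm_ofMap]
    exact formCast_formCast _ _ _
  rw [h1, h1, h2, formCast_formCast, Nat.zero_mul, pow_zero, one_smul, ← formCast_sub]
  exact ⟨formCast_injective _, fun h => by rw [h]⟩

lemma lieVF_ofMap (𝔛 : smoothMaps (FieldsOn A M) (TFieldsOn A M))
    (F : smoothMaps (FieldsOn A M) ℝ) : lieVF 𝔛 (ofMap F) = ofMap (deriveAlong 𝔛 F) :=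
  form_ext fun φ hs => by
    rw [lieVF_apply]
    simp
    rfl

/-- The Frölicher-Nijenhuis bracket of vector fields is the bracket of vector fields. -/
lemma isBracketFN_iff (𝔛 𝔜 : smoothMaps (FieldsOn A M) (TFieldsOn A M))
    (N : Form A M 0 (TFieldsOn A M)) :
    IsBracketFN (ofMap 𝔛) (ofMap 𝔜) N ↔ N = ofMap (bracketΦ 𝔛 𝔜) := by
  constructor
  · intro h
    rw [eq_ofMap N] at h ⊢
    rw [isBracketFN_ofMap_iff] at h
    refine congrArg ofMap (vectorField_ext fun F => Subtype.ext (funext fun φ => ?_))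
    -- Uniqueness needs only functions: on them `L_N` is the derivative along `N`.
    have h' := h 0 (ofMap F)
    rw [lieVF_bracketΦ, lieVF_ofMap, lieVF_ofMap] at h'
    exact (congrArg (fun β : Form A M 0 ℝ => β.1 φ Fin.elim0) h').symm
  · rintro rfl
    exact (isBracketFN_ofMap_iff _ _ _).2 fun q α => lieVF_bracketΦ 𝔛 𝔜 α

/-- Insertion into the `0`-form `𝔛` is zero, so the bracket reduces to `ι_𝔛 (dY)^v`, whose value at
`φ` is the Lie derivative of `φ` along `DY(𝔛)`. -/
lemma bracketNR_ofMap_vertD (𝔛 : smoothMaps (FieldsOn A M) (TFieldsOn A M))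
    (Y : smoothMaps (FieldsOn A M) (VecField E M)) :
    bracketNR (ofMap 𝔛) (vertD Y) = ofMap (vert (deriveAlong 𝔛 Y)) := by
  have h : bracketNR (ofMap 𝔛) (vertD Y) = insForm (q := 0) (ofMap 𝔛) (vertD Y) := by
    have h0 : insVec (vertD Y) (ofMap 𝔛) = 0 := rfl
    rw [bracketNR, h0]
    have h1 : formCast (A := A) (M := M) (by rw [Nat.add_comm] : 1 + 0 - 1 = 0 + 1 - 1)
      (0 : Form A M (1 + 0 - 1) (TFieldsOn A M)) = 0 := rfl
    rw [h1, smul_zero, sub_zero]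
    rfl
  rw [h, insForm_ofMap]
  exact form_ext fun φ hs => rfl

end CartanCalculus

end Fields

end FieldSpace

/-! ### The theorem -/

theorem mainTheorem3 {E : Type*} [NormedAddCommGroup E] [NormedSpace ℝ E] [FiniteDimensional ℝ E]
    {V : Type*} [NormedAddCommGroup V] [NormedSpace ℝ V] [FiniteDimensional ℝ V]
    {M : Type*} [TopologicalSpace M] [ChartedSpace E M] [IsManifold 𝓘(ℝ, E) ∞ M]
    {r : ℕ} (A : AffineJetAction E V r) :
    -- `X^v` at `φ` is the velocity of `ψ_τ^* φ`, for every smooth curve `ψ` of diffeomorphisms of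
    -- `M` which starts at the identity with velocity `X(φ)`
    (∀ (X : smoothMaps (FieldsOn A M) (VecField E M)) (φ : FieldsOn A M)
      (ψ : ℝ → M ≃ₘ^∞⟮𝓘(ℝ, E), 𝓘(ℝ, E)⟯ M),
      ContMDiff (𝓘(ℝ, ℝ).prod 𝓘(ℝ, E)) 𝓘(ℝ, E) ∞ (fun z : ℝ × M => ψ z.1 z.2) →
      (∀ x, ψ 0 x = x) →
      (∀ x, HasMFDerivAt 𝓘(ℝ, ℝ) 𝓘(ℝ, E) (fun τ => ψ τ x) 0
        ((1 : ℝ →L[ℝ] ℝ).smulRight (X.1 φ (ψ 0 x)))) →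
      ∀ (p : E → M) (u : E), IsParam p u →
        HasDerivAt (fun τ => (pullback (ψ τ) φ).val p u) (((vert X).1 φ).val p u) 0) ∧
    -- the extended bracket and the bracket of vector fields on `Φ` are Lie brackets
    IsLieBracket (extBracket : smoothMaps (FieldsOn A M) (VecField E M) → _ → _) ∧
    IsLieBracket (bracketΦ : smoothMaps (FieldsOn A M) (TFieldsOn A M) → _ → _) ∧
    -- `X ↦ X^v` is a morphism of Lie algebras
    (∀ X Y : smoothMaps (FieldsOn A M) (VecField E M), vert (X + Y) = vert X + vert Y) ∧
    (∀ (a : ℝ) (X : smoothMaps (FieldsOn A M) (VecField E M)), vert (a • X) = a • vert X) ∧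
    (∀ X Y : smoothMaps (FieldsOn A M) (VecField E M),
      bracketΦ (vert X) (vert Y) = vert (extBracket X Y)) ∧
    -- the extended bracket is the Frölicher-Nijenhuis bracket of vertical vector fields
    (∀ X Y : smoothMaps (FieldsOn A M) (VecField E M),
      (∀ N : Form A M 0 (TFieldsOn A M),
        IsBracketFN (ofMap (vert X)) (ofMap (vert Y)) N ↔ N = ofMap (vert (extBracket X Y))) ∧
      ofMap (vert (extBracket X Y)) = ofMap (vert (bracketDiff X Y)) +
        bracketNR (ofMap (vert X)) (vertD Y) - bracketNR (ofMap (vert Y)) (vertD X) ∧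
      bracketNR (ofMap (vert X)) (vertD Y) = ofMap (vert (deriveAlong (vert X) Y))) ∧
    -- the commutator of the Lie derivatives
    (∀ (X Y : smoothMaps (FieldsOn A M) (VecField E M)) (q : ℕ) (α : Form A M q ℝ),
      lieAlong (vert X) (lieAlong (vert Y) α) - lieAlong (vert Y) (lieAlong (vert X) α) =
        lieAlong (vert (extBracket X Y)) α) := by
  refine ⟨fun X φ ψ hψ h0 hX p u hp => hasDerivAt_pullback φ.2 (X.1 φ) (ψ := fun τ => ψ τ) hψ h0
    hX hp, isLieBracket_extBracket, isLieBracket_bracketΦ, vert_add, vert_smul, bracketΦ_vert,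
    fun X Y => ⟨fun N => ?_, ?_, bracketNR_ofMap_vertD _ _⟩, fun X Y q α => ?_⟩
  · rw [isBracketFN_iff, bracketΦ_vert]
  · rw [bracketNR_ofMap_vertD, bracketNR_ofMap_vertD]
    -- Once the Nijenhuis-Richardson brackets are evaluated, the formula is the linearity of `X ↦
    -- X^v` on the three terms of the extended bracket.
    exact congrArg ofMap ((map_sub vertLM _ _).trans (congrArg (· - _) (map_add vertLM _ _)))
  · simp only [lieAlong_eq_lieVF, ← bracketΦ_vert]
    exact lieVF_bracketΦ _ _ α
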